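/- Let $M=\mathbb R^5$ with coordinates $(x,y,z,p,q)$ (the second jet space, $p=z_x$, $q=z_{xx}$). A para-CR structure of type $(1,2,2)$ on $M$ is a class of coframes $(\omega^1,\dots,\omega^5)$ with integrable distributions $(\omega^1,\omega^2,\omega^3)^\perp$ and $(\omega^1,\omega^4,\omega^5)^\perp$, where two coframes are equivalent if they differ by an invertible matrix of functions $S$ with $S_{1j}=0$ for $j\ne1$ and $S_{ij}=S_{ji}=0$ for $i\in\{2,3\}$, $j\in\{4,5\}$. The flat structure, that of the system $z_y=\frac14z_x^2$, $z_{xxx}=0$, is the class of $(dz-p\,dx-\frac14p^2dy,\ dp-q\,dx-\frac12pq\,dy,\ dq-\frac12q^2dy,\ dx,\ dy)$, equivalently of $$\omega^1=-dz+p\,dx+\tfrac14p^2dy,\quad \omega^2=dp-q\,dx-\tfrac12pq\,dy,\quad \omega^3=-dq+\tfrac12q^2dy,\quad \omega^4=dx+\tfrac12p\,dy,\quad \omega^5=-\tfrac12dy .$$ Its local symmetries on an open set $V\subset M$ are the smooth maps $\psi:V\to M$ such that $(\psi^*\omega^i)$ is equivalent to $(\omega^i)$ on $V$. Let $J$ be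 the antidiagonal $5\times5$ matrix with entries $1,-1,1,-1,1$; it has signature $(3,2)$. Put $SO(3,2)=\{A\in SL(5,\mathbb R):A^TJA=J\}$ and $\mathfrak{so}(3,2)=\{X:X^TJ+JX=0\}$. Let $G$ be the set of all matrices $$U=\begin{pmatrix} \frac{e^{-\phi}}{r}&-\frac{e^{-\phi}(s\bar s+r^4 u)}{2r^3}&-\frac{\bar s}{r^2}&0&-\frac{e^\phi\bar s^2}{2r^3}\\ 0&re^{-\phi}&0&0&0\\0&\frac{se^{-\phi}}{r}&1&0&\frac{\bar se^{\phi}}{r}\\0&\frac{s^2e^{-\phi}}{2r^3}&\frac{s}{r^2}&\frac{e^{\phi}}{r}&\frac{e^{\phi}(s\bar s-r^4 u)}{2r^3}\\ 0&0&0&0&re^\phi\end{pmatrix},\qquad r,\phi,s,\bar s,u\in\mathbb R,\ r\neq0 .$$ **Theorem.** (0) The forms $\omega^i$ represent a para-CR structure of type $(1,2,2)$ and belong to the class of the system. (1) $G$ is a subgroup of $SO(3,2)$, and $(r,\phi,s,\bar s,u)\mapsto U$ is a smooth embedding (an injective immersion and a homeomorphism onto its image) of $\{r\ne0\}\subset\mathbb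 R^5$ with image $G$; so $G$ is a 5-dimensional Lie group. The parameters $(1,0,0,0,0)$ give the identity. (2) Let $\mathcal G=M\times G\to M$ be the 10-dimensional principal bundle with right action $(m,U)\cdot k=(m,k^{-1}U)$. There is a smooth coframe $(\theta^1,\dots,\theta^5,\Omega_1,\dots,\Omega_5)$ on $\mathcal G$ such that $(\theta^i)$ belongs at each point to the class of the pullbacks of $(\omega^i)$ to $\mathcal G$ and $$\begin{aligned} d\theta^1&=\theta^2\wedge\theta^4-\theta^1\wedge\Omega_1\\ d\theta^2&=\theta^3\wedge\theta^4+\theta^2\wedge(\Omega_2-\tfrac12\Omega_1)-\theta^1\wedge\Omega_3\\ d\theta^3&=2\theta^3\wedge\Omega_2-\theta^2\wedge\Omega_3\\ d\theta^4&=-\theta^2\wedge\theta^5-\theta^4\wedge(\tfrac12\Omega_1+\Omega_2)-\theta^1\wedge\Omega_4\\ d\theta^5&=-2\theta^5\wedge\Omega_2+\theta^4\wedge\Omega_4\\ d\Omega_1&=-\theta^4\wedge\Omega_3+\theta^2\wedge\Omega_4-\theta^1\wedge\Omega_5\\ d\Omega_2&=-\theta^3\wedge\theta^5-\tfrac12\theta^4\wedge\Omega_3-\tfrac12\theta^2\wedge\Omega_4\\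 d\Omega_3&=-(\tfrac12\Omega_1+\Omega_2)\wedge\Omega_3+\theta^3\wedge\Omega_4-\tfrac12\theta^2\wedge\Omega_5\\ d\Omega_4&=(\Omega_2-\tfrac12\Omega_1)\wedge\Omega_4+\theta^5\wedge\Omega_3-\tfrac12\theta^4\wedge\Omega_5\\ d\Omega_5&=-\Omega_1\wedge\Omega_5+2\Omega_3\wedge\Omega_4 . \end{aligned}$$ Along the identity section, $(\theta^i,\Omega_j)$ pulls back to $(\omega^1,\dots,\omega^5,0,q\,\omega^5,0,0,0)$. Moreover the coframe in (2) can be chosen such that (3), (5) and (6) hold as well. (3) (Local uniqueness.) Let $O\subset\mathbb R^{10}$ be nonempty, open and connected, $\pi:O\to M$ smooth, and $(\theta'^i,\Omega'_j)$ a smooth coframe on $O$ that satisfies the ten equations and is such that $(\theta'^i)$ belongs at each point to the class of $(\pi^*\omega^i)$. Then there are a unique sign $\varepsilon\in\{1,-1\}$ and a unique smooth map $\Phi:O\to\mathcal G$ over $M$ which pulls $(\theta^1,\dots,\theta^5,\Omega_1,\dots,\Omega_5)$ back to $(\varepsilon\theta'^1,\varepsilon\theta'^2,\varepsilon\theta'^3,\theta'^4,\varepsilon\theta'^5,\Omega'_1,\Omega'_2,\Omega'_3,\varepsilon\Omega'_4,\varepsilon\Omega'_5)$.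 (4) For arbitrary 1-forms $(\theta,\Omega)$ on $\mathbb R^{10}$ and any point at which they are differentiable, the ten equations hold at that point if and only if $d\omega+\omega\wedge\omega=0$ there, where $$\omega=\begin{pmatrix} \tfrac12\Omega_1-\Omega_2&-\tfrac12\Omega_5&\Omega_4&\theta^5&0\\ \theta^1&-\tfrac12\Omega_1-\Omega_2&\theta^4&0&\theta^5\\ \theta^2&-\Omega_3&0&\theta^4&-\Omega_4\\ \theta^3&0&-\Omega_3&\tfrac12\Omega_1+\Omega_2&-\tfrac12\Omega_5\\ 0&\theta^3&-\theta^2&\theta^1&-\tfrac12\Omega_1+\Omega_2 \end{pmatrix}.$$ (5) For the coframe on $\mathcal G$, $\omega$ is a flat $\mathfrak{so}(3,2)$-valued Cartan connection on $\mathcal G\to M$: it maps every tangent space isomorphically onto $\mathfrak{so}(3,2)$, it satisfies $R_k^*\omega=k^{-1}\omega k$ for $k\in G$, it takes the value $X$ on the fundamental vector field of each $X\in\mathrm{Lie}(G)$, and $d\omega+\omega\wedge\omega=0$. (6) (Symmetry group $SO(3,2)$.) Let $E=\mathrm{diag}(-1,1,1,1,-1)\in SO(3,2)$. The set $K=G\cup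 EG$ is a subgroup of $SO(3,2)$, and there is a smooth map $h:M\to SO(3,2)$ such that $H(m,U)=h(m)U^{-1}$ satisfies $dH=H\omega$ on $\mathcal G$ (so $\omega$ is the pullback by $H$ of the Maurer–Cartan form of $SO(3,2)$) and such that $\iota(m)=h(m)K$ is an open embedding of $M$ into $SO(3,2)/K$. Moreover: (a) if $V\subset M$ is open, $\psi:V\to M$ is a map, $A\in SO(3,2)$ and $\iota\circ\psi=A\cdot\iota$ on $V$, then $\psi$ is a local symmetry; (b) for every local symmetry $\psi$ on a nonempty connected open set $V\subset M$ there is a unique $A\in SO(3,2)$ with $\iota\circ\psi=A\cdot\iota$ on $V$; (c) give $SO(3,2)/K$ the para-CR structure with charts $m\mapsto A\cdot\iota(m)$, $A\in SO(3,2)$; then $SO(3,2)$ acts faithfully on $SO(3,2)/K$, and the homeomorphisms of $SO(3,2)/K$ that are local symmetries in all charts are exactly the maps $x\mapsto A\cdot x$ with $A\in SO(3,2)$. -/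

import Mathlib

open scoped ContDiff Matrix

noncomputable section

/-! ### Differential 1-forms on (open subsets of) normed spaces -/

/-- 1-forms on a real normed space. -/
abbrev OneForm (E : Type*) [NormedAddCommGroup E] [NormedSpace ℝ E] := E → (E →L[ℝ] ℝ)

/-- The wedge product of two covectors, `(α ∧ β)(v, w) = α(v) β(w) - α(w) β(v)`. -/
def wedge {E : Type*} [NormedAddCommGroup E] [NormedSpace ℝ E] (α β : E →L[ℝ] ℝ) :
    E → E → ℝ :=
  fun v w => α v * β w - α w * β v

infixl:70 " ⋏ " => wedge

/-- The exterior derivative of a 1-form, `dα(v, w) = (D_v α)(w) - (D_w α)(v)`. -/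
def extD {E : Type*} [NormedAddCommGroup E] [NormedSpace ℝ E] (α : OneForm E) (x : E) :
    E → E → ℝ :=
  fun v w => fderiv ℝ α x v w - fderiv ℝ α x w v

/-- `extD` is Mathlib's exterior derivative, specialised to 1-forms. -/
theorem extDeriv_eq_extD {E : Type*} [NormedAddCommGroup E] [NormedSpace ℝ E]
    (α : OneForm E) (x : E) (hα : DifferentiableAt ℝ α x) (v w : E) :
    extDeriv (fun y => ContinuousAlternatingMap.ofSubsingleton ℝ E ℝ (0 : Fin 1) (α y)) x ![v, w]
      = extD α x v w := by
  have h : DifferentiableAt ℝ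
      (fun y => ContinuousAlternatingMap.ofSubsingleton ℝ E ℝ (0 : Fin 1) (α y)) x :=
    (ContinuousAlternatingMap.ofSubsingletonLIE (𝕜 := ℝ) (E := E) (F := ℝ)
      (0 : Fin 1)).differentiable.differentiableAt.comp x hα
  rw [extDeriv_apply h]
  have e : ∀ u : E, fderiv ℝ (fun y => α y u) x = (fderiv ℝ α x).flip u := by
    intro u
    ext t
    rw [fderiv_clm_apply hα (differentiableAt_const u)]
    simp
  simp [Fin.sum_univ_two, Fin.removeNth, Fin.succAbove, extD, e, sub_eq_add_neg]

/-- The pullback of a 1-form by a map. -/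
def pullback {E F : Type*} [NormedAddCommGroup E] [NormedSpace ℝ E] [NormedAddCommGroup F]
    [NormedSpace ℝ F] (f : E → F) (α : OneForm F) : OneForm E :=
  fun x => (α (f x)).comp (fderiv ℝ f x)

/-! ### The flat para-CR structure -/

/-- The second jet space `M`, with coordinates `(x, y, z, p, q)`, `p = z_x`, `q = z_xx`. -/
abbrev JetSpace := Fin 5 → ℝ

/-- The differential of the `i`-th coordinate of the jet space. -/
def dX (i : Fin 5) : JetSpace →L[ℝ] ℝ := ContinuousLinearMap.proj i

/-- The contact forms of the system `z_y = (1/4) z_x ^ 2`, `z_xxx = 0`, followed by `dx`, `dy`. -/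
def pdeForms : Fin 5 → OneForm JetSpace :=
  ![fun m => dX 2 - m 3 • dX 0 - (1 / 4 * m 3 ^ 2) • dX 1,
    fun m => dX 3 - m 4 • dX 0 - (1 / 2 * m 3 * m 4) • dX 1,
    fun m => dX 4 - (1 / 2 * m 4 ^ 2) • dX 1,
    fun _ => dX 0,
    fun _ => dX 1]

/-- The representative `(ω¹, …, ω⁵)` of the flat para-CR structure. -/
def flatForms : Fin 5 → OneForm JetSpace :=
  ![fun m => -dX 2 + m 3 • dX 0 + (1 / 4 * m 3 ^ 2) • dX 1,
    fun m => dX 3 - m 4 • dX 0 - (1 / 2 * m 3 * m 4) • dX 1,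
    fun m => -dX 4 + (1 / 2 * m 4 ^ 2) • dX 1,
    fun m => dX 0 + (1 / 2 * m 3) • dX 1,
    fun _ => (-(1 / 2 : ℝ)) • dX 1]

/-- The group of invertible matrices of the block form that relates two 5-tuples of 1-forms of one
para-CR structure of type `(1, 2, 2)`. -/
def paraCRMatrices : Set (Matrix (Fin 5) (Fin 5) ℝ) :=
  {S | S.det ≠ 0 ∧ (∀ j, j ≠ 0 → S 0 j = 0) ∧
    (∀ i ∈ ({1, 2} : Set (Fin 5)), ∀ j ∈ ({3, 4} : Set (Fin 5)), S i j = 0) ∧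
    (∀ i ∈ ({3, 4} : Set (Fin 5)), ∀ j ∈ ({1, 2} : Set (Fin 5)), S i j = 0)}

/-- Two 5-tuples of covectors are para-CR equivalent. -/
def ParaCRRel {E : Type*} [NormedAddCommGroup E] [NormedSpace ℝ E]
    (α β : Fin 5 → (E →L[ℝ] ℝ)) : Prop :=
  ∃ S ∈ paraCRMatrices, ∀ i, β i = ∑ j, S i j • α j

/-- A 5-tuple of 1-forms represents a para-CR structure of type `(1, 2, 2)` on the jet space:
the forms are a coframe, and the two rank 2 distributions `(ω¹, ω², ω³)^⊥` and `(ω¹, ω⁴, ω⁵)^⊥` are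
integrable; for a coframe, `dω^i ∧ ω^1 ∧ ω^2 ∧ ω^3 = 0` means that `dω^i` vanishes on pairs of
vectors annihilated by `ω^1, ω^2, ω^3`, and similarly for the second distribution. -/
structure IsParaCR (η : Fin 5 → OneForm JetSpace) : Prop where
  smooth : ∀ i, ContDiff ℝ ∞ (η i)
  coframe : ∀ m, LinearIndependent ℝ (fun i => η i m)
  integrable₁ : ∀ m, ∀ i ∈ ({0, 1, 2} : Set (Fin 5)), ∀ v w : JetSpace,
    (∀ k ∈ ({0, 1, 2} : Set (Fin 5)), η k m v = 0 ∧ η k m w = 0) → extD (η i) m v w = 0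
  integrable₂ : ∀ m, ∀ i ∈ ({0, 3, 4} : Set (Fin 5)), ∀ v w : JetSpace,
    (∀ k ∈ ({0, 3, 4} : Set (Fin 5)), η k m v = 0 ∧ η k m w = 0) → extD (η i) m v w = 0

/-- Local symmetries of the flat para-CR structure: smooth maps `ψ : V → M` such that
`(ψ^* ω¹, …, ψ^* ω⁵)` is para-CR equivalent to `(ω¹, …, ω⁵)` at each point of `V`. Such maps are
local diffeomorphisms. -/
def IsLocalSymmetry (V : Set JetSpace) (ψ : JetSpace → JetSpace) : Prop :=
  ContDiffOn ℝ ∞ ψ V ∧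
    ∀ m ∈ V, ParaCRRel (fun j => flatForms j m) (fun i => pullback ψ (flatForms i) m)

/-! ### The structure group and the bundle -/

/-- The parameters `(r, φ, s, s', u)` of the structure group. -/
abbrev Params := Fin 5 → ℝ

/-- The parameters with `r ≠ 0`. -/
def paramSet : Set Params := {b | b 0 ≠ 0}

/-- The matrix `U` with parameters `r = b 0`, `φ = b 1`, `s = b 2`, `s' = b 3` (written with a bar
over `s` in print), `u = b 4`. -/
def matU (b : Params) : Matrix (Fin 5) (Fin 5) ℝ :=
  let r := b 0
  let e := Real.exp (b 1)
  let e' := Real.exp (-b 1)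
  let s := b 2
  let t := b 3
  let u := b 4
  !![e' / r, -(e' * (s * t + r ^ 4 * u)) / (2 * r ^ 3), -t / r ^ 2, 0, -(e * t ^ 2) / (2 * r ^ 3);
     0, r * e', 0, 0, 0;
     0, s * e' / r, 1, 0, t * e / r;
     0, s ^ 2 * e' / (2 * r ^ 3), s / r ^ 2, e / r, e * (s * t - r ^ 4 * u) / (2 * r ^ 3);
     0, 0, 0, 0, r * e]

/-- The ambient 10-dimensional coordinate space of the bundle. -/
abbrev BundleSpace := JetSpace × Params

/-- The bundle `M × G → M`, in the coordinates `(m, b)` of the point `(m, U(b))`. -/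
def bundle : Set BundleSpace := {p | p.2 ∈ paramSet}

/-- The parameters of the identity matrix. -/
def idParam : Params := ![1, 0, 0, 0, 0]

/-- `R` is the right translation of the bundle by the element `k` of the structure group, where the
right action is `(m, U) · k = (m, k⁻¹ U)`. -/
def IsRightTranslation (k : Matrix (Fin 5) (Fin 5) ℝ) (R : BundleSpace → BundleSpace) : Prop :=
  ContDiffOn ℝ ∞ R bundle ∧ ∀ p ∈ bundle, R p ∈ bundle ∧ (R p).1 = p.1 ∧
    matU (R p).2 = k⁻¹ * matU p.2

/-- The ten structure equations at the point `x`. -/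
structure StructureEquations {E : Type*} [NormedAddCommGroup E] [NormedSpace ℝ E]
    (θ Ω : Fin 5 → OneForm E) (x : E) : Prop where
  dθ₁ : extD (θ 0) x = θ 1 x ⋏ θ 3 x - θ 0 x ⋏ Ω 0 x
  dθ₂ : extD (θ 1) x =
    θ 2 x ⋏ θ 3 x + θ 1 x ⋏ (Ω 1 x - (1 / 2 : ℝ) • Ω 0 x) - θ 0 x ⋏ Ω 2 x
  dθ₃ : extD (θ 2) x = (2 : ℝ) • (θ 2 x ⋏ Ω 1 x) - θ 1 x ⋏ Ω 2 x
  dθ₄ : extD (θ 3) x =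
    -(θ 1 x ⋏ θ 4 x) - θ 3 x ⋏ ((1 / 2 : ℝ) • Ω 0 x + Ω 1 x) - θ 0 x ⋏ Ω 3 x
  dθ₅ : extD (θ 4) x = -((2 : ℝ) • (θ 4 x ⋏ Ω 1 x)) + θ 3 x ⋏ Ω 3 x
  dΩ₁ : extD (Ω 0) x = -(θ 3 x ⋏ Ω 2 x) + θ 1 x ⋏ Ω 3 x - θ 0 x ⋏ Ω 4 x
  dΩ₂ : extD (Ω 1) x =
    -(θ 2 x ⋏ θ 4 x) - (1 / 2 : ℝ) • (θ 3 x ⋏ Ω 2 x) - (1 / 2 : ℝ) • (θ 1 x ⋏ Ω 3 x)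
  dΩ₃ : extD (Ω 2) x =
    -(((1 / 2 : ℝ) • Ω 0 x + Ω 1 x) ⋏ Ω 2 x) + θ 2 x ⋏ Ω 3 x - (1 / 2 : ℝ) • (θ 1 x ⋏ Ω 4 x)
  dΩ₄ : extD (Ω 3) x =
    (Ω 1 x - (1 / 2 : ℝ) • Ω 0 x) ⋏ Ω 3 x + θ 4 x ⋏ Ω 2 x - (1 / 2 : ℝ) • (θ 3 x ⋏ Ω 4 x)
  dΩ₅ : extD (Ω 4) x = -(Ω 0 x ⋏ Ω 4 x) + (2 : ℝ) • (Ω 2 x ⋏ Ω 3 x)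

/-- On the open set `O`, the forms `(θ, Ω)` are a smooth coframe of a 10-dimensional space, the
forms `θ` belong to the flat para-CR structure pulled back by the smooth map `π : O → M`, and the
structure equations hold. -/
structure IsAdaptedCoframe {E : Type*} [NormedAddCommGroup E] [NormedSpace ℝ E]
    (O : Set E) (π : E → JetSpace) (θ Ω : Fin 5 → OneForm E) : Prop where
  smooth_proj : ContDiffOn ℝ ∞ π O
  smooth_θ : ∀ i, ContDiffOn ℝ ∞ (θ i) O
  smooth_Ω : ∀ i, ContDiffOn ℝ ∞ (Ω i) O
  coframe : ∀ x ∈ O, LinearIndependent ℝ (Sum.elim (fun i => θ i x) (fun i => Ω i x))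
  adapted : ∀ x ∈ O, ParaCRRel (fun j => pullback π (flatForms j) x) (fun i => θ i x)
  structureEquations : ∀ x ∈ O, StructureEquations θ Ω x

/-- The factors by which the involution attached to the sign `ε` multiplies the forms `θ`. -/
def signθ (ε : ℝ) : Fin 5 → ℝ := ![ε, ε, ε, 1, ε]

/-- The factors by which the involution attached to the sign `ε` multiplies the forms `Ω`. -/
def signΩ (ε : ℝ) : Fin 5 → ℝ := ![1, 1, 1, ε, ε]

/-- `Φ : O → M × G` is a smooth map over `M` that pulls the coframe `(θ, Ω)` of the bundle back to
the coframe `(θ', Ω')` of `O`, up to the involution attached to the sign `ε`. -/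
structure IsCoframeMap {E : Type*} [NormedAddCommGroup E] [NormedSpace ℝ E]
    (O : Set E) (π : E → JetSpace) (θ' Ω' : Fin 5 → OneForm E) (θ Ω : Fin 5 → OneForm BundleSpace)
    (ε : ℝ) (Φ : E → BundleSpace) : Prop where
  smooth : ContDiffOn ℝ ∞ Φ O
  mapsTo : Set.MapsTo Φ O bundle
  proj : ∀ x ∈ O, (Φ x).1 = π x
  pullback_θ : ∀ x ∈ O, ∀ i, pullback Φ (θ i) x = signθ ε i • θ' i x
  pullback_Ω : ∀ x ∈ O, ∀ i, pullback Φ (Ω i) x = signΩ ε i • Ω' i x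

/-! ### The Lie group `SO(3, 2)` and Cartan connections -/

/-- The symmetric bilinear form of signature `(3, 2)` that is used to define `SO(3, 2)`. -/
def formJ : Matrix (Fin 5) (Fin 5) ℝ :=
  !![0, 0, 0, 0, 1;
     0, 0, 0, -1, 0;
     0, 0, 1, 0, 0;
     0, -1, 0, 0, 0;
     1, 0, 0, 0, 0]

/-- `formJ` has signature `(3, 2)`. -/
theorem formJ_signature : ∃ P : Matrix (Fin 5) (Fin 5) ℝ,
    P.det ≠ 0 ∧ Pᵀ * formJ * P = Matrix.diagonal ![1, 1, 1, -1, -1] := by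
  refine ⟨!![0, 1, 0, 1, 0;
             0, 0, 1, 0, 1;
             1, 0, 0, 0, 0;
             0, 0, -1/2, 0, 1/2;
             0, 1/2, 0, -1/2, 0], ?_, ?_⟩
  · simp [Matrix.det_succ_row_zero, Fin.sum_univ_succ, Fin.succAbove]
    norm_num
  · ext i j
    fin_cases i <;> fin_cases j <;>
      simp [formJ, Matrix.mul_apply, Fin.sum_univ_succ, Matrix.diagonal] <;> norm_num

/-- The group `SO(3, 2)`. -/
def SO32 : Subgroup (Matrix.SpecialLinearGroup (Fin 5) ℝ) where
  carrier := {A | (A : Matrix (Fin 5) (Fin 5) ℝ)ᵀ * formJ * (A : Matrix (Fin 5) (Fin 5) ℝ) = formJ}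
  mul_mem' := by
    intro A B hA hB
    simp only [Set.mem_ofPred_eq, Matrix.SpecialLinearGroup.coe_mul, Matrix.transpose_mul] at *
    calc _ = (B : Matrix (Fin 5) (Fin 5) ℝ)ᵀ * ((A : Matrix (Fin 5) (Fin 5) ℝ)ᵀ * formJ *
          (A : Matrix (Fin 5) (Fin 5) ℝ)) * (B : Matrix (Fin 5) (Fin 5) ℝ) := by
          simp only [Matrix.mul_assoc]
      _ = formJ := by rw [hA, hB]
  one_mem' := by simp
  inv_mem' := by
    intro A hA
    simp only [Set.mem_ofPred_eq] at *
    have h : (A : Matrix (Fin 5) (Fin 5) ℝ) *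
        ((A⁻¹ : Matrix.SpecialLinearGroup (Fin 5) ℝ) : Matrix (Fin 5) (Fin 5) ℝ) = 1 := by
      rw [← Matrix.SpecialLinearGroup.coe_mul, mul_inv_cancel, Matrix.SpecialLinearGroup.coe_one]
    have h' := congrArg Matrix.transpose h
    rw [Matrix.transpose_mul, Matrix.transpose_one] at h'
    generalize ((A⁻¹ : Matrix.SpecialLinearGroup (Fin 5) ℝ) : Matrix (Fin 5) (Fin 5) ℝ) = B at *
    calc Bᵀ * formJ * B = (Bᵀ * (A : Matrix (Fin 5) (Fin 5) ℝ)ᵀ) * formJ *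
          ((A : Matrix (Fin 5) (Fin 5) ℝ) * B) := by
          nth_rewrite 1 [← hA]
          simp only [Matrix.mul_assoc]
      _ = formJ := by rw [h, h', Matrix.one_mul, Matrix.mul_one]

/-- The matrix of an element of `SO(3, 2)`. -/
def matSO (A : SO32) : Matrix (Fin 5) (Fin 5) ℝ :=
  ((A : Matrix.SpecialLinearGroup (Fin 5) ℝ) : Matrix (Fin 5) (Fin 5) ℝ)

/-- The Lie algebra `so(3, 2)`: the matrices `X` with `Xᵀ J = -J X`. -/
def so32 : Submodule ℝ (Matrix (Fin 5) (Fin 5) ℝ) :=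
  skewAdjointMatricesSubmodule formJ

/-- The matrix of 1-forms made of `(θ, Ω)`. -/
def connMatrix {E : Type*} [NormedAddCommGroup E] [NormedSpace ℝ E] (θ Ω : Fin 5 → OneForm E) :
    Matrix (Fin 5) (Fin 5) (OneForm E) :=
  !![(1 / 2 : ℝ) • Ω 0 - Ω 1, -((1 / 2 : ℝ) • Ω 4), Ω 3, θ 4, 0;
     θ 0, -((1 / 2 : ℝ) • Ω 0) - Ω 1, θ 3, 0, θ 4;
     θ 1, -Ω 2, 0, θ 3, -Ω 3;
     θ 2, 0, -Ω 2, (1 / 2 : ℝ) • Ω 0 + Ω 1, -((1 / 2 : ℝ) • Ω 4);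
     0, θ 2, -θ 1, θ 0, -((1 / 2 : ℝ) • Ω 0) + Ω 1]

/-- The value of a matrix of 1-forms on a tangent vector `v` at `p`. -/
def evalForm {E : Type*} [NormedAddCommGroup E] [NormedSpace ℝ E]
    (W : Matrix (Fin 5) (Fin 5) (OneForm E)) (p v : E) : Matrix (Fin 5) (Fin 5) ℝ :=
  Matrix.of fun i j => W i j p v

/-- The equation `dW + W ∧ W = 0` at `p` for a matrix `W` of 1-forms. -/
def IsFlatAt {E : Type*} [NormedAddCommGroup E] [NormedSpace ℝ E]
    (W : Matrix (Fin 5) (Fin 5) (OneForm E)) (p : E) : Prop :=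
  ∀ i j, extD (W i j) p + ∑ k, W i k p ⋏ W k j p = 0

/-- `W` is an `so(3, 2)`-valued Cartan connection on the principal bundle `M × G → M`: it is a
linear isomorphism of each tangent space onto `so(3, 2)`, it is equivariant under the right
translations, `R_k^* W = k⁻¹ W k`, and it reproduces the generators of the fundamental vector
fields. In the coordinates `(m, b)` the fundamental vector field generated by `X` takes at `(m, b)`
the value `(0, β)` with `D_β U = d/dt exp(-t X) U = -X U`. -/
structure IsCartanConnection (W : Matrix (Fin 5) (Fin 5) (OneForm BundleSpace)) : Prop where
  smooth : ∀ i j, ContDiffOn ℝ ∞ (W i j) bundle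
  bijOn : ∀ p ∈ bundle, Set.BijOn (evalForm W p) Set.univ (so32 : Set (Matrix (Fin 5) (Fin 5) ℝ))
  equivariant : ∀ b ∈ paramSet, ∃ R : BundleSpace → BundleSpace, IsRightTranslation (matU b) R ∧
    ∀ p ∈ bundle, ∀ v, evalForm W (R p) (fderiv ℝ R p v) = (matU b)⁻¹ * evalForm W p v * matU b
  fundamental : ∀ p ∈ bundle, ∀ β : Params, ∀ X : Matrix (Fin 5) (Fin 5) ℝ,
    (Matrix.of fun i j => fderiv ℝ (fun b => matU b i j) p.2 β) = -(X * matU p.2) →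
      evalForm W p (0, β) = X

/-! ### The homogeneous model -/

/-- An element of `SO(3, 2)` that normalises the structure group. -/
def reflE : Matrix (Fin 5) (Fin 5) ℝ := Matrix.diagonal ![-1, 1, 1, 1, -1]

/-- `Ψ` is an automorphism of the homogeneous space `SO(3, 2) / K`, endowed with the para-CR
structure whose charts are the maps `m ↦ A • ι m`: in each pair of charts it is a local symmetry of
the flat para-CR structure. -/
def IsModelSymmetry {K : Subgroup SO32} (ι : JetSpace → SO32 ⧸ K)
    (Ψ : (SO32 ⧸ K) ≃ₜ (SO32 ⧸ K)) : Prop :=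
  ∀ (A A' : SO32) (V : Set JetSpace) (ψ : JetSpace → JetSpace), IsOpen V →
    (∀ m ∈ V, Ψ (A • ι m) = A' • ι (ψ m)) → IsLocalSymmetry V ψ

end

set_option linter.unusedSimpArgs false

noncomputable section

/-! ### Matrices of the orthogonal group -/

/-! Below, matrix entries and basis vectors are numbered from 0, while the forms θ¹, …, Ω₅ are
numbered as in the printed theorem.

The ten structure equations say, entry by entry, that the so(3,2)-valued matrix ω of `connMatrix`
satisfies dω + ω∧ω = 0 (`structureEquations_iff_isFlatAt`). The model is therefore SO(3,2) with its
Maurer-Cartan form. Let W be `connMatrix` of the flat forms and of `flatΩ`. An explicit polynomial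
map h (`matH`) satisfies dh = hW (`matD_matH`). The canonical forms are the gauge transform ω =
UWU⁻¹ - dU U⁻¹ (`canon_mul_matU`), so that H = hU⁻¹ satisfies dH = Hω (`matD_bundleH`). Flatness is
then d(dH) = 0 (`isFlatAt_of_matD_eq`), and equivariance is H(m, k⁻¹U) = H(m, U)k.

On the side of the group, e₀ and e₃ span a totally isotropic plane and K is the stabiliser of their
two lines. The coset of A is thus determined by the lines of columns 0 and 3 of A; the coordinates
x, y, z are read off from column 3, and p, q from column 0. The sign of A₁₁A₄₄ separates G from EG
inside K.

Local uniqueness follows Cartan's method of equivalence. Write π^*ω = Tθ for an adapted coframe. The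
structure equations force relations between the entries of T (`IsAdaptedCoframe.coef_relations`),
after which r, φ, s, s̄ are fixed by normalising T, once T₁₁T₃₃ > 0. The sign of T₁₁T₃₃ is constant
on a connected set; this is ε. The rigidity lemmas show that the pulled back forms then agree,
except for one function in Ω₁, Ω₃, Ω₄ that the choice of u removes and Ω₅, which follows.

For a local symmetry ψ, the canonical coframe is also adapted to ψ composed with the projection, so
there is a coframe map Φ. With D = diag(ε, 1, 1, 1, ε) in K, the product (H∘Φ)DH⁻¹ has derivative
zero, and its constant value is the required A (`exists_smul_of_isLocalSymmetry`). This A is unique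
because a group element that fixes the lines of column 3 over an open set is 1
(`eq_one_of_eigenvector`). A global automorphism is locally given by group elements; these are
locally constant, and the quotient is connected since every translate of the chart meets the chart.
-/

theorem formJ_mul_formJ : formJ * formJ = 1 := by
  ext i j
  fin_cases i <;> fin_cases j <;> simp [formJ, Matrix.mul_apply, Fin.sum_univ_five]

/-- The entries of the equation `Aᵀ J A = J`. -/
theorem isOrthogonal_iff (A : Matrix (Fin 5) (Fin 5) ℝ) :
    Aᵀ * formJ * A = formJ ↔ ∀ i j, A 0 i * A 4 j - A 1 i * A 3 j + A 2 i * A 2 j - A 3 i * A 1 j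
      + A 4 i * A 0 j = formJ i j := by
  rw [← Matrix.ext_iff]
  refine forall_congr' fun i => forall_congr' fun j => ?_
  have : (Aᵀ * formJ * A) i j = A 0 i * A 4 j - A 1 i * A 3 j + A 2 i * A 2 j - A 3 i * A 1 j
      + A 4 i * A 0 j := by
    simp [formJ, Matrix.mul_apply, Fin.sum_univ_five]
    ring
  rw [this]

/-- This is the inverse of an orthogonal A. With its entries written out, conditions on A⁻¹ become
conditions on A, and AA⁻¹ = 1 becomes the orthogonality relations of the rows. -/
theorem formJ_conj (A : Matrix (Fin 5) (Fin 5) ℝ) : formJ * Aᵀ * formJ =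
    !![A 4 4, -A 3 4, A 2 4, -A 1 4, A 0 4;
       -A 4 3, A 3 3, -A 2 3, A 1 3, -A 0 3;
       A 4 2, -A 3 2, A 2 2, -A 1 2, A 0 2;
       -A 4 1, A 3 1, -A 2 1, A 1 1, -A 0 1;
       A 4 0, -A 3 0, A 2 0, -A 1 0, A 0 0] := by
  ext i j
  simp only [Matrix.mul_apply, Fin.sum_univ_five]
  fin_cases i <;> fin_cases j <;> simp [formJ]

theorem orthogonal_inv_left {A : Matrix (Fin 5) (Fin 5) ℝ} (h : Aᵀ * formJ * A = formJ) :
    formJ * Aᵀ * formJ * A = 1 := by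
  rw [Matrix.mul_assoc formJ, Matrix.mul_assoc formJ, h, formJ_mul_formJ]

theorem orthogonal_inv_right {A : Matrix (Fin 5) (Fin 5) ℝ} (h : Aᵀ * formJ * A = formJ) :
    A * (formJ * Aᵀ * formJ) = 1 :=
  mul_eq_one_comm.1 (orthogonal_inv_left h)

theorem orthogonal_inv_eq {A : Matrix (Fin 5) (Fin 5) ℝ} (h : Aᵀ * formJ * A = formJ) :
    A⁻¹ = formJ * Aᵀ * formJ :=
  Matrix.inv_eq_left_inv (orthogonal_inv_left h)

theorem matSO_orthogonal (A : SO32) : (matSO A)ᵀ * formJ * matSO A = formJ := A.2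

theorem matSO_det (A : SO32) : (matSO A).det = 1 := A.1.2

theorem matSO_mul (A B : SO32) : matSO (A * B) = matSO A * matSO B := rfl

theorem matSO_one : matSO 1 = 1 := rfl

theorem matSO_injective : Function.Injective matSO := fun _ _ h => Subtype.ext (Subtype.ext h)

theorem matSO_inv (A : SO32) : matSO A⁻¹ = formJ * (matSO A)ᵀ * formJ := by
  have h : matSO A⁻¹ * matSO A = 1 := by rw [← matSO_mul, inv_mul_cancel, matSO_one]
  exact (Matrix.inv_eq_left_inv h).symm.trans (orthogonal_inv_eq (matSO_orthogonal A))

/-- The element of `SO(3, 2)` with a given matrix. -/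
def mkSO (A : Matrix (Fin 5) (Fin 5) ℝ) (h : Aᵀ * formJ * A = formJ) (hd : A.det = 1) : SO32 :=
  ⟨⟨A, hd⟩, h⟩

theorem continuous_matSO : Continuous matSO :=
  continuous_subtype_val.comp continuous_subtype_val

theorem continuous_of_matSO {X : Type*} [TopologicalSpace X] {f : X → SO32}
    (h : Continuous fun x => matSO (f x)) : Continuous f :=
  Continuous.subtype_mk (Continuous.subtype_mk h _) _

/-! ### The structure group -/

theorem matU_orthogonal {b : Params} (hb : b ∈ paramSet) :
    (matU b)ᵀ * formJ * matU b = formJ := by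
  have hr : b 0 ≠ 0 := hb
  rw [isOrthogonal_iff]
  intro i j
  have he : Real.exp (-b 1) = (Real.exp (b 1))⁻¹ := Real.exp_neg _
  have hp := Real.exp_pos (b 1)
  fin_cases i <;> fin_cases j <;> simp [formJ, matU, he] <;> field_simp <;> ring

theorem matU_det {b : Params} (hb : b ∈ paramSet) : (matU b).det = 1 := by
  have hr : b 0 ≠ 0 := hb
  have he : Real.exp (-b 1) = (Real.exp (b 1))⁻¹ := Real.exp_neg _
  have hp := Real.exp_pos (b 1)
  simp [matU, Matrix.det_succ_row_zero, Fin.sum_univ_succ, Fin.succAbove, he]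
  field_simp

theorem reflE_orthogonal : reflEᵀ * formJ * reflE = formJ := by
  rw [isOrthogonal_iff]
  intro i j
  fin_cases i <;> fin_cases j <;> simp [formJ, reflE, Matrix.diagonal]

theorem reflE_det : reflE.det = 1 := by
  simp [reflE, Fin.prod_univ_five]

theorem reflE_mul_reflE : reflE * reflE = 1 := by
  ext i j
  fin_cases i <;> fin_cases j <;> simp [reflE]

/-- The element of `SO(3, 2)` with the matrix `matU b`. -/
def elemU (b : Params) (hb : b ∈ paramSet) : SO32 := mkSO (matU b) (matU_orthogonal hb) (matU_det hb)

theorem matSO_elemU (b : Params) (hb : b ∈ paramSet) : matSO (elemU b hb) = matU b := rfl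

/-- The element of `SO(3, 2)` with the matrix `reflE`. -/
def elemE : SO32 := mkSO reflE reflE_orthogonal reflE_det

/-- The parameters of a matrix of the structure group. -/
def paramOf (A : Matrix (Fin 5) (Fin 5) ℝ) : Params :=
  -- On `matU b` one has A₄₄/A₁₁ = e^{2φ}, A₄₄ = re^φ, A₃₂ = s/r², A₀₂ = -s̄/r² and A₃₄e^{-φ} +
  -- A₀₁e^φ = -ru.
  let φ := Real.log (A 4 4 / A 1 1) / 2
  let r := A 4 4 * Real.exp (-φ)
  ![r, φ, r ^ 2 * A 3 2, -(r ^ 2 * A 0 2), -(A 3 4 * Real.exp (-φ) + A 0 1 * Real.exp φ) / r]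

theorem paramOf_matU {b : Params} (hb : b ∈ paramSet) : paramOf (matU b) = b := by
  have hr : b 0 ≠ 0 := hb
  have hp := Real.exp_pos (b 1)
  have hp' := Real.exp_pos (-b 1)
  have h1 : matU b 4 4 / matU b 1 1 = Real.exp (b 1 + b 1) := by
    simp only [matU, Matrix.of_apply, Matrix.cons_val]
    rw [Real.exp_add, Real.exp_neg]
    field_simp
  have h2 : Real.log (matU b 4 4 / matU b 1 1) / 2 = b 1 := by
    rw [h1, Real.log_exp]; ring
  have h3 : matU b 4 4 * Real.exp (-b 1) = b 0 := by
    simp only [matU, Matrix.of_apply, Matrix.cons_val]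
    rw [Real.exp_neg]
    field_simp
  have he : Real.exp (-b 1) = (Real.exp (b 1))⁻¹ := Real.exp_neg _
  unfold paramOf
  simp only [h2, h3]
  ext i
  fin_cases i
  · rfl
  · rfl
  · simp [matU]; field_simp
  · simp [matU]; field_simp
  · simp [matU, he]; field_simp; ring

/-- The matrices that preserve the lines spanned by the first and the fourth basis vector. -/
def PreservesLines (A : Matrix (Fin 5) (Fin 5) ℝ) : Prop :=
  (∀ i, i ≠ 0 → A i 0 = 0) ∧ ∀ i, i ≠ 3 → A i 3 = 0

theorem PreservesLines.mul {A B : Matrix (Fin 5) (Fin 5) ℝ} (hA : PreservesLines A)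
    (hB : PreservesLines B) : PreservesLines (A * B) := by
  constructor
  · intro i hi
    rw [Matrix.mul_apply, Finset.sum_eq_single 0]
    · rw [hA.1 i hi, zero_mul]
    · intro k _ hk; rw [hB.1 k hk, mul_zero]
    · simp
  · intro i hi
    rw [Matrix.mul_apply, Finset.sum_eq_single 3]
    · rw [hA.2 i hi, zero_mul]
    · intro k _ hk; rw [hB.2 k hk, mul_zero]
    · simp

theorem preservesLines_matU (b : Params) : PreservesLines (matU b) := by
  constructor <;> intro i hi <;> fin_cases i <;> simp_all [matU]

theorem preservesLines_reflE : PreservesLines reflE := by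
  constructor <;> intro i hi <;> fin_cases i <;> simp_all [reflE]

/-- The shape of an orthogonal matrix that preserves the two lines. -/
theorem PreservesLines.shape {A : Matrix (Fin 5) (Fin 5) ℝ} (hA : PreservesLines A)
    (h : Aᵀ * formJ * A = formJ) :
    A 1 2 = 0 ∧ A 1 4 = 0 ∧ A 4 1 = 0 ∧ A 4 2 = 0 ∧ A 0 0 * A 4 4 = 1 ∧ A 1 1 * A 3 3 = 1 := by
  rw [isOrthogonal_iff] at h
  have h10 := hA.1 1 (by decide)
  have h20 := hA.1 2 (by decide)
  have h30 := hA.1 3 (by decide)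
  have h40 := hA.1 4 (by decide)
  have h03 := hA.2 0 (by decide)
  have h13 := hA.2 1 (by decide)
  have h23 := hA.2 2 (by decide)
  have h43 := hA.2 4 (by decide)
  -- Columns 0 and 3 are A₀₀e₀ and A₃₃e₃, so they pair with column j to A₀₀A₄ⱼ and -A₃₃A₁ⱼ.
  -- Comparison with `formJ` gives the six relations.
  have a1 := h 0 1
  have a2 := h 0 2
  have a4 := h 0 4
  have d1 := h 3 1
  have d2 := h 3 2
  have d4 := h 3 4
  simp [formJ, h10, h20, h30, h40, h03, h13, h23, h43] at a1 a2 a4 d1 d2 d4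
  have ha : A 0 0 ≠ 0 := fun h0 => by simp [h0] at a4
  have hd : A 3 3 ≠ 0 := fun h0 => by simp [h0] at d1
  refine ⟨d2.resolve_left hd, d4.resolve_left hd, a1.resolve_left ha, a2.resolve_left ha, a4, ?_⟩
  rw [mul_comm, d1]

/-- The diagonal is (1/A₄₄, A₁₁, 1, 1/A₁₁, A₄₄), where the middle entry comes from the determinant.
When A₁₁ and A₄₄ have the same sign they can be written as re^{-φ} and re^φ. With A₃₂, A₀₂ and A₀₁
given as well, orthogonality determines all other entries. -/
theorem matU_paramOf {A : Matrix (Fin 5) (Fin 5) ℝ} (hA : PreservesLines A)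
    (h : Aᵀ * formJ * A = formJ) (hd : A.det = 1) (hpos : 0 < A 1 1 * A 4 4) :
    paramOf A ∈ paramSet ∧ matU (paramOf A) = A := by
  obtain ⟨h12, h14, h41, h42, h04, h13'⟩ := hA.shape h
  have h10 := hA.1 1 (by decide)
  have h20 := hA.1 2 (by decide)
  have h30 := hA.1 3 (by decide)
  have h40 := hA.1 4 (by decide)
  have h03 := hA.2 0 (by decide)
  have h13 := hA.2 1 (by decide)
  have h23 := hA.2 2 (by decide)
  have h43 := hA.2 4 (by decide)
  rw [isOrthogonal_iff] at h
  have n1 : A 1 1 ≠ 0 := fun h0 => by simp [h0] at hpos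
  have n4 : A 4 4 ≠ 0 := fun h0 => by simp [h0] at hpos
  have h22 : A 2 2 = 1 := by
    have := hd
    simp [Matrix.det_succ_row_zero, Fin.sum_univ_succ, Fin.succAbove, h10, h20, h30, h40, h03, h13,
      h23, h43, h12, h14, h41, h42] at this
    linear_combination this - A 2 2 * h04 - A 2 2 * (A 0 0 * A 4 4) * h13'
  have e12 := h 1 2
  have e24 := h 2 4
  have e11 := h 1 1
  have e44 := h 4 4
  have e14 := h 1 4
  simp [formJ, h10, h20, h30, h40, h03, h13, h23, h43, h12, h14, h41, h42, h22] at e12 e24 e11 e44 e14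
  have hpos' : 0 < A 4 4 / A 1 1 := by
    rcases pos_and_pos_or_neg_and_neg_of_mul_pos hpos with h | h
    · exact div_pos h.2 h.1
    · exact div_pos_of_neg_of_neg h.2 h.1
  set φ := Real.log (A 4 4 / A 1 1) / 2 with hφ
  have hp := Real.exp_pos φ
  have he : Real.exp (-φ) = (Real.exp φ)⁻¹ := Real.exp_neg _
  have hee : Real.exp φ * Real.exp φ = A 4 4 / A 1 1 := by
    rw [← Real.exp_add, hφ, add_halves, Real.exp_log hpos']
  have b0 : paramOf A 0 = A 4 4 * Real.exp (-φ) := rfl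
  have b1 : paramOf A 1 = φ := rfl
  have b2 : paramOf A 2 = (A 4 4 * Real.exp (-φ)) ^ 2 * A 3 2 := rfl
  have b3 : paramOf A 3 = -((A 4 4 * Real.exp (-φ)) ^ 2 * A 0 2) := rfl
  have b4 : paramOf A 4 = -(A 3 4 * Real.exp (-φ) + A 0 1 * Real.exp φ) / (A 4 4 * Real.exp (-φ)) := rfl
  have hr : A 4 4 * Real.exp (-φ) ≠ 0 := mul_ne_zero n4 (Real.exp_pos _).ne'
  refine ⟨by rw [paramSet, Set.mem_ofPred_eq, b0]; exact hr, ?_⟩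
  set E := Real.exp φ with hE
  have h44 : A 4 4 = A 1 1 * (E * E) := by rw [hee]; field_simp
  have h00 : A 0 0 = 1 / A 4 4 := by field_simp; linarith
  have h33 : A 3 3 = 1 / A 1 1 := by field_simp; linarith
  have h21 : A 2 1 = A 3 2 * A 1 1 := by linarith
  have h24 : A 2 4 = -(A 0 2 * A 4 4) := by linarith
  have h31 : A 3 1 = A 2 1 ^ 2 / (2 * A 1 1) := by field_simp; linarith
  have h04' : A 0 4 = -A 2 4 ^ 2 / (2 * A 4 4) := by field_simp; linarith
  have h34 : A 3 4 = (A 0 1 * A 4 4 + A 2 1 * A 2 4) / A 1 1 := by field_simp; linarith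
  ext i j
  fin_cases i <;> fin_cases j <;>
    simp [matU, b0, b1, b2, b3, b4, h10, h20, h30, h40, h03, h13, h23, h43, h12, h14, h41, h42, h22,
      he, ← hE, h00, h33, h31, h04', h34, h21, h24, h44] <;> field_simp <;> ring

/-- Left multiplication by `reflE` changes the sign of A₄₄ and keeps A₁₁, so it carries the case
A₁₁A₄₄ < 0 to the one of `matU_paramOf`. -/
theorem exists_matU_or_reflE {A : Matrix (Fin 5) (Fin 5) ℝ} (hA : PreservesLines A)
    (h : Aᵀ * formJ * A = formJ) (hd : A.det = 1) :
    ∃ b ∈ paramSet, A = matU b ∨ A = reflE * matU b := by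
  obtain ⟨h12, h14, h41, h42, h04, h13⟩ := hA.shape h
  have n1 : A 1 1 ≠ 0 := fun h0 => by simp [h0] at h13
  have n4 : A 4 4 ≠ 0 := fun h0 => by simp [h0] at h04
  rcases lt_or_gt_of_ne (mul_ne_zero n1 n4) with hneg | hpos
  · have h' : (reflE * A)ᵀ * formJ * (reflE * A) = formJ := by
      rw [Matrix.transpose_mul]
      calc _ = Aᵀ * (reflEᵀ * formJ * reflE) * A := by simp only [Matrix.mul_assoc]
        _ = formJ := by rw [reflE_orthogonal, h]
    have := matU_paramOf (preservesLines_reflE.mul hA) h' (by rw [Matrix.det_mul, reflE_det, hd, one_mul])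
      (by simpa [reflE] using hneg)
    refine ⟨_, this.1, Or.inr ?_⟩
    rw [this.2, ← Matrix.mul_assoc, reflE_mul_reflE, Matrix.one_mul]
  · have := matU_paramOf hA h hd hpos
    exact ⟨_, this.1, Or.inl this.2.symm⟩

theorem matU_diag_pos {b : Params} (hb : b ∈ paramSet) : 0 < matU b 1 1 * matU b 4 4 := by
  have hr : b 0 ≠ 0 := hb
  have hp := Real.exp_pos (b 1)
  have h : matU b 1 1 * matU b 4 4 = b 0 ^ 2 := by
    simp only [matU, Matrix.of_apply, Matrix.cons_val, Real.exp_neg]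
    field_simp
  rw [h]
  positivity

theorem matU_diag_pos' {b : Params} (hb : b ∈ paramSet) : 0 < matU b 0 0 * matU b 3 3 := by
  have hr : b 0 ≠ 0 := hb
  have hp := Real.exp_pos (b 1)
  have h : matU b 0 0 * matU b 3 3 = (b 0 ^ 2)⁻¹ := by
    simp only [matU, Matrix.of_apply, Matrix.cons_val, Real.exp_neg]
    field_simp
  rw [h]
  positivity

theorem PreservesLines.inv {A : Matrix (Fin 5) (Fin 5) ℝ} (hA : PreservesLines A)
    (h : Aᵀ * formJ * A = formJ) : PreservesLines (formJ * Aᵀ * formJ) := by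
  obtain ⟨h12, h14, h41, h42, -, -⟩ := hA.shape h
  have h10 := hA.1 1 (by decide)
  have h20 := hA.1 2 (by decide)
  have h30 := hA.1 3 (by decide)
  have h40 := hA.1 4 (by decide)
  have h03 := hA.2 0 (by decide)
  have h13 := hA.2 1 (by decide)
  have h23 := hA.2 2 (by decide)
  have h43 := hA.2 4 (by decide)
  rw [formJ_conj]
  constructor <;> intro i hi <;> fin_cases i <;> simp_all

/-- The subgroup `K` of `SO(3, 2)`, the stabiliser of two lines. -/
def lineStabilizer : Subgroup SO32 where
  carrier := {A | PreservesLines (matSO A)}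
  mul_mem' := fun {A B} hA hB => by
    have := PreservesLines.mul hA hB
    rwa [← matSO_mul] at this
  one_mem' := by
    constructor <;> intro i hi <;> rw [matSO_one] <;> exact Matrix.one_apply_ne hi
  inv_mem' := fun {A} hA => by
    have := PreservesLines.inv hA (matSO_orthogonal A)
    rwa [← matSO_inv] at this

theorem mem_lineStabilizer (A : SO32) : A ∈ lineStabilizer ↔ PreservesLines (matSO A) := Iff.rfl

theorem mem_lineStabilizer_iff (A : SO32) :
    A ∈ lineStabilizer ↔ ∃ b ∈ paramSet, matSO A = matU b ∨ matSO A = reflE * matU b := by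
  constructor
  · intro hA
    exact exists_matU_or_reflE hA (matSO_orthogonal A) (matSO_det A)
  · rintro ⟨b, hb, h | h⟩
    · rw [mem_lineStabilizer, h]; exact preservesLines_matU b
    · rw [mem_lineStabilizer, h]; exact preservesLines_reflE.mul (preservesLines_matU b)

theorem PreservesLines.diag_mul {B : Matrix (Fin 5) (Fin 5) ℝ} (A : Matrix (Fin 5) (Fin 5) ℝ)
    (hB : PreservesLines B) : (A * B) 0 0 = A 0 0 * B 0 0 ∧ (A * B) 3 3 = A 3 3 * B 3 3 := by
  constructor
  · rw [Matrix.mul_apply, Finset.sum_eq_single 0]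
    · intro k _ hk; rw [hB.1 k hk, mul_zero]
    · simp
  · rw [Matrix.mul_apply, Finset.sum_eq_single 3]
    · intro k _ hk; rw [hB.2 k hk, mul_zero]
    · simp

theorem pos_of_mul_eq_one {a b : ℝ} (h : a * b = 1) (ha : 0 < a) : 0 < b :=
  (mul_pos_iff_of_pos_left ha).1 (h ▸ one_pos)

/-- The two products are inverse to each other. The first suits the group law, since the entries 00
and 33 are multiplicative on matrices that preserve the lines; the second is what `paramOf` needs.
-/
theorem diag_pos_iff {A : Matrix (Fin 5) (Fin 5) ℝ} (hA : PreservesLines A)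
    (h : Aᵀ * formJ * A = formJ) : 0 < A 0 0 * A 3 3 ↔ 0 < A 1 1 * A 4 4 := by
  obtain ⟨-, -, -, -, h1, h2⟩ := hA.shape h
  have : (A 0 0 * A 3 3) * (A 1 1 * A 4 4) = 1 := by linear_combination h1 + A 0 0 * A 4 4 * h2
  constructor <;> intro h0
  · exact pos_of_mul_eq_one this h0
  · exact pos_of_mul_eq_one (by rw [mul_comm]; exact this) h0

/-- The structure group `G`. -/
def structureGroup : Subgroup SO32 where
  carrier := {A | PreservesLines (matSO A) ∧ 0 < matSO A 0 0 * matSO A 3 3}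
  mul_mem' := fun {A B} hA hB => by
    have h := hB.1.diag_mul (matSO A)
    rw [← matSO_mul] at h
    refine ⟨lineStabilizer.mul_mem hA.1 hB.1, ?_⟩
    rw [h.1, h.2]
    linarith [mul_pos hA.2 hB.2]
  one_mem' := ⟨lineStabilizer.one_mem, by simp [matSO_one]⟩
  inv_mem' := fun {A} hA => by
    refine ⟨lineStabilizer.inv_mem hA.1, ?_⟩
    have := (diag_pos_iff hA.1 (matSO_orthogonal A)).1 hA.2
    rw [matSO_inv, formJ_conj]
    simpa [mul_comm] using this

theorem mem_structureGroup_iff (A : SO32) :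
    A ∈ structureGroup ↔ ∃ b ∈ paramSet, matSO A = matU b := by
  constructor
  · intro hA
    have := matU_paramOf hA.1 (matSO_orthogonal A) (matSO_det A)
      ((diag_pos_iff hA.1 (matSO_orthogonal A)).1 hA.2)
    exact ⟨_, this.1, this.2.symm⟩
  · rintro ⟨b, hb, h⟩
    change PreservesLines (matSO A) ∧ 0 < matSO A 0 0 * matSO A 3 3
    rw [h]
    exact ⟨preservesLines_matU b, matU_diag_pos' hb⟩

theorem matU_idParam : matU idParam = 1 := by
  ext i j
  fin_cases i <;> fin_cases j <;> simp [matU, idParam]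

theorem idParam_mem : idParam ∈ paramSet := by
  simp [paramSet, idParam]

theorem paramSet_isOpen : IsOpen paramSet :=
  isOpen_ne_fun (continuous_apply 0) continuous_const

theorem bundle_isOpen : IsOpen bundle := paramSet_isOpen.preimage continuous_snd

/-! ### Calculus of 1-forms -/

section Forms

variable {E F : Type*} [NormedAddCommGroup E] [NormedSpace ℝ E] [NormedAddCommGroup F]
  [NormedSpace ℝ F]

theorem wedge_apply (α β : E →L[ℝ] ℝ) (v w : E) : (α ⋏ β) v w = α v * β w - α w * β v := rfl

theorem extD_apply (α : OneForm E) (x v w : E) :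
    extD α x v w = fderiv ℝ α x v w - fderiv ℝ α x w v := rfl

theorem extD_congr {α β : OneForm E} {x : E} (h : α =ᶠ[nhds x] β) : extD α x = extD β x := by
  funext v w
  rw [extD_apply, extD_apply, h.fderiv_eq]

theorem extD_add {α β : OneForm E} {x : E} (hα : DifferentiableAt ℝ α x)
    (hβ : DifferentiableAt ℝ β x) (v w : E) :
    extD (α + β) x v w = extD α x v w + extD β x v w := by
  simp only [extD_apply, fderiv_add hα hβ]
  simp only [add_apply]
  ring

theorem extD_neg (α : OneForm E) (x : E) (v w : E) : extD (-α) x v w = -extD α x v w := by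
  simp only [extD_apply, fderiv_neg]
  simp only [neg_apply]
  ring

theorem extD_sub {α β : OneForm E} {x : E} (hα : DifferentiableAt ℝ α x)
    (hβ : DifferentiableAt ℝ β x) (v w : E) :
    extD (α - β) x v w = extD α x v w - extD β x v w := by
  simp only [extD_apply, fderiv_sub hα hβ]
  simp only [sub_apply]
  ring

theorem extD_const_smul (c : ℝ) {α : OneForm E} {x : E} (hα : DifferentiableAt ℝ α x) (v w : E) :
    extD (c • α) x v w = c * extD α x v w := by
  simp only [extD_apply, fderiv_const_smul hα]
  simp only [smul_apply, smul_eq_mul]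
  ring

theorem extD_zero (x v w : E) : extD (0 : OneForm E) x v w = 0 := by
  simp [extD_apply]

theorem extD_smul {f : E → ℝ} {α : OneForm E} {x : E} (hf : DifferentiableAt ℝ f x)
    (hα : DifferentiableAt ℝ α x) (v w : E) :
    extD (fun y => f y • α y) x v w = (fderiv ℝ f x ⋏ α x) v w + f x * extD α x v w := by
  simp only [extD_apply, fderiv_fun_smul hf hα, wedge_apply]
  simp only [add_apply, smul_apply,
    ContinuousLinearMap.smulRight_apply, smul_eq_mul]
  ring

theorem extD_sum {ι : Type*} (s : Finset ι) {α : ι → OneForm E} {x : E}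
    (hα : ∀ i ∈ s, DifferentiableAt ℝ (α i) x) (v w : E) :
    extD (fun y => ∑ i ∈ s, α i y) x v w = ∑ i ∈ s, extD (α i) x v w := by
  simp only [extD_apply, fderiv_fun_sum hα, sum_apply, Finset.sum_sub_distrib]

theorem extD_fderiv {f : E → ℝ} {x : E} (hf : ContDiffAt ℝ ∞ f x) (v w : E) :
    extD (fderiv ℝ f) x v w = 0 := by
  have h := hf.isSymmSndFDerivAt (by simp; exact WithTop.coe_le_coe.2 (le_top : (2 : ℕ∞) ≤ ⊤))
  rw [extD_apply, h v w, sub_self]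

/-- The derivative of the pullback contains the second derivative of f, which is symmetric in v and
w and drops out of the alternation. -/
theorem extD_pullback {f : E → F} {α : OneForm F} {x : E} (hf : ContDiffAt ℝ ∞ f x)
    (hα : DifferentiableAt ℝ α (f x)) (v w : E) :
    extD (pullback f α) x v w = extD α (f x) (fderiv ℝ f x v) (fderiv ℝ f x w) := by
  have h := hf.isSymmSndFDerivAt (by simp; exact WithTop.coe_le_coe.2 (le_top : (2 : ℕ∞) ≤ ⊤))
  have hf1 : DifferentiableAt ℝ f x := hf.differentiableAt (by simp)
  have hf2 : DifferentiableAt ℝ (fderiv ℝ f) x :=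
    (hf.fderiv_right (m := ∞) (by simp)).differentiableAt (by simp)
  have hc : HasFDerivAt (fun y => α (f y)) ((fderiv ℝ α (f x)).comp (fderiv ℝ f x)) x :=
    hα.hasFDerivAt.comp x hf1.hasFDerivAt
  have key : ∀ v w, fderiv ℝ (pullback f α) x v w = fderiv ℝ α (f x) (fderiv ℝ f x v)
      (fderiv ℝ f x w) + α (f x) (fderiv ℝ (fderiv ℝ f) x v w) := by
    intro v w
    have := (hc.clm_comp hf2.hasFDerivAt).fderiv
    change fderiv ℝ (fun y => (α (f y)).comp (fderiv ℝ f y)) x v w = _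
    rw [this]
    simp [add_comm]
  rw [extD_apply, extD_apply, key, key, h v w]
  ring

theorem pullback_apply (f : E → F) (α : OneForm F) (x v : E) :
    pullback f α x v = α (f x) (fderiv ℝ f x v) := rfl

theorem contDiffOn_pullback {f : E → F} {α : OneForm F} {s : Set E} {t : Set F} (hs : IsOpen s)
    (hf : ContDiffOn ℝ ∞ f s) (hα : ContDiffOn ℝ ∞ α t) (hst : Set.MapsTo f s t) :
    ContDiffOn ℝ ∞ (pullback f α) s :=
  (hα.comp hf hst).clm_comp (hf.fderiv_of_isOpen hs (by simp))

theorem StructureEquations.pullback {θ Ω : Fin 5 → OneForm F} {f : E → F} {x : E}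
    (h : StructureEquations θ Ω (f x)) (hf : ContDiffAt ℝ ∞ f x)
    (hθ : ∀ i, DifferentiableAt ℝ (θ i) (f x)) (hΩ : ∀ i, DifferentiableAt ℝ (Ω i) (f x)) :
    StructureEquations (fun i => pullback f (θ i)) (fun i => pullback f (Ω i)) x := by
  constructor <;> funext v w
  · rw [extD_pullback hf (hθ _), h.dθ₁]; rfl
  · rw [extD_pullback hf (hθ _), h.dθ₂]; rfl
  · rw [extD_pullback hf (hθ _), h.dθ₃]; rfl
  · rw [extD_pullback hf (hθ _), h.dθ₄]; rfl
  · rw [extD_pullback hf (hθ _), h.dθ₅]; rfl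
  · rw [extD_pullback hf (hΩ _), h.dΩ₁]; rfl
  · rw [extD_pullback hf (hΩ _), h.dΩ₂]; rfl
  · rw [extD_pullback hf (hΩ _), h.dΩ₃]; rfl
  · rw [extD_pullback hf (hΩ _), h.dΩ₄]; rfl
  · rw [extD_pullback hf (hΩ _), h.dΩ₅]; rfl

/-- The structure equations are the Maurer-Cartan equations of `so(3, 2)`. -/
theorem structureEquations_iff_isFlatAt (θ Ω : Fin 5 → OneForm E) (x : E)
    (hΩ : ∀ i, DifferentiableAt ℝ (Ω i) x) :
    StructureEquations θ Ω x ↔ IsFlatAt (connMatrix θ Ω) x := by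
  have hs : ∀ (c : ℝ) i, DifferentiableAt ℝ (c • Ω i) x := fun c i => (hΩ i).const_smul c
  have hn : ∀ (c : ℝ) i, DifferentiableAt ℝ (-(c • Ω i)) x := fun c i => (hs c i).neg
  constructor
  · rintro ⟨h1, h2, h3, h4, h5, g1, g2, g3, g4, g5⟩ i j
    funext v w
    replace h1 := congrFun (congrFun h1 v) w
    replace h2 := congrFun (congrFun h2 v) w
    replace h3 := congrFun (congrFun h3 v) w
    replace h4 := congrFun (congrFun h4 v) w
    replace h5 := congrFun (congrFun h5 v) w
    replace g1 := congrFun (congrFun g1 v) w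
    replace g2 := congrFun (congrFun g2 v) w
    replace g3 := congrFun (congrFun g3 v) w
    replace g4 := congrFun (congrFun g4 v) w
    replace g5 := congrFun (congrFun g5 v) w
    simp only [Pi.add_apply, Pi.sub_apply, Pi.neg_apply, Pi.smul_apply, wedge_apply, smul_eq_mul,
      add_apply, sub_apply, smul_apply]
      at h1 h2 h3 h4 h5 g1 g2 g3 g4 g5
    fin_cases i <;> fin_cases j <;>
    simp only [connMatrix, Fin.sum_univ_five, Matrix.of_apply, Matrix.cons_val, Fin.zero_eta,
      Fin.mk_one, Fin.reduceFinMk, Pi.add_apply, Pi.sub_apply, Pi.neg_apply, Pi.smul_apply,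
      Pi.zero_apply,
      wedge_apply, smul_eq_mul, add_apply, sub_apply,
      smul_apply, neg_apply,
      zero_apply, extD_sub (hs _ _) (hΩ _), extD_sub (hn _ _) (hΩ _),
      extD_add (hs _ _) (hΩ _), extD_add (hn _ _) (hΩ _), extD_neg, extD_const_smul _ (hΩ _),
      extD_zero, h1, h2, h3, h4, h5, g1, g2, g3, g4, g5] <;> ring
  · intro h
    -- Ten of the 25 entries suffice: 10, 20, 30, 12, 03 for the θ, the difference and half the sum
    -- of 00 and 11 for Ω₁ and Ω₂, and 21, 02, 01 for Ω₃, Ω₄, Ω₅.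
    have key : ∀ i j v w, _ := fun i j v w => congrFun (congrFun (h i j) v) w
    have h10 := key 1 0
    have h20 := key 2 0
    have h30 := key 3 0
    have h12 := key 1 2
    have h03 := key 0 3
    have h00 := key 0 0
    have h11 := key 1 1
    have h21 := key 2 1
    have h02 := key 0 2
    have h01 := key 0 1
    simp only [connMatrix, Fin.sum_univ_five, Matrix.of_apply, Matrix.cons_val, Fin.zero_eta,
      Fin.mk_one, Fin.reduceFinMk, Pi.add_apply, Pi.sub_apply, Pi.neg_apply, Pi.smul_apply,
      Pi.zero_apply,
      wedge_apply, smul_eq_mul, add_apply, sub_apply,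
      smul_apply, neg_apply,
      zero_apply, extD_sub (hs _ _) (hΩ _), extD_sub (hn _ _) (hΩ _),
      extD_add (hs _ _) (hΩ _), extD_add (hn _ _) (hΩ _), extD_neg, extD_const_smul _ (hΩ _),
      extD_zero] at h10 h20 h30 h12 h03 h00 h11 h21 h02 h01
    constructor <;> funext v w <;>
      simp only [Pi.add_apply, Pi.sub_apply, Pi.neg_apply, Pi.smul_apply, wedge_apply, smul_eq_mul,
        add_apply, sub_apply,
        smul_apply]
    · linear_combination h10 v w
    · linear_combination h20 v w
    · linear_combination h30 v w
    · linear_combination h12 v w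
    · linear_combination h03 v w
    · linear_combination h00 v w - h11 v w
    · linear_combination -(1 / 2) * h00 v w - (1 / 2) * h11 v w
    · linear_combination -h21 v w
    · linear_combination h02 v w
    · linear_combination -2 * h01 v w

/-! ### Derivatives of matrix-valued functions -/

/-- The entries of `X` are differentiable at `x`. -/
def MatDiffAt (X : E → Matrix (Fin 5) (Fin 5) ℝ) (x : E) : Prop :=
  ∀ i j, DifferentiableAt ℝ (fun y => X y i j) x

/-- The directional derivative of a matrix-valued function. -/
def matD (X : E → Matrix (Fin 5) (Fin 5) ℝ) (x v : E) : Matrix (Fin 5) (Fin 5) ℝ :=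
  Matrix.of fun i j => fderiv ℝ (fun y => X y i j) x v

theorem matD_apply (X : E → Matrix (Fin 5) (Fin 5) ℝ) (x v : E) (i j : Fin 5) :
    matD X x v i j = fderiv ℝ (fun y => X y i j) x v := rfl

theorem MatDiffAt.mul {X Y : E → Matrix (Fin 5) (Fin 5) ℝ} {x : E} (hX : MatDiffAt X x)
    (hY : MatDiffAt Y x) : MatDiffAt (fun y => X y * Y y) x := fun i j => by
  simp only [Matrix.mul_apply]
  exact DifferentiableAt.fun_sum fun k _ => (hX i k).fun_mul (hY k j)

theorem matDiffAt_const (A : Matrix (Fin 5) (Fin 5) ℝ) (x : E) : MatDiffAt (fun _ => A) x :=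
  fun _ _ => differentiableAt_const _

theorem MatDiffAt.transpose {X : E → Matrix (Fin 5) (Fin 5) ℝ} {x : E} (hX : MatDiffAt X x) :
    MatDiffAt (fun y => (X y)ᵀ) x := fun i j => hX j i

theorem MatDiffAt.comp {X : F → Matrix (Fin 5) (Fin 5) ℝ} {f : E → F} {x : E}
    (hX : MatDiffAt X (f x)) (hf : DifferentiableAt ℝ f x) : MatDiffAt (fun y => X (f y)) x :=
  fun i j => (hX i j).fun_comp' x hf

theorem matD_mul {X Y : E → Matrix (Fin 5) (Fin 5) ℝ} {x : E} (hX : MatDiffAt X x)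
    (hY : MatDiffAt Y x) (v : E) :
    matD (fun y => X y * Y y) x v = matD X x v * Y x + X x * matD Y x v := by
  ext i j
  simp only [matD_apply, Matrix.mul_apply, Matrix.add_apply]
  rw [fderiv_fun_sum fun k _ => (hX i k).fun_mul (hY k j), sum_apply,
    ← Finset.sum_add_distrib]
  refine Finset.sum_congr rfl fun k _ => ?_
  rw [fderiv_fun_mul (hX i k) (hY k j)]
  simp
  ring

theorem matD_const (A : Matrix (Fin 5) (Fin 5) ℝ) (x v : E) : matD (fun _ => A) x v = 0 := by
  ext i j
  simp [matD_apply]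

theorem matD_transpose (X : E → Matrix (Fin 5) (Fin 5) ℝ) (x v : E) :
    matD (fun y => (X y)ᵀ) x v = (matD X x v)ᵀ := rfl

theorem matD_comp {X : F → Matrix (Fin 5) (Fin 5) ℝ} {f : E → F} {x : E}
    (hX : MatDiffAt X (f x)) (hf : DifferentiableAt ℝ f x) (v : E) :
    matD (fun y => X (f y)) x v = matD X (f x) (fderiv ℝ f x v) := by
  ext i j
  rw [matD_apply, matD_apply]
  have := fderiv_fun_comp x (hX i j) hf
  exact congrArg (fun L => L v) this

theorem matD_congr {X Y : E → Matrix (Fin 5) (Fin 5) ℝ} {x : E} (h : X =ᶠ[nhds x] Y) (v : E) :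
    matD X x v = matD Y x v := by
  ext i j
  rw [matD_apply, matD_apply]
  have : (fun y => X y i j) =ᶠ[nhds x] fun y => Y y i j := h.mono fun y hy => by simp only [hy]
  rw [this.fderiv_eq]

theorem matD_const_mul (A : Matrix (Fin 5) (Fin 5) ℝ) {X : E → Matrix (Fin 5) (Fin 5) ℝ} {x : E}
    (hX : MatDiffAt X x) (v : E) : matD (fun y => A * X y) x v = A * matD X x v := by
  rw [matD_mul (matDiffAt_const A x) hX, matD_const, Matrix.zero_mul, zero_add]

theorem matD_mul_const (A : Matrix (Fin 5) (Fin 5) ℝ) {X : E → Matrix (Fin 5) (Fin 5) ℝ} {x : E}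
    (hX : MatDiffAt X x) (v : E) : matD (fun y => X y * A) x v = matD X x v * A := by
  rw [matD_mul hX (matDiffAt_const A x), matD_const, Matrix.mul_zero, add_zero]

theorem evalForm_apply (W : Matrix (Fin 5) (Fin 5) (OneForm E)) (p v : E) (i j : Fin 5) :
    evalForm W p v i j = W i j p v := rfl

/-- A matrix of 1-forms `W` with `dH = H W` for an invertible matrix of functions `H` is flat. -/
theorem isFlatAt_of_matD_eq {H : E → Matrix (Fin 5) (Fin 5) ℝ}
    {W : Matrix (Fin 5) (Fin 5) (OneForm E)} {O : Set E} (hO : IsOpen O)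
    (hH : ∀ i j, ContDiffOn ℝ ∞ (fun y => H y i j) O) (hW : ∀ i j, ContDiffOn ℝ ∞ (W i j) O)
    (hHW : ∀ p ∈ O, ∀ v, matD H p v = H p * evalForm W p v) {p : E} (hp : p ∈ O)
    {B : Matrix (Fin 5) (Fin 5) ℝ} (hB : B * H p = 1) : IsFlatAt W p := by
  have hHp : ∀ i j, ContDiffAt ℝ ∞ (fun y => H y i j) p := fun i j =>
    (hH i j).contDiffAt (hO.mem_nhds hp)
  have hHd : ∀ i j, DifferentiableAt ℝ (fun y => H y i j) p := fun i j =>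
    (hHp i j).differentiableAt (by simp)
  have hWd : ∀ i j, DifferentiableAt ℝ (W i j) p := fun i j =>
    ((hW i j).contDiffAt (hO.mem_nhds hp)).differentiableAt (by simp)
  have hform : ∀ i j, ∀ y ∈ O, fderiv ℝ (fun y => H y i j) y = ∑ k, H y i k • W k j y := by
    intro i j y hy
    ext v
    have := congrFun (congrFun (hHW y hy v) i) j
    rw [matD_apply, Matrix.mul_apply] at this
    rw [this]
    simp [evalForm_apply, sum_apply]
  -- Applying d to dH = HW gives 0 = dH∧W + H dW = H(dW + W∧W); the factor H is cancelled at the end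
  -- by B.
  have key : ∀ i j v w, ∑ k, H p i k * (extD (W k j) p v w + ∑ l, (W k l p ⋏ W l j p) v w) = 0 := by
    intro i j v w
    have h1 := extD_fderiv (hHp i j) v w
    have h2 : fderiv ℝ (fun y => H y i j) =ᶠ[nhds p] fun y => ∑ k, H y i k • W k j y :=
      Filter.eventually_of_mem (hO.mem_nhds hp) (hform i j)
    rw [extD_congr h2, extD_sum _ (fun k _ => (hHd i k).fun_smul (hWd k j))] at h1
    have h3 : ∀ k, extD (fun y => H y i k • W k j y) p v w
        = (∑ l, H p i l * (W l k p ⋏ W k j p) v w) + H p i k * extD (W k j) p v w := by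
      intro k
      rw [extD_smul (hHd i k) (hWd k j), hform i k p hp]
      simp only [wedge_apply, sum_apply, smul_apply,
        smul_eq_mul, Finset.sum_mul, mul_sub, Finset.sum_sub_distrib, mul_assoc]
    simp only [h3, Finset.sum_add_distrib] at h1
    rw [Finset.sum_comm] at h1
    simp only [mul_add, Finset.sum_add_distrib, Finset.mul_sum]
    linarith
  intro i j
  funext v w
  have hz : H p * Matrix.of (fun i j => extD (W i j) p v w + ∑ l, (W i l p ⋏ W l j p) v w) = 0 := by
    ext a b
    rw [Matrix.mul_apply]
    exact key a b v w
  have := congrArg (fun M => (B * M) i j) hz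
  simp only [← Matrix.mul_assoc, hB, Matrix.one_mul, Matrix.mul_zero] at this
  simpa [Finset.sum_apply] using this

end Forms

/-! ### The flat para-CR structure -/

theorem flatForms_zero_apply (m v : JetSpace) :
    flatForms 0 m v = -v 2 + m 3 * v 0 + 1 / 4 * m 3 ^ 2 * v 1 := by
  simp [flatForms, dX]

theorem flatForms_one_apply (m v : JetSpace) :
    flatForms 1 m v = v 3 - m 4 * v 0 - 1 / 2 * m 3 * m 4 * v 1 := by
  simp [flatForms, dX]

theorem flatForms_two_apply (m v : JetSpace) :
    flatForms 2 m v = -v 4 + 1 / 2 * m 4 ^ 2 * v 1 := by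
  simp [flatForms, dX]

theorem flatForms_three_apply (m v : JetSpace) :
    flatForms 3 m v = v 0 + 1 / 2 * m 3 * v 1 := by
  simp [flatForms, dX]

theorem flatForms_four_apply (m v : JetSpace) : flatForms 4 m v = -(1 / 2) * v 1 := by
  simp [flatForms, dX]

theorem contDiff_flatForms (i : Fin 5) : ContDiff ℝ ∞ (flatForms i) := by
  fin_cases i <;> simp [flatForms] <;> fun_prop

theorem linearIndependent_flatForms (m : JetSpace) :
    LinearIndependent ℝ (fun i => flatForms i m) := by
  rw [Fintype.linearIndependent_iff]
  intro g hg
  have key : ∀ v : JetSpace, ∑ i, g i * flatForms i m v = 0 := by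
    intro v
    simpa [sum_apply] using congrArg (fun L => L v) hg
  have h0 := key ![1, 0, 0, 0, 0]
  have h1 := key ![0, 1, 0, 0, 0]
  have h2 := key ![0, 0, 1, 0, 0]
  have h3 := key ![0, 0, 0, 1, 0]
  have h4 := key ![0, 0, 0, 0, 1]
  simp [Fin.sum_univ_five, flatForms_zero_apply, flatForms_one_apply, flatForms_two_apply,
    flatForms_three_apply, flatForms_four_apply] at h0 h1 h2 h3 h4
  simp [h2, h3, h4] at h0 h1
  simp [h0] at h1
  intro i
  fin_cases i <;> assumption

/-- The matrix of the coefficients of the differential of the section of the model. -/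
theorem extD_flatForms (m v w : JetSpace) :
    extD (flatForms 0) m v w = (flatForms 1 m ⋏ flatForms 3 m) v w ∧
    extD (flatForms 1) m v w = (flatForms 2 m ⋏ flatForms 3 m) v w
      + m 4 * (flatForms 1 m ⋏ flatForms 4 m) v w ∧
    extD (flatForms 2) m v w = 2 * m 4 * (flatForms 2 m ⋏ flatForms 4 m) v w ∧
    extD (flatForms 3) m v w = -(flatForms 1 m ⋏ flatForms 4 m) v w
      - m 4 * (flatForms 3 m ⋏ flatForms 4 m) v w ∧
    extD (flatForms 4) m v w = 0 := by
  -- Fixing the second argument reduces the derivative of a form to that of a polynomial function.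
  -- The result is the first five structure equations with Ω₂ = qω⁵ and the other Ω zero, which is
  -- the origin of `flatΩ`.
  have key : ∀ i v w, fderiv ℝ (flatForms i) m v w = fderiv ℝ (fun y => flatForms i y w) m v := by
    intro i v w
    rw [fderiv_clm_apply ((contDiff_flatForms i).differentiable (by simp) m)
      (differentiableAt_const w)]
    simp
  have c : ∀ i : Fin 5, ∀ v : JetSpace, fderiv ℝ (fun y : JetSpace => y i) m v = v i := by
    intro i v
    have : HasFDerivAt (fun y : JetSpace => y i) (dX i) m := (dX i).hasFDerivAt
    rw [this.fderiv]; rfl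
  have c2 : ∀ i : Fin 5, ∀ v : JetSpace, fderiv ℝ (fun y : JetSpace => y i ^ 2) m v = 2 * m i * v i := by
    intro i v
    rw [fderiv_fun_pow _ (by fun_prop)]
    simp [c]
  have cm : ∀ v : JetSpace, fderiv ℝ (fun y : JetSpace => y 3 * y 4) m v = m 3 * v 4 + m 4 * v 3 := by
    intro v
    rw [fderiv_fun_mul (by fun_prop) (by fun_prop)]
    simp [c]
  have e0 : ∀ v w, fderiv ℝ (flatForms 0) m v w = v 3 * w 0 + 1 / 2 * m 3 * v 3 * w 1 := by
    intro v w
    rw [key]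
    have : (fun y => flatForms 0 y w) = fun y => -w 2 + (w 0 * y 3 + 1 / 4 * w 1 * y 3 ^ 2) := by
      funext y; rw [flatForms_zero_apply]; ring
    rw [this, fderiv_const_add, fderiv_fun_add (by fun_prop) (by fun_prop),
      fderiv_const_mul (by fun_prop), fderiv_const_mul (by fun_prop)]
    simp only [add_apply, smul_apply, c, c2, smul_eq_mul]
    ring
  have e1 : ∀ v w, fderiv ℝ (flatForms 1) m v w
      = -v 4 * w 0 - 1 / 2 * (m 3 * v 4 + m 4 * v 3) * w 1 := by
    intro v w
    rw [key]
    have : (fun y => flatForms 1 y w) = fun y => w 3 + (-w 0 * y 4 + -(1 / 2) * w 1 * (y 3 * y 4)) := by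
      funext y; rw [flatForms_one_apply]; ring
    rw [this, fderiv_const_add, fderiv_fun_add (by fun_prop) (by fun_prop),
      fderiv_const_mul (by fun_prop), fderiv_const_mul (by fun_prop)]
    simp only [add_apply, smul_apply, c, cm, smul_eq_mul]
    ring
  have e2 : ∀ v w, fderiv ℝ (flatForms 2) m v w = m 4 * v 4 * w 1 := by
    intro v w
    rw [key]
    have : (fun y => flatForms 2 y w) = fun y => -w 4 + 1 / 2 * w 1 * y 4 ^ 2 := by
      funext y; rw [flatForms_two_apply]; ring
    rw [this, fderiv_const_add, fderiv_const_mul (by fun_prop)]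
    simp only [smul_apply, c2, smul_eq_mul]
    ring
  have e3 : ∀ v w, fderiv ℝ (flatForms 3) m v w = 1 / 2 * v 3 * w 1 := by
    intro v w
    rw [key]
    have : (fun y => flatForms 3 y w) = fun y => w 0 + 1 / 2 * w 1 * y 3 := by
      funext y; rw [flatForms_three_apply]; ring
    rw [this, fderiv_const_add, fderiv_const_mul (by fun_prop)]
    simp only [smul_apply, c, smul_eq_mul]
    ring
  have e4 : ∀ v w, fderiv ℝ (flatForms 4) m v w = 0 := by
    intro v w
    rw [key]
    simp [flatForms_four_apply]
  simp only [extD_apply, wedge_apply, e0, e1, e2, e3, e4, flatForms_zero_apply, flatForms_one_apply,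
    flatForms_two_apply, flatForms_three_apply, flatForms_four_apply]
  refine ⟨?_, ?_, ?_, ?_, ?_⟩ <;> ring

/-- Every term of dω¹, dω², dω³ contains ω² or ω³, and every term of dω¹, dω⁴, dω⁵ contains ω⁴ or
ω⁵. -/
theorem isParaCR_flatForms : IsParaCR flatForms where
  smooth := contDiff_flatForms
  coframe := linearIndependent_flatForms
  integrable₁ := by
    intro m i hi v w h
    obtain ⟨h0, h1, h2, -, -⟩ := extD_flatForms m v w
    have k1 := h 1 (by simp)
    have k2 := h 2 (by simp)
    simp only [wedge_apply, k1.1, k1.2, k2.1, k2.2] at h0 h1 h2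
    rcases hi with rfl | rfl | rfl
    · rw [h0]; ring
    · rw [h1]; ring
    · rw [h2]; ring
  integrable₂ := by
    intro m i hi v w h
    obtain ⟨h0, -, -, h3, h4⟩ := extD_flatForms m v w
    have k3 := h 3 (by simp)
    have k4 := h 4 (by simp)
    simp only [wedge_apply, k3.1, k3.2, k4.1, k4.2] at h0 h3
    rcases hi with rfl | rfl | rfl
    · rw [h0]; ring
    · rw [h3]; ring
    · exact h4

theorem paraCRRel_pdeForms (m : JetSpace) :
    ParaCRRel (fun j => pdeForms j m) (fun i => flatForms i m) := by
  refine ⟨!![-1, 0, 0, 0, 0; 0, 1, 0, 0, 0; 0, 0, -1, 0, 0; 0, 0, 0, 1, 1 / 2 * m 3;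
    0, 0, 0, 0, -(1 / 2)], ⟨?_, ?_, ?_, ?_⟩, ?_⟩
  · simp [Matrix.det_succ_row_zero, Fin.sum_univ_succ, Fin.succAbove]
  · intro j hj
    fin_cases j <;> simp_all
  · rintro i (rfl | rfl) j (rfl | rfl) <;> simp
  · rintro i (rfl | rfl) j (rfl | rfl) <;> simp
  · intro i
    ext v
    fin_cases i <;> simp [Fin.sum_univ_five, flatForms, pdeForms, dX] <;> ring

/-! ### The canonical coframe -/

/-- The pullback to the bundle of a 1-form of the jet space. -/
def liftForm (α : OneForm JetSpace) : OneForm BundleSpace := pullback Prod.fst α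

/-- The differential of a coordinate of the fibre. -/
def dB (l : Fin 5) : BundleSpace →L[ℝ] ℝ :=
  (ContinuousLinearMap.proj l).comp (ContinuousLinearMap.snd ℝ JetSpace Params)

theorem dB_apply (l : Fin 5) (v : BundleSpace) : dB l v = v.2 l := rfl

theorem liftForm_apply (α : OneForm JetSpace) (p v : BundleSpace) :
    liftForm α p v = α p.1 v.1 := by
  rw [liftForm, pullback_apply, fderiv_fst]
  rfl

/-- The forms `θ` of the canonical coframe. -/
def canonθ : Fin 5 → OneForm BundleSpace :=
  ![fun p => (p.2 0 ^ 2) • liftForm (flatForms 0) p,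
    fun p => p.2 2 • liftForm (flatForms 0) p +
      (p.2 0 * Real.exp (p.2 1)) • liftForm (flatForms 1) p,
    fun p => (p.2 2 ^ 2 / (2 * p.2 0 ^ 2)) • liftForm (flatForms 0) p +
      (p.2 2 * Real.exp (p.2 1) / p.2 0) • liftForm (flatForms 1) p +
      (Real.exp (p.2 1) ^ 2) • liftForm (flatForms 2) p,
    fun p => p.2 3 • liftForm (flatForms 0) p +
      (p.2 0 * Real.exp (-p.2 1)) • liftForm (flatForms 3) p,
    fun p => (-p.2 3 ^ 2 / (2 * p.2 0 ^ 2)) • liftForm (flatForms 0) p +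
      (-(p.2 3 * Real.exp (-p.2 1) / p.2 0)) • liftForm (flatForms 3) p +
      (Real.exp (-p.2 1) ^ 2) • liftForm (flatForms 4) p]

/-- The forms `Ω` of the canonical coframe. -/
def canonΩ : Fin 5 → OneForm BundleSpace :=
  ![fun p => (-(p.2 0 ^ 2 * p.2 4)) • liftForm (flatForms 0) p +
      (-(p.2 3 * Real.exp (p.2 1) / p.2 0)) • liftForm (flatForms 1) p +
      (p.2 2 * Real.exp (-p.2 1) / p.2 0) • liftForm (flatForms 3) p + (2 / p.2 0) • dB 0,
    fun p => (p.2 2 * p.2 3 / (2 * p.2 0 ^ 2)) • liftForm (flatForms 0) p +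
      (p.2 3 * Real.exp (p.2 1) / (2 * p.2 0)) • liftForm (flatForms 1) p +
      (p.2 2 * Real.exp (-p.2 1) / (2 * p.2 0)) • liftForm (flatForms 3) p +
      p.1 4 • liftForm (flatForms 4) p - dB 1,
    fun p => (-(p.2 2 * p.2 4 / 2)) • liftForm (flatForms 0) p +
      (-(Real.exp (p.2 1) * (p.2 2 * p.2 3 + p.2 0 ^ 4 * p.2 4) / (2 * p.2 0 ^ 3))) •
        liftForm (flatForms 1) p +
      (-(p.2 3 * Real.exp (p.2 1) ^ 2 / p.2 0 ^ 2)) • liftForm (flatForms 2) p +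
      (p.2 2 ^ 2 * Real.exp (-p.2 1) / (2 * p.2 0 ^ 3)) • liftForm (flatForms 3) p +
      (p.2 2 * p.1 4 / p.2 0 ^ 2) • liftForm (flatForms 4) p +
      (1 / p.2 0 ^ 2) • dB 2 + (-(p.2 2 / p.2 0 ^ 2)) • dB 1 + (-(p.2 2 / p.2 0 ^ 3)) • dB 0,
    fun p => (-(p.2 3 * p.2 4 / 2)) • liftForm (flatForms 0) p +
      (-(Real.exp (p.2 1) * p.2 3 ^ 2 / (2 * p.2 0 ^ 3))) • liftForm (flatForms 1) p +
      (Real.exp (-p.2 1) * (p.2 2 * p.2 3 - p.2 0 ^ 4 * p.2 4) / (2 * p.2 0 ^ 3)) •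
        liftForm (flatForms 3) p +
      (-((p.1 4 * p.2 3 + p.2 2 * Real.exp (-p.2 1) ^ 2) / p.2 0 ^ 2)) • liftForm (flatForms 4) p +
      (1 / p.2 0 ^ 2) • dB 3 + (p.2 3 / p.2 0 ^ 2) • dB 1 + (-(p.2 3 / p.2 0 ^ 3)) • dB 0,
    fun p => (p.2 0 ^ 2 * p.2 4 ^ 2 / 2) • liftForm (flatForms 0) p +
      (Real.exp (p.2 1) * p.2 3 * p.2 4 / p.2 0) • liftForm (flatForms 1) p +
      (Real.exp (p.2 1) ^ 2 * p.2 3 ^ 2 / p.2 0 ^ 4) • liftForm (flatForms 2) p +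
      (-(p.2 2 * Real.exp (-p.2 1) * p.2 4 / p.2 0)) • liftForm (flatForms 3) p +
      (-((2 * p.1 4 * p.2 2 * p.2 3 + p.2 2 ^ 2 * Real.exp (-p.2 1) ^ 2) / p.2 0 ^ 4)) •
        liftForm (flatForms 4) p +
      (2 * p.2 2 * p.2 3 / p.2 0 ^ 4) • dB 1 + (-(2 * p.2 4 / p.2 0)) • dB 0 +
      (p.2 2 / p.2 0 ^ 4) • dB 3 + (-(p.2 3 / p.2 0 ^ 4)) • dB 2 - dB 4]

theorem contDiff_liftForm (i : Fin 5) : ContDiff ℝ ∞ (liftForm (flatForms i)) := by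
  have h : liftForm (flatForms i) = fun p : BundleSpace =>
      (flatForms i p.1).comp (ContinuousLinearMap.fst ℝ JetSpace Params) := by
    funext p
    exact ContinuousLinearMap.ext fun v => liftForm_apply _ p v
  rw [h]
  exact ((contDiff_flatForms i).comp contDiff_fst).clm_comp contDiff_const

theorem contDiffOn_canonθ (i : Fin 5) : ContDiffOn ℝ ∞ (canonθ i) bundle := by
  have hr : ∀ p ∈ bundle, p.2 0 ≠ 0 := fun p hp => hp
  have hr2 : ∀ p ∈ bundle, 2 * p.2 0 ^ 2 ≠ 0 := fun p hp => by have := hr p hp; positivity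
  -- The lifted flat forms become an opaque family `L`, of which only the smoothness is used.
  obtain ⟨L, hL⟩ : ∃ L : Fin 5 → BundleSpace → (BundleSpace →L[ℝ] ℝ),
      L = fun i => liftForm (flatForms i) := ⟨_, rfl⟩
  have hL' : ∀ i, liftForm (flatForms i) = L i := fun i => by rw [hL]
  have h : ∀ i, ContDiffOn ℝ ∞ (L i) bundle := fun i => hL' i ▸ (contDiff_liftForm i).contDiffOn
  have h0 := h 0
  have h1 := h 1
  have h2 := h 2
  have h3 := h 3
  have h4 := h 4
  fin_cases i <;> simp only [canonθ, Matrix.cons_val, Fin.zero_eta, Fin.mk_one, Fin.reduceFinMk, hL'] <;>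
    fun_prop (disch := assumption)

theorem contDiffOn_canonΩ (i : Fin 5) : ContDiffOn ℝ ∞ (canonΩ i) bundle := by
  have hr : ∀ p ∈ bundle, p.2 0 ≠ 0 := fun p hp => hp
  have hr1 : ∀ p ∈ bundle, 2 * p.2 0 ≠ 0 := fun p hp => by have := hr p hp; positivity
  have hr2 : ∀ p ∈ bundle, 2 * p.2 0 ^ 2 ≠ 0 := fun p hp => by have := hr p hp; positivity
  have hr3 : ∀ p ∈ bundle, 2 * p.2 0 ^ 3 ≠ 0 := fun p hp => by have := hr p hp; positivity
  have hr4 : ∀ p ∈ bundle, p.2 0 ^ 3 ≠ 0 := fun p hp => by have := hr p hp; positivity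
  have hr5 : ∀ p ∈ bundle, p.2 0 ^ 2 ≠ 0 := fun p hp => by have := hr p hp; positivity
  have hr6 : ∀ p ∈ bundle, p.2 0 ^ 4 ≠ 0 := fun p hp => by have := hr p hp; positivity
  obtain ⟨L, hL⟩ : ∃ L : Fin 5 → BundleSpace → (BundleSpace →L[ℝ] ℝ),
      L = fun i => liftForm (flatForms i) := ⟨_, rfl⟩
  have hL' : ∀ i, liftForm (flatForms i) = L i := fun i => by rw [hL]
  have h : ∀ i, ContDiffOn ℝ ∞ (L i) bundle := fun i => hL' i ▸ (contDiff_liftForm i).contDiffOn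
  have h0 := h 0
  have h1 := h 1
  have h2 := h 2
  have h3 := h 3
  have h4 := h 4
  fin_cases i <;> simp only [canonΩ, Matrix.cons_val, Fin.zero_eta, Fin.mk_one, Fin.reduceFinMk, hL'] <;>
    fun_prop (disch := assumption)

/-- The forms `Ω` along the identity section. -/
def flatΩ : Fin 5 → OneForm JetSpace := ![0, fun m => m 4 • flatForms 4 m, 0, 0, 0]

theorem hasFDerivAt_div {E : Type*} [NormedAddCommGroup E] [NormedSpace ℝ E] {f g : E → ℝ}
    {f' g' : E →L[ℝ] ℝ} {x : E} (hf : HasFDerivAt f f' x) (hg : HasFDerivAt g g' x)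
    (hx : g x ≠ 0) :
    HasFDerivAt (fun y => f y / g y) ((1 / g x) • f' - (f x / g x ^ 2) • g') x := by
  have h := hf.fun_mul ((hasDerivAt_inv hx).comp_hasFDerivAt x hg)
  simp only [Function.comp_def, ← div_eq_mul_inv] at h
  refine h.congr_fderiv (ContinuousLinearMap.ext fun v => ?_)
  simp
  field_simp
  ring

/-- The derivative of the parametrisation of the structure group. -/
theorem matD_matU {b : Params} (hb : b ∈ paramSet) (β : Params) : matD matU b β =
    let r := b 0
    let e := Real.exp (b 1)
    let e' := Real.exp (-b 1)
    let s := b 2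
    let t := b 3
    let u := b 4
    !![-(e' * β 1) / r - e' * β 0 / r ^ 2,
        (e' * β 1 * (s * t + r ^ 4 * u) -
          e' * (β 2 * t + s * β 3 + 4 * r ^ 3 * β 0 * u + r ^ 4 * β 4)) / (2 * r ^ 3) +
          3 * e' * (s * t + r ^ 4 * u) * β 0 / (2 * r ^ 4),
        -β 3 / r ^ 2 + 2 * t * β 0 / r ^ 3, 0,
        -(e * β 1 * t ^ 2 + 2 * e * t * β 3) / (2 * r ^ 3) + 3 * e * t ^ 2 * β 0 / (2 * r ^ 4);
       0, β 0 * e' - r * e' * β 1, 0, 0, 0;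
       0, (β 2 * e' - s * e' * β 1) / r - s * e' * β 0 / r ^ 2, 0, 0,
        (β 3 * e + t * e * β 1) / r - t * e * β 0 / r ^ 2;
       0, (2 * s * β 2 * e' - s ^ 2 * e' * β 1) / (2 * r ^ 3) -
          3 * s ^ 2 * e' * β 0 / (2 * r ^ 4),
        β 2 / r ^ 2 - 2 * s * β 0 / r ^ 3, e * β 1 / r - e * β 0 / r ^ 2,
        (e * β 1 * (s * t - r ^ 4 * u) +
          e * (β 2 * t + s * β 3 - 4 * r ^ 3 * β 0 * u - r ^ 4 * β 4)) / (2 * r ^ 3) -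
          3 * e * (s * t - r ^ 4 * u) * β 0 / (2 * r ^ 4);
       0, 0, 0, 0, β 0 * e + r * e * β 1] := by
  have hr0 : b 0 ≠ 0 := hb
  have c : ∀ l : Fin 5, HasFDerivAt (fun y : Params => y l)
      (ContinuousLinearMap.proj (R := ℝ) (φ := fun _ : Fin 5 => ℝ) l) b := fun l =>
    (ContinuousLinearMap.proj (R := ℝ) (φ := fun _ : Fin 5 => ℝ) l).hasFDerivAt
  have hr := c 0
  have hs := c 2
  have ht := c 3
  have hu := c 4
  have he := (c 1).exp
  have he' := (c 1).fun_neg.exp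
  have hr2 := (HasFDerivAt.pow hr 2)
  have hr3 := (HasFDerivAt.pow hr 3).const_mul 2
  have hr4 := (HasFDerivAt.pow hr 4)
  have n2 : b 0 ^ 2 ≠ 0 := pow_ne_zero _ hr0
  have n3 : 2 * b 0 ^ 3 ≠ 0 := mul_ne_zero two_ne_zero (pow_ne_zero _ hr0)
  have h00 := (hasFDerivAt_div he' hr hr0).fderiv
  have h01 := (hasFDerivAt_div (he'.fun_mul ((hs.fun_mul ht).fun_add (hr4.fun_mul hu))).fun_neg hr3 n3).fderiv
  have h02 := (hasFDerivAt_div ht.fun_neg hr2 n2).fderiv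
  have h04 := (hasFDerivAt_div (he.fun_mul (HasFDerivAt.pow ht 2)).fun_neg hr3 n3).fderiv
  have h11 := (hr.fun_mul he').fderiv
  have h21 := (hasFDerivAt_div (hs.fun_mul he') hr hr0).fderiv
  have h24 := (hasFDerivAt_div (ht.fun_mul he) hr hr0).fderiv
  have h31 := (hasFDerivAt_div ((HasFDerivAt.pow hs 2).fun_mul he') hr3 n3).fderiv
  have h32 := (hasFDerivAt_div hs hr2 n2).fderiv
  have h33 := (hasFDerivAt_div he hr hr0).fderiv
  have h34 := (hasFDerivAt_div (he.fun_mul ((hs.fun_mul ht).fun_sub (hr4.fun_mul hu))) hr3 n3).fderiv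
  have h44 := (hr.fun_mul he).fderiv
  ext i j
  rw [matD_apply]
  fin_cases i <;> fin_cases j <;>
    simp only [matU, Matrix.of_apply, Matrix.cons_val, Fin.zero_eta, Fin.mk_one, Fin.reduceFinMk,
      h00, h01, h02, h04, h11, h21, h24, h31, h32, h33, h34, h44, fderiv_fun_const, Pi.zero_apply,
      zero_apply] <;>
    simp <;> field_simp <;> ring

/-! ### The canonical connection -/

theorem evalForm_connMatrix {E : Type*} [NormedAddCommGroup E] [NormedSpace ℝ E]
    (θ Ω : Fin 5 → OneForm E) (p v : E) : evalForm (connMatrix θ Ω) p v =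
    !![1 / 2 * Ω 0 p v - Ω 1 p v, -(1 / 2 * Ω 4 p v), Ω 3 p v, θ 4 p v, 0;
       θ 0 p v, -(1 / 2 * Ω 0 p v) - Ω 1 p v, θ 3 p v, 0, θ 4 p v;
       θ 1 p v, -Ω 2 p v, 0, θ 3 p v, -Ω 3 p v;
       θ 2 p v, 0, -Ω 2 p v, 1 / 2 * Ω 0 p v + Ω 1 p v, -(1 / 2 * Ω 4 p v);
       0, θ 2 p v, -θ 1 p v, θ 0 p v, -(1 / 2 * Ω 0 p v) + Ω 1 p v] := by
  ext i j
  rw [evalForm_apply]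
  fin_cases i <;> fin_cases j <;> rfl

theorem canonθ_apply (p v : BundleSpace) :
    canonθ 0 p v = p.2 0 ^ 2 * flatForms 0 p.1 v.1 ∧
    canonθ 1 p v = p.2 2 * flatForms 0 p.1 v.1 +
      p.2 0 * Real.exp (p.2 1) * flatForms 1 p.1 v.1 ∧
    canonθ 2 p v = p.2 2 ^ 2 / (2 * p.2 0 ^ 2) * flatForms 0 p.1 v.1 +
      p.2 2 * Real.exp (p.2 1) / p.2 0 * flatForms 1 p.1 v.1 +
      Real.exp (p.2 1) ^ 2 * flatForms 2 p.1 v.1 ∧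
    canonθ 3 p v = p.2 3 * flatForms 0 p.1 v.1 +
      p.2 0 * Real.exp (-p.2 1) * flatForms 3 p.1 v.1 ∧
    canonθ 4 p v = -p.2 3 ^ 2 / (2 * p.2 0 ^ 2) * flatForms 0 p.1 v.1 +
      -(p.2 3 * Real.exp (-p.2 1) / p.2 0) * flatForms 3 p.1 v.1 +
      Real.exp (-p.2 1) ^ 2 * flatForms 4 p.1 v.1 := by
  simp [canonθ, liftForm_apply]

theorem canonΩ_apply (p v : BundleSpace) :
    canonΩ 0 p v = -(p.2 0 ^ 2 * p.2 4) * flatForms 0 p.1 v.1 +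
      -(p.2 3 * Real.exp (p.2 1) / p.2 0) * flatForms 1 p.1 v.1 +
      p.2 2 * Real.exp (-p.2 1) / p.2 0 * flatForms 3 p.1 v.1 + 2 / p.2 0 * v.2 0 ∧
    canonΩ 1 p v = p.2 2 * p.2 3 / (2 * p.2 0 ^ 2) * flatForms 0 p.1 v.1 +
      p.2 3 * Real.exp (p.2 1) / (2 * p.2 0) * flatForms 1 p.1 v.1 +
      p.2 2 * Real.exp (-p.2 1) / (2 * p.2 0) * flatForms 3 p.1 v.1 +
      p.1 4 * flatForms 4 p.1 v.1 - v.2 1 ∧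
    canonΩ 2 p v = -(p.2 2 * p.2 4 / 2) * flatForms 0 p.1 v.1 +
      -(Real.exp (p.2 1) * (p.2 2 * p.2 3 + p.2 0 ^ 4 * p.2 4) / (2 * p.2 0 ^ 3)) *
        flatForms 1 p.1 v.1 +
      -(p.2 3 * Real.exp (p.2 1) ^ 2 / p.2 0 ^ 2) * flatForms 2 p.1 v.1 +
      p.2 2 ^ 2 * Real.exp (-p.2 1) / (2 * p.2 0 ^ 3) * flatForms 3 p.1 v.1 +
      p.2 2 * p.1 4 / p.2 0 ^ 2 * flatForms 4 p.1 v.1 +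
      1 / p.2 0 ^ 2 * v.2 2 + -(p.2 2 / p.2 0 ^ 2) * v.2 1 + -(p.2 2 / p.2 0 ^ 3) * v.2 0 ∧
    canonΩ 3 p v = -(p.2 3 * p.2 4 / 2) * flatForms 0 p.1 v.1 +
      -(Real.exp (p.2 1) * p.2 3 ^ 2 / (2 * p.2 0 ^ 3)) * flatForms 1 p.1 v.1 +
      Real.exp (-p.2 1) * (p.2 2 * p.2 3 - p.2 0 ^ 4 * p.2 4) / (2 * p.2 0 ^ 3) *
        flatForms 3 p.1 v.1 +
      -((p.1 4 * p.2 3 + p.2 2 * Real.exp (-p.2 1) ^ 2) / p.2 0 ^ 2) * flatForms 4 p.1 v.1 +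
      1 / p.2 0 ^ 2 * v.2 3 + p.2 3 / p.2 0 ^ 2 * v.2 1 + -(p.2 3 / p.2 0 ^ 3) * v.2 0 ∧
    canonΩ 4 p v = p.2 0 ^ 2 * p.2 4 ^ 2 / 2 * flatForms 0 p.1 v.1 +
      Real.exp (p.2 1) * p.2 3 * p.2 4 / p.2 0 * flatForms 1 p.1 v.1 +
      Real.exp (p.2 1) ^ 2 * p.2 3 ^ 2 / p.2 0 ^ 4 * flatForms 2 p.1 v.1 +
      -(p.2 2 * Real.exp (-p.2 1) * p.2 4 / p.2 0) * flatForms 3 p.1 v.1 +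
      -((2 * p.1 4 * p.2 2 * p.2 3 + p.2 2 ^ 2 * Real.exp (-p.2 1) ^ 2) / p.2 0 ^ 4) *
        flatForms 4 p.1 v.1 +
      2 * p.2 2 * p.2 3 / p.2 0 ^ 4 * v.2 1 + -(2 * p.2 4 / p.2 0) * v.2 0 +
      p.2 2 / p.2 0 ^ 4 * v.2 3 + -(p.2 3 / p.2 0 ^ 4) * v.2 2 - v.2 4 := by
  simp [canonΩ, liftForm_apply, dB_apply]

theorem flatΩ_apply (m v : JetSpace) : flatΩ 0 m v = 0 ∧ flatΩ 1 m v = m 4 * flatForms 4 m v ∧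
    flatΩ 2 m v = 0 ∧ flatΩ 3 m v = 0 ∧ flatΩ 4 m v = 0 := by
  simp [flatΩ]

/-- The connection is the gauge transform of its value along the identity section. -/
theorem canon_mul_matU {p : BundleSpace} (hp : p ∈ bundle) (v : BundleSpace) :
    evalForm (connMatrix canonθ canonΩ) p v * matU p.2 =
      matU p.2 * evalForm (connMatrix flatForms flatΩ) p.1 v.1 - matD matU p.2 v.2 := by
  have hr : p.2 0 ≠ 0 := hp
  have he : Real.exp (-p.2 1) = (Real.exp (p.2 1))⁻¹ := Real.exp_neg _
  have hpos := (Real.exp_pos (p.2 1)).ne'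
  obtain ⟨t0, t1, t2, t3, t4⟩ := canonθ_apply p v
  obtain ⟨o0, o1, o2, o3, o4⟩ := canonΩ_apply p v
  obtain ⟨f0, f1, f2, f3, f4⟩ := flatΩ_apply p.1 v.1
  rw [evalForm_connMatrix, evalForm_connMatrix, matD_matU hp, t0, t1, t2, t3, t4, o0, o1, o2, o3, o4,
    f0, f1, f2, f3, f4]
  clear t0 t1 t2 t3 t4 o0 o1 o2 o3 o4 f0 f1 f2 f3 f4
  -- The values of the flat forms, e^φ and r are now independent unknowns, and each entry is an
  -- identity between rational functions. Stating the gauge transformation as ωU = UW - dU has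
  -- avoided the inverse of U.
  generalize flatForms 0 p.1 v.1 = F0
  generalize flatForms 1 p.1 v.1 = F1
  generalize flatForms 2 p.1 v.1 = F2
  generalize flatForms 3 p.1 v.1 = F3
  generalize flatForms 4 p.1 v.1 = F4
  simp only [matU, he]
  generalize Real.exp (p.2 1) = e at hpos ⊢
  generalize p.2 0 = r at hr ⊢
  ext i j
  rw [Matrix.sub_apply, Matrix.mul_apply, Matrix.mul_apply, Fin.sum_univ_five, Fin.sum_univ_five]
  fin_cases i <;> fin_cases j <;>
    simp only [Matrix.of_apply, Matrix.cons_val, Fin.zero_eta, Fin.mk_one, Fin.reduceFinMk] <;>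
    field_simp <;> ring

/-- The map `h` from the jet space to `SO(3, 2)`. -/
def matH (m : JetSpace) : Matrix (Fin 5) (Fin 5) ℝ :=
  -- Column 3 is the isotropic vector (-y/2, (x² + zy)/2, x, 1, -z), which depends on x, y, z alone;
  -- p and q enter through columns 0, 1 and 2, and of these column 0 is the one that matters modulo
  -- K.
  !![1 + m 4 * m 1 * (1 / 2), 0, 0, -m 1 * (1 / 2), 0;
     -m 2 + m 3 * m 0 + m 3 ^ 2 * m 1 * (1 / 4) - m 4 * (m 0 ^ 2 + m 2 * m 1) * (1 / 2),
      1 + m 4 * m 1 * (1 / 2), m 0 + m 3 * m 1 * (1 / 2), (m 0 ^ 2 + m 2 * m 1) * (1 / 2),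
      -m 1 * (1 / 2);
     m 3 - m 4 * m 0, 0, 1, m 0, 0;
     -m 4, 0, 0, 1, 0;
     -m 3 ^ 2 * (1 / 2) + m 4 * m 2, -m 4, -m 3, -m 2, 1]

theorem matH_orthogonal (m : JetSpace) : (matH m)ᵀ * formJ * matH m = formJ := by
  rw [isOrthogonal_iff]
  intro i j
  fin_cases i <;> fin_cases j <;> simp [formJ, matH] <;> ring

theorem matH_det (m : JetSpace) : (matH m).det = 1 := by
  simp [matH, Matrix.det_succ_row_zero, Fin.sum_univ_succ, Fin.succAbove]
  ring

theorem contDiff_matH (i j : Fin 5) : ContDiff ℝ ∞ (fun m => matH m i j) := by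
  fin_cases i <;> fin_cases j <;>
    simp only [matH, Matrix.of_apply, Matrix.cons_val, Fin.zero_eta, Fin.mk_one, Fin.reduceFinMk] <;>
    fun_prop

theorem matDiffAt_matH (m : JetSpace) : MatDiffAt matH m := fun i j =>
  (contDiff_matH i j).differentiable (by simp) m

/-- The matrix h is the solution of dh = hW with h = 1 at the origin; it happens to be polynomial.
-/
theorem matD_matH (m v : JetSpace) :
    matD matH m v = matH m * evalForm (connMatrix flatForms flatΩ) m v := by
  have c : ∀ l : Fin 5, HasFDerivAt (fun y : Params => y l)
      (ContinuousLinearMap.proj (R := ℝ) (φ := fun _ : Fin 5 => ℝ) l) m := fun l =>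
    (ContinuousLinearMap.proj (R := ℝ) (φ := fun _ : Fin 5 => ℝ) l).hasFDerivAt
  have h00 := (((c 4).fun_mul (c 1)).mul_const (1 / 2)).fderiv
  have h03 := ((c 1).fun_neg.mul_const (1 / 2)).fderiv
  have h10 := ((((c 2).fun_neg.fun_add ((c 3).fun_mul (c 0))).fun_add
    ((((c 3).pow 2).fun_mul (c 1)).mul_const (1 / 4))).fun_sub
    (((c 4).fun_mul (((c 0).pow 2).fun_add ((c 2).fun_mul (c 1)))).mul_const (1 / 2))).fderiv
  have h12 := ((c 0).fun_add (((c 3).fun_mul (c 1)).mul_const (1 / 2))).fderiv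
  have h13 := ((((c 0).pow 2).fun_add ((c 2).fun_mul (c 1))).mul_const (1 / 2)).fderiv
  have h20 := ((c 3).fun_sub ((c 4).fun_mul (c 0))).fderiv
  have h40 := ((((c 3).pow 2).fun_neg.mul_const (1 / 2)).fun_add ((c 4).fun_mul (c 2))).fderiv
  have hl : ∀ l, fderiv ℝ (fun y : JetSpace => y l) m v = v l := fun l => by rw [(c l).fderiv]; rfl
  have hn : ∀ l, fderiv ℝ (fun y : JetSpace => -y l) m v = -v l := fun l => by
    rw [(c l).fun_neg.fderiv]; rfl
  obtain ⟨f0, f1, f2, f3, f4⟩ := flatΩ_apply m v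
  rw [evalForm_connMatrix, f0, f1, f2, f3, f4, flatForms_zero_apply, flatForms_one_apply,
    flatForms_two_apply, flatForms_three_apply, flatForms_four_apply]
  ext i j
  rw [matD_apply, Matrix.mul_apply, Fin.sum_univ_five]
  fin_cases i <;> fin_cases j <;>
    simp only [matH, Matrix.of_apply, Matrix.cons_val, Fin.zero_eta, Fin.mk_one, Fin.reduceFinMk,
      fderiv_const_add,
      h00, h03, h10, h12, h13, h20, h40, fderiv_fun_const, Pi.zero_apply, zero_apply, hl, hn] <;>
    simp <;> ring

theorem contDiffOn_matU (i j : Fin 5) : ContDiffOn ℝ ∞ (fun b => matU b i j) paramSet := by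
  have hr : ∀ b ∈ paramSet, b 0 ≠ 0 := fun b hb => hb
  have hr2 : ∀ b ∈ paramSet, b 0 ^ 2 ≠ 0 := fun b hb => pow_ne_zero _ (hr b hb)
  have hr3 : ∀ b ∈ paramSet, 2 * b 0 ^ 3 ≠ 0 := fun b hb =>
    mul_ne_zero two_ne_zero (pow_ne_zero _ (hr b hb))
  fin_cases i <;> fin_cases j <;>
    simp only [matU, Matrix.of_apply, Matrix.cons_val, Fin.zero_eta, Fin.mk_one, Fin.reduceFinMk] <;>
    fun_prop (disch := assumption)

theorem matDiffAt_matU {b : Params} (hb : b ∈ paramSet) : MatDiffAt matU b := fun i j =>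
  ((contDiffOn_matU i j).contDiffAt (paramSet_isOpen.mem_nhds hb)).differentiableAt (by simp)

/-- The entries 11 and 44, that is re^{-φ} and re^φ, detect the variations of r and φ. Then 32 and
02 detect those of s and s̄, and 01 that of u. -/
theorem matD_matU_injective {b : Params} (hb : b ∈ paramSet) {β : Params}
    (h : matD matU b β = 0) : β = 0 := by
  have hr : b 0 ≠ 0 := hb
  have he := (Real.exp_pos (b 1)).ne'
  have he' := (Real.exp_pos (-b 1)).ne'
  rw [matD_matU hb] at h
  have h11 := congrFun (congrFun h 1) 1
  have h44 := congrFun (congrFun h 4) 4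
  have h32 := congrFun (congrFun h 3) 2
  have h02 := congrFun (congrFun h 0) 2
  have h01 := congrFun (congrFun h 0) 1
  simp only [Matrix.of_apply, Matrix.cons_val, Matrix.zero_apply] at h11 h44 h32 h02 h01
  have a : β 0 - b 0 * β 1 = 0 := by
    have : Real.exp (-b 1) * (β 0 - b 0 * β 1) = 0 := by linarith
    exact (mul_eq_zero.1 this).resolve_left he'
  have a' : β 0 + b 0 * β 1 = 0 := by
    have : Real.exp (b 1) * (β 0 + b 0 * β 1) = 0 := by linarith
    exact (mul_eq_zero.1 this).resolve_left he
  have b0 : β 0 = 0 := by linarith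
  have b1 : β 1 = 0 := by
    have : b 0 * β 1 = 0 := by linarith
    exact (mul_eq_zero.1 this).resolve_left hr
  simp [b0, hr] at h32 h02
  simp [b0, b1, h32, h02, hr] at h01
  ext i
  fin_cases i <;> assumption

/-- The inverse of `matU b`. -/
def matUinv (b : Params) : Matrix (Fin 5) (Fin 5) ℝ := formJ * (matU b)ᵀ * formJ

theorem matUinv_mul {b : Params} (hb : b ∈ paramSet) : matUinv b * matU b = 1 :=
  orthogonal_inv_left (matU_orthogonal hb)

theorem mul_matUinv {b : Params} (hb : b ∈ paramSet) : matU b * matUinv b = 1 :=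
  orthogonal_inv_right (matU_orthogonal hb)

theorem matU_inv_eq {b : Params} (hb : b ∈ paramSet) : (matU b)⁻¹ = matUinv b :=
  orthogonal_inv_eq (matU_orthogonal hb)

theorem MatDiffAt.conjJ {E : Type*} [NormedAddCommGroup E] [NormedSpace ℝ E]
    {X : E → Matrix (Fin 5) (Fin 5) ℝ} {x : E} (h : MatDiffAt X x) :
    MatDiffAt (fun y => formJ * (X y)ᵀ * formJ) x :=
  ((matDiffAt_const _ _).mul h.transpose).mul (matDiffAt_const _ _)

theorem matD_matUinv {b : Params} (hb : b ∈ paramSet) (β : Params) :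
    matD matUinv b β = -(matUinv b * matD matU b β * matUinv b) := by
  have hd : MatDiffAt matUinv b := (matDiffAt_matU hb).conjJ
  have h1 : (fun y => matUinv y * matU y) =ᶠ[nhds b] fun _ => 1 :=
    Filter.eventually_of_mem (paramSet_isOpen.mem_nhds hb) fun y hy => matUinv_mul hy
  have h2 := matD_congr h1 β
  rw [matD_const, matD_mul hd (matDiffAt_matU hb)] at h2
  have h3 := congrArg (· * matUinv b) h2
  simp only [Matrix.add_mul, Matrix.mul_assoc, mul_matUinv hb, Matrix.mul_one, Matrix.zero_mul] at h3
  rw [Matrix.mul_assoc]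
  exact eq_neg_of_add_eq_zero_left h3

/-- The map `H` from the bundle to `SO(3, 2)`. -/
def bundleH (p : BundleSpace) : Matrix (Fin 5) (Fin 5) ℝ := matH p.1 * matUinv p.2

theorem matDiffAt_bundleH {p : BundleSpace} (hp : p ∈ bundle) : MatDiffAt bundleH p :=
  ((matDiffAt_matH p.1).comp differentiableAt_fst).mul
    (MatDiffAt.comp (matDiffAt_matU hp).conjJ differentiableAt_snd)

/-- By the product rule, d(hU⁻¹) = hWU⁻¹ - hU⁻¹dU U⁻¹ = hU⁻¹(UWU⁻¹ - dU U⁻¹). -/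
theorem matD_bundleH {p : BundleSpace} (hp : p ∈ bundle) (v : BundleSpace) :
    matD bundleH p v = bundleH p * evalForm (connMatrix canonθ canonΩ) p v := by
  have hp' : p.2 ∈ paramSet := hp
  have h1 : MatDiffAt (fun q : BundleSpace => matH q.1) p :=
    (matDiffAt_matH p.1).comp differentiableAt_fst
  have h2 : MatDiffAt (fun q : BundleSpace => matUinv q.2) p :=
    MatDiffAt.comp (matDiffAt_matU hp).conjJ differentiableAt_snd
  have h3 : matD bundleH p v = _ := matD_mul h1 h2 v
  rw [h3, matD_comp (matDiffAt_matH p.1) differentiableAt_fst,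
    matD_comp (X := matUinv) (matDiffAt_matU hp).conjJ differentiableAt_snd, matD_matH,
    matD_matUinv hp', fderiv_fst, fderiv_snd]
  change matH p.1 * evalForm (connMatrix flatForms flatΩ) p.1 v.1 * matUinv p.2 +
    matH p.1 * -(matUinv p.2 * matD matU p.2 v.2 * matUinv p.2) = _
  have h4 := canon_mul_matU hp v
  have h5 : evalForm (connMatrix canonθ canonΩ) p v =
      (matU p.2 * evalForm (connMatrix flatForms flatΩ) p.1 v.1 - matD matU p.2 v.2)
        * matUinv p.2 := by
    rw [← h4, Matrix.mul_assoc, mul_matUinv hp', Matrix.mul_one]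
  rw [h5, bundleH]
  have h6 : ∀ X, matUinv p.2 * (matU p.2 * X) = X := fun X => by
    rw [← Matrix.mul_assoc, matUinv_mul hp', Matrix.one_mul]
  simp only [Matrix.mul_assoc, Matrix.sub_mul, Matrix.mul_sub, h6, Matrix.mul_neg]
  abel

theorem bundleH_orthogonal {p : BundleSpace} (hp : p ∈ bundle) :
    (bundleH p)ᵀ * formJ * bundleH p = formJ := by
  have h1 := matH_orthogonal p.1
  have h2 : (matUinv p.2)ᵀ * formJ * matUinv p.2 = formJ := by
    have := matSO_orthogonal (elemU p.2 hp)⁻¹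
    rwa [matSO_inv] at this
  rw [bundleH, Matrix.transpose_mul]
  calc _ = (matUinv p.2)ᵀ * ((matH p.1)ᵀ * formJ * matH p.1) * matUinv p.2 := by
        simp only [Matrix.mul_assoc]
    _ = formJ := by rw [h1, h2]

theorem contDiffOn_bundleH (i j : Fin 5) : ContDiffOn ℝ ∞ (fun p => bundleH p i j) bundle := by
  have h1 : ∀ a b, ContDiffOn ℝ ∞ (fun p : BundleSpace => matH p.1 a b) bundle := fun a b =>
    ((contDiff_matH a b).comp contDiff_fst).contDiffOn
  have h2 : ∀ a b, ContDiffOn ℝ ∞ (fun p : BundleSpace => matU p.2 a b) bundle := fun a b =>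
    (contDiffOn_matU a b).comp contDiff_snd.contDiffOn fun p hp => hp
  have h3 : ∀ a b, ContDiffOn ℝ ∞ (fun p : BundleSpace => matUinv p.2 a b) bundle := by
    intro a b
    simp only [matUinv, Matrix.mul_apply, Matrix.transpose_apply]
    exact ContDiffOn.sum fun k _ => (ContDiffOn.sum fun l _ =>
      contDiffOn_const.mul (h2 k l)).mul contDiffOn_const
  simp only [bundleH, Matrix.mul_apply]
  exact ContDiffOn.sum fun k _ => (h1 i k).mul (h3 k j)

theorem contDiffOn_connMatrix {E : Type*} [NormedAddCommGroup E] [NormedSpace ℝ E]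
    {θ Ω : Fin 5 → OneForm E} {O : Set E} (hθ : ∀ i, ContDiffOn ℝ ∞ (θ i) O)
    (hΩ : ∀ i, ContDiffOn ℝ ∞ (Ω i) O) (i j : Fin 5) :
    ContDiffOn ℝ ∞ (connMatrix θ Ω i j) O := by
  have hs : ∀ (c : ℝ) i, ContDiffOn ℝ ∞ (c • Ω i) O := fun c i => (hΩ i).const_smul c
  have hz : ContDiffOn ℝ ∞ (0 : OneForm E) O := contDiffOn_const
  fin_cases i <;> fin_cases j <;>
    simp only [connMatrix, Matrix.of_apply, Matrix.cons_val, Fin.zero_eta, Fin.mk_one,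
      Fin.reduceFinMk]
  all_goals first
    | exact hz
    | exact hθ _
    | exact hΩ _
    | exact (hθ _).neg
    | exact (hΩ _).neg
    | exact (hs _ _).neg
    | exact (hs _ _).sub (hΩ _)
    | exact (hs _ _).neg.sub (hΩ _)
    | exact (hs _ _).add (hΩ _)
    | exact (hs _ _).neg.add (hΩ _)

/-- No exterior derivative of a canonical form is computed: flatness follows from dH = Hω, and the
ten structure equations follow from flatness. -/
theorem isFlatAt_canon {p : BundleSpace} (hp : p ∈ bundle) :
    IsFlatAt (connMatrix canonθ canonΩ) p :=
  isFlatAt_of_matD_eq bundle_isOpen contDiffOn_bundleH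
    (contDiffOn_connMatrix contDiffOn_canonθ contDiffOn_canonΩ) (fun _ hq => matD_bundleH hq) hp
    (orthogonal_inv_left (bundleH_orthogonal hp))

theorem differentiableAt_canonθ {p : BundleSpace} (hp : p ∈ bundle) (i : Fin 5) :
    DifferentiableAt ℝ (canonθ i) p :=
  ((contDiffOn_canonθ i).contDiffAt (bundle_isOpen.mem_nhds hp)).differentiableAt (by simp)

theorem differentiableAt_canonΩ {p : BundleSpace} (hp : p ∈ bundle) (i : Fin 5) :
    DifferentiableAt ℝ (canonΩ i) p :=
  ((contDiffOn_canonΩ i).contDiffAt (bundle_isOpen.mem_nhds hp)).differentiableAt (by simp)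

theorem structureEquations_canon {p : BundleSpace} (hp : p ∈ bundle) :
    StructureEquations canonθ canonΩ p :=
  (structureEquations_iff_isFlatAt canonθ canonΩ p (differentiableAt_canonΩ hp)).2
    (isFlatAt_canon hp)

/-! ### Coframes -/

section Coframe

variable {E : Type*} [NormedAddCommGroup E] [NormedSpace ℝ E]

theorem finrank_clm_real [FiniteDimensional ℝ E] :
    Module.finrank ℝ (E →L[ℝ] ℝ) = Module.finrank ℝ E := by
  rw [← (LinearMap.toContinuousLinearMap (𝕜 := ℝ) (E := E) (F' := ℝ)).finrank_eq]
  exact Subspace.dual_finrank_eq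

/-- The map v ↦ (fᵢ(v)) is injective between spaces of equal dimension, hence onto. A vector on
which only fⱼ is nonzero isolates the coefficient of fⱼ in a linear relation. -/
theorem linearIndependent_of_injective [FiniteDimensional ℝ E] {ι : Type*} [Fintype ι]
    {f : ι → E →L[ℝ] ℝ} (hc : Fintype.card ι = Module.finrank ℝ E)
    (h : ∀ v, (∀ i, f i v = 0) → v = 0) : LinearIndependent ℝ f := by
  classical
  let L : E →ₗ[ℝ] ι → ℝ := LinearMap.pi fun i => (f i : E →ₗ[ℝ] ℝ)
  have hinj : Function.Injective L := by
    rw [← LinearMap.ker_eq_bot, LinearMap.ker_eq_bot']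
    intro v hv
    exact h v fun i => congrFun hv i
  have hsurj : Function.Surjective L :=
    (LinearMap.injective_iff_surjective_of_finrank_eq_finrank (by simp [hc])).1 hinj
  rw [Fintype.linearIndependent_iff]
  intro g hg j
  obtain ⟨v, hv⟩ := hsurj (Pi.single j 1)
  have h1 : ∀ i, f i v = if i = j then 1 else 0 := fun i => by
    have := congrFun hv i
    rw [Pi.single_apply] at this
    exact this
  have h2 := congrArg (fun M => M v) hg
  simpa [h1] using h2

/-- By the dimension count the forms span the dual space, and the dual space separates v from 0. -/
theorem injective_of_linearIndependent [FiniteDimensional ℝ E] {ι : Type*} [Fintype ι]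
    {f : ι → E →L[ℝ] ℝ} (hc : Fintype.card ι = Module.finrank ℝ E) (h : LinearIndependent ℝ f)
    {v : E} (hv : ∀ i, f i v = 0) : v = 0 := by
  have hs := h.span_eq_top_of_card_eq_finrank' (by rw [hc, finrank_clm_real])
  by_contra hne
  obtain ⟨g, -, hg⟩ := exists_dual_vector ℝ v (norm_ne_zero_iff.2 hne)
  have : g ∈ Submodule.span ℝ (Set.range f) := hs ▸ Submodule.mem_top
  have key : ∀ g ∈ Submodule.span ℝ (Set.range f), g v = 0 := by
    intro g hg
    induction hg using Submodule.span_induction with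
    | mem x hx => obtain ⟨i, rfl⟩ := hx; exact hv i
    | zero => rfl
    | add x y _ _ hx hy => rw [add_apply, hx, hy, add_zero]
    | smul a x _ hx => rw [smul_apply, hx, smul_zero]
  rw [key g this] at hg
  exact hne (norm_eq_zero.1 (by exact_mod_cast hg.symm))

/-- The coefficients of the forms `θ` of the canonical coframe with respect to the flat forms. -/
def coefθ (b : Params) : Matrix (Fin 5) (Fin 5) ℝ :=
  !![b 0 ^ 2, 0, 0, 0, 0;
     b 2, b 0 * Real.exp (b 1), 0, 0, 0;
     b 2 ^ 2 / (2 * b 0 ^ 2), b 2 * Real.exp (b 1) / b 0, Real.exp (b 1) ^ 2, 0, 0;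
     b 3, 0, 0, b 0 * Real.exp (-b 1), 0;
     -b 3 ^ 2 / (2 * b 0 ^ 2), 0, 0, -(b 3 * Real.exp (-b 1) / b 0), Real.exp (-b 1) ^ 2]

theorem coefθ_mem {b : Params} (hb : b ∈ paramSet) : coefθ b ∈ paraCRMatrices := by
  have hr : b 0 ≠ 0 := hb
  refine ⟨?_, ?_, ?_, ?_⟩
  · simp [coefθ, Matrix.det_succ_row_zero, Fin.sum_univ_succ, Fin.succAbove, hr]
  · intro j hj
    fin_cases j <;> simp_all [coefθ]
  · rintro i (rfl | rfl) j (rfl | rfl) <;> simp [coefθ]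
  · rintro i (rfl | rfl) j (rfl | rfl) <;> simp [coefθ]

theorem canonθ_apply_eq_sum (p v : BundleSpace) (i : Fin 5) :
    canonθ i p v = ∑ j, coefθ p.2 i j * flatForms j p.1 v.1 := by
  obtain ⟨h0, h1, h2, h3, h4⟩ := canonθ_apply p v
  rw [Fin.sum_univ_five]
  fin_cases i
  · simp [h0, coefθ]
  · simp [h1, coefθ]
  · simp [h2, coefθ]
  · simp [h3, coefθ]
  · simp [h4, coefθ]

theorem forall_eq_zero_of_mul_sum {S : Matrix (Fin 5) (Fin 5) ℝ} (hS : S.det ≠ 0) {x : Fin 5 → ℝ}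
    (h : ∀ i, ∑ j, S i j * x j = 0) : ∀ j, x j = 0 := by
  have : S *ᵥ x = 0 := funext h
  exact congrFun (Matrix.eq_zero_of_mulVec_eq_zero hS this)

theorem eq_zero_of_flatForms {m v : JetSpace} (h : ∀ i, flatForms i m v = 0) : v = 0 :=
  injective_of_linearIndependent (by simp) (linearIndependent_flatForms m) h

/-- The θ are invertible combinations of the lifted flat forms, so the component of v along M
vanishes. The gauge formula `canon_mul_matU` then leaves dU = 0 on the component along the fibre. -/
theorem eq_zero_of_canon {p : BundleSpace} (hp : p ∈ bundle) {v : BundleSpace}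
    (hθ : ∀ i, canonθ i p v = 0) (hΩ : ∀ i, canonΩ i p v = 0) : v = 0 := by
  have h1 : v.1 = 0 := by
    refine eq_zero_of_flatForms (m := p.1) fun i => ?_
    exact forall_eq_zero_of_mul_sum (coefθ_mem (b := p.2) hp).1
      (x := fun j => flatForms j p.1 v.1) (fun i => by rw [← canonθ_apply_eq_sum, hθ]) i
  have h2 := canon_mul_matU hp v
  rw [evalForm_connMatrix, evalForm_connMatrix] at h2
  have h3 : matD matU p.2 v.2 = 0 := by
    obtain ⟨f0, f1, f2, f3, f4⟩ := flatΩ_apply p.1 v.1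
    have e1 : (!![(0 : ℝ), 0, 0, 0, 0; 0, 0, 0, 0, 0; 0, 0, 0, 0, 0; 0, 0, 0, 0, 0; 0, 0, 0, 0, 0])
        = 0 := by
      ext i j; fin_cases i <;> fin_cases j <;> rfl
    simp only [hθ, hΩ, f0, f1, f2, f3, f4, h1, map_zero, mul_zero, neg_zero, sub_zero, add_zero, e1,
      Matrix.zero_mul, Matrix.mul_zero, zero_sub] at h2
    exact neg_eq_zero.1 h2.symm
  exact Prod.ext h1 (matD_matU_injective hp h3)

theorem finrank_bundleSpace : Module.finrank ℝ BundleSpace = 10 := by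
  simp

theorem isAdaptedCoframe_canon : IsAdaptedCoframe bundle Prod.fst canonθ canonΩ where
  smooth_proj := contDiff_fst.contDiffOn
  smooth_θ := contDiffOn_canonθ
  smooth_Ω := contDiffOn_canonΩ
  coframe := fun p hp => by
    refine linearIndependent_of_injective (by simp) fun v hv => ?_
    exact eq_zero_of_canon hp (fun i => hv (Sum.inl i)) (fun i => hv (Sum.inr i))
  adapted := fun p hp => by
    refine ⟨coefθ p.2, coefθ_mem hp, fun i => ContinuousLinearMap.ext fun v => ?_⟩
    rw [canonθ_apply_eq_sum]
    simp only [sum_apply, smul_apply, smul_eq_mul]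
    exact Finset.sum_congr rfl fun j _ => by rw [← liftForm_apply]; rfl
  structureEquations := fun p hp => structureEquations_canon hp

theorem canon_identity_section (m : JetSpace) :
    (∀ i, pullback (fun m' : JetSpace => ((m', idParam) : BundleSpace)) (canonθ i) m
      = flatForms i m) ∧
    (∀ i, pullback (fun m' : JetSpace => ((m', idParam) : BundleSpace)) (canonΩ i) m =
      if i = 1 then m 4 • flatForms 4 m else 0) := by
  have hd : fderiv ℝ (fun m' : JetSpace => ((m', idParam) : BundleSpace)) m
      = ContinuousLinearMap.inl ℝ JetSpace Params :=
    (hasFDerivAt_prodMk_left m idParam).fderiv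
  have e : ∀ v, fderiv ℝ (fun m' : JetSpace => ((m', idParam) : BundleSpace)) m v = (v, 0) :=
    fun v => by rw [hd]; rfl
  constructor
  · intro i
    refine ContinuousLinearMap.ext fun v => ?_
    rw [pullback_apply, e, canonθ_apply_eq_sum, Fin.sum_univ_five]
    fin_cases i <;> simp [coefθ, idParam]
  · intro i
    refine ContinuousLinearMap.ext fun v => ?_
    rw [pullback_apply, e]
    obtain ⟨o0, o1, o2, o3, o4⟩ := canonΩ_apply (m, idParam) (v, 0)
    fin_cases i
    · refine o0.trans ?_
      simp [idParam]
    · refine o1.trans ?_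
      simp [idParam]
    · refine o2.trans ?_
      simp [idParam]
    · refine o3.trans ?_
      simp [idParam]
    · refine o4.trans ?_
      simp [idParam]

/-! ### The Cartan connection -/

theorem mem_so32_iff (X : Matrix (Fin 5) (Fin 5) ℝ) : X ∈ so32 ↔ Xᵀ * formJ + formJ * X = 0 := by
  rw [so32, mem_skewAdjointMatricesSubmodule, Matrix.IsSkewAdjoint, Matrix.IsAdjointPair,
    Matrix.mul_neg, eq_neg_iff_add_eq_zero]

theorem evalForm_connMatrix_mem (θ Ω : Fin 5 → OneForm E) (p v : E) :
    evalForm (connMatrix θ Ω) p v ∈ so32 := by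
  rw [mem_so32_iff, evalForm_connMatrix]
  ext i j
  fin_cases i <;> fin_cases j <;>
    simp [formJ, Matrix.mul_apply, Fin.sum_univ_five] <;> ring

/-- Membership says that JX is antisymmetric. This leaves ten free entries, arranged as in
`connMatrix`. -/
theorem mem_so32_shape {X : Matrix (Fin 5) (Fin 5) ℝ} (hX : X ∈ so32) :
    X = !![X 0 0, X 0 1, X 0 2, X 0 3, 0;
           X 1 0, X 1 1, X 1 2, 0, X 0 3;
           X 2 0, X 2 1, 0, X 1 2, -X 0 2;
           X 3 0, 0, X 2 1, -X 1 1, X 0 1;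
           0, X 3 0, -X 2 0, X 1 0, -X 0 0] := by
  rw [mem_so32_iff] at hX
  have h : ∀ i j, X 4 i * formJ 4 j + X 3 i * formJ 3 j + X 2 i * formJ 2 j + X 1 i * formJ 1 j
      + X 0 i * formJ 0 j + (formJ i 0 * X 0 j + formJ i 1 * X 1 j + formJ i 2 * X 2 j
      + formJ i 3 * X 3 j + formJ i 4 * X 4 j) = 0 := by
    intro i j
    have := congrFun (congrFun hX i) j
    rw [Matrix.add_apply, Matrix.mul_apply, Matrix.mul_apply, Fin.sum_univ_five,
      Fin.sum_univ_five] at this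
    simp only [Matrix.transpose_apply, Matrix.zero_apply] at this
    linarith
  have h00 := h 0 0
  have h01 := h 0 1
  have h02 := h 0 2
  have h03 := h 0 3
  have h04 := h 0 4
  have h11 := h 1 1
  have h12 := h 1 2
  have h13 := h 1 3
  have h14 := h 1 4
  have h22 := h 2 2
  have h23 := h 2 3
  have h24 := h 2 4
  have h33 := h 3 3
  have h34 := h 3 4
  have h44 := h 4 4
  simp [formJ] at h00 h01 h02 h03 h04 h11 h12 h13 h14 h22 h23 h24 h33 h34 h44
  ext i j
  fin_cases i <;> fin_cases j <;> simp <;> linarith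

theorem bijOn_canon {p : BundleSpace} (hp : p ∈ bundle) :
    Set.BijOn (evalForm (connMatrix canonθ canonΩ) p) Set.univ
      (so32 : Set (Matrix (Fin 5) (Fin 5) ℝ)) := by
  refine ⟨fun v _ => evalForm_connMatrix_mem _ _ _ _, ?_, ?_⟩
  · intro v _ w _ h
    have key : ∀ i j, connMatrix canonθ canonΩ i j p (v - w) = 0 := fun i j => by
      rw [map_sub, ← evalForm_apply, ← evalForm_apply, h, sub_self]
    have k := fun i j => (congrFun (congrFun (evalForm_connMatrix canonθ canonΩ p (v - w)) i) j)
    simp only [evalForm_apply, key] at k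
    have t0 := k 1 0
    have t1 := k 2 0
    have t2 := k 3 0
    have t3 := k 1 2
    have t4 := k 0 3
    have o0 := k 0 0
    have o1 := k 1 1
    have o2 := k 2 1
    have o3 := k 0 2
    have o4 := k 0 1
    simp only [Matrix.of_apply, Matrix.cons_val] at t0 t1 t2 t3 t4 o0 o1 o2 o3 o4
    refine sub_eq_zero.1 (eq_zero_of_canon hp ?_ ?_)
    · intro i
      fin_cases i
      exacts [t0.symm, t1.symm, t2.symm, t3.symm, t4.symm]
    · intro i
      fin_cases i <;> simp only [Fin.zero_eta, Fin.mk_one, Fin.reduceFinMk] <;> linarith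
  · intro X hX
    let L : BundleSpace →ₗ[ℝ] (Fin 5 ⊕ Fin 5 → ℝ) := LinearMap.pi fun k =>
      ((Sum.elim (fun i => canonθ i p) (fun i => canonΩ i p) k : BundleSpace →L[ℝ] ℝ) :
        BundleSpace →ₗ[ℝ] ℝ)
    have hinj : Function.Injective L := by
      rw [← LinearMap.ker_eq_bot, LinearMap.ker_eq_bot']
      intro v hv
      exact eq_zero_of_canon hp (fun i => congrFun hv (Sum.inl i)) fun i => congrFun hv (Sum.inr i)
    have hsurj : Function.Surjective L :=
      (LinearMap.injective_iff_surjective_of_finrank_eq_finrank (by simp)).1 hinj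
    -- The prescribed values invert `connMatrix`: for instance Ω₁ = X₀₀ - X₁₁ and Ω₂ = -(X₀₀ +
    -- X₁₁)/2.
    obtain ⟨v, hv⟩ := hsurj (Sum.elim ![X 1 0, X 2 0, X 3 0, X 1 2, X 0 3]
      ![X 0 0 - X 1 1, -(X 0 0 + X 1 1) / 2, -X 2 1, X 0 2, -2 * X 0 1])
    have e : ∀ i, canonθ i p v = ![X 1 0, X 2 0, X 3 0, X 1 2, X 0 3] i := fun i =>
      congrFun hv (Sum.inl i)
    have e' : ∀ i, canonΩ i p v =
        ![X 0 0 - X 1 1, -(X 0 0 + X 1 1) / 2, -X 2 1, X 0 2, -2 * X 0 1] i := fun i =>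
      congrFun hv (Sum.inr i)
    refine ⟨v, trivial, ?_⟩
    rw [mem_so32_shape hX, evalForm_connMatrix]
    simp only [e, e']
    ext i j
    fin_cases i <;> fin_cases j <;> simp <;> ring

theorem contDiffOn_paramOf {X : E → Matrix (Fin 5) (Fin 5) ℝ} {s : Set E}
    (hX : ∀ i j, ContDiffOn ℝ ∞ (fun x => X x i j) s) (hpos : ∀ x ∈ s, 0 < X x 1 1 * X x 4 4) :
    ContDiffOn ℝ ∞ (fun x => paramOf (X x)) s := by
  have n1 : ∀ x ∈ s, X x 1 1 ≠ 0 := fun x hx h => by simpa [h] using hpos x hx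
  have n4 : ∀ x ∈ s, X x 4 4 ≠ 0 := fun x hx h => by simpa [h] using hpos x hx
  have h44 := hX 4 4
  have h11 := hX 1 1
  have h32 := hX 3 2
  have h02 := hX 0 2
  have h34 := hX 3 4
  have h01 := hX 0 1
  have hd : ∀ x ∈ s, X x 4 4 / X x 1 1 ≠ 0 := fun x hx => div_ne_zero (n4 x hx) (n1 x hx)
  have hφ : ContDiffOn ℝ ∞ (fun x => Real.log (X x 4 4 / X x 1 1) / 2) s :=
    (((h44.div h11 n1).log hd).div_const 2)
  have he : ContDiffOn ℝ ∞ (fun x => Real.exp (Real.log (X x 4 4 / X x 1 1) / 2)) s := hφ.exp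
  have he' : ContDiffOn ℝ ∞ (fun x => Real.exp (-(Real.log (X x 4 4 / X x 1 1) / 2))) s :=
    hφ.neg.exp
  have hr := h44.mul he'
  rw [contDiffOn_pi]
  intro i
  fin_cases i
  · exact hr
  · exact hφ
  · exact (hr.pow 2).mul h32
  · exact ((hr.pow 2).mul h02).neg
  · exact ((h34.mul he').add (h01.mul he)).neg.div hr fun x hx =>
      mul_ne_zero (n4 x hx) (Real.exp_pos _).ne'

/-- The right translation of the bundle by `matU b`. -/
def rightTranslation (b : Params) (p : BundleSpace) : BundleSpace :=
  (p.1, paramOf (matUinv b * matU p.2))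

/-- Closure of G under b⁻¹c, together with the positivity that makes `paramOf` defined and smooth
there. -/
theorem matU_matUinv_mul {b c : Params} (hb : b ∈ paramSet) (hc : c ∈ paramSet) :
    0 < (matUinv b * matU c) 1 1 * (matUinv b * matU c) 4 4 ∧
    paramOf (matUinv b * matU c) ∈ paramSet ∧
    matU (paramOf (matUinv b * matU c)) = matUinv b * matU c := by
  have h1 : matSO ((elemU b hb)⁻¹ * elemU c hc) = matUinv b * matU c := by
    rw [matSO_mul, matSO_inv]; rfl
  have h2 : (elemU b hb)⁻¹ * elemU c hc ∈ structureGroup :=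
    mul_mem (inv_mem ((mem_structureGroup_iff _).2 ⟨b, hb, rfl⟩))
      ((mem_structureGroup_iff _).2 ⟨c, hc, rfl⟩)
  rw [← h1]
  have h3 := (diag_pos_iff h2.1 (matSO_orthogonal _)).1 h2.2
  exact ⟨h3, matU_paramOf h2.1 (matSO_orthogonal _) (matSO_det _) h3⟩

theorem isRightTranslation {b : Params} (hb : b ∈ paramSet) :
    IsRightTranslation (matU b) (rightTranslation b) := by
  refine ⟨?_, fun p hp => ⟨(matU_matUinv_mul hb hp).2.1, rfl, ?_⟩⟩
  · refine contDiff_fst.contDiffOn.prodMk ?_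
    refine contDiffOn_paramOf (X := fun p : BundleSpace => matUinv b * matU p.2) ?_
      fun p hp => (matU_matUinv_mul hb hp).1
    intro i j
    simp only [Matrix.mul_apply]
    exact ContDiffOn.sum fun k _ => contDiffOn_const.mul
      ((contDiffOn_matU k j).comp contDiff_snd.contDiffOn fun p hp => hp)
  · rw [matU_inv_eq hb]
    exact (matU_matUinv_mul hb hp).2.2

theorem matD_bundleH_comp {f : E → BundleSpace} {x : E} (hf : DifferentiableAt ℝ f x)
    (hx : f x ∈ bundle) (v : E) : matD (fun y => bundleH (f y)) x v =
      bundleH (f x) * evalForm (connMatrix canonθ canonΩ) (f x) (fderiv ℝ f x v) := by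
  rw [matD_comp (matDiffAt_bundleH hx) hf, matD_bundleH hx]

theorem isCartanConnection_canon : IsCartanConnection (connMatrix canonθ canonΩ) where
  smooth := contDiffOn_connMatrix contDiffOn_canonθ contDiffOn_canonΩ
  bijOn := fun p hp => bijOn_canon hp
  equivariant := fun b hb => by
    refine ⟨rightTranslation b, isRightTranslation hb, fun p hp v => ?_⟩
    -- Equivariance is read off from H(R_k q) = H(q)k: differentiating with dH = Hω gives Hk·R_k^*ω
    -- = Hωk.
    have hR : ∀ q ∈ bundle, bundleH (rightTranslation b q) = bundleH q * matU b := by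
      intro q hq
      have h1 : matUinv (rightTranslation b q).2 = matUinv q.2 * matU b := by
        rw [matUinv, rightTranslation, (matU_matUinv_mul hb hq).2.2]
        have h2 : matUinv b * matU q.2 = matSO ((elemU b hb)⁻¹ * elemU q.2 hq) := by
          rw [matSO_mul, matSO_inv]; rfl
        rw [h2, ← matSO_inv, mul_inv_rev, inv_inv, matSO_mul, matSO_inv]; rfl
      rw [bundleH, h1, ← Matrix.mul_assoc]; rfl
    have hd : DifferentiableAt ℝ (rightTranslation b) p :=
      ((isRightTranslation hb).1.contDiffAt (bundle_isOpen.mem_nhds hp)).differentiableAt (by simp)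
    have h1 := matD_bundleH_comp hd ((isRightTranslation hb).2 p hp).1 v
    have h2 : (fun q => bundleH (rightTranslation b q)) =ᶠ[nhds p] fun q => bundleH q * matU b :=
      Filter.eventually_of_mem (bundle_isOpen.mem_nhds hp) hR
    rw [matD_congr h2, matD_mul_const _ (matDiffAt_bundleH hp), matD_bundleH hp, hR p hp] at h1
    have h3 := congrArg (fun M => matUinv b * ((formJ * (bundleH p)ᵀ * formJ) * M)) h1
    have h4 : ∀ X, formJ * (bundleH p)ᵀ * formJ * (bundleH p * X) = X := fun X => by
      rw [← Matrix.mul_assoc, orthogonal_inv_left (bundleH_orthogonal hp), Matrix.one_mul]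
    have h5 : ∀ X, matUinv b * (matU b * X) = X := fun X => by
      rw [← Matrix.mul_assoc, matUinv_mul hb, Matrix.one_mul]
    rw [matU_inv_eq hb]
    rw [Matrix.mul_assoc (bundleH p), Matrix.mul_assoc (bundleH p)] at h3
    simp only [h4, h5] at h3
    rw [← h3, Matrix.mul_assoc]
  fundamental := fun p hp β X h => by
    have hp' : p.2 ∈ paramSet := hp
    -- On a vertical vector the term from M is absent, so ωU = -dU = XU.
    have h1 := canon_mul_matU hp ((0 : JetSpace), β)
    have h2 : matD matU p.2 β = -(X * matU p.2) := h
    have h3 : evalForm (connMatrix flatForms flatΩ) p.1 0 = 0 := by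
      ext i j
      simp [evalForm_apply]
    simp only [h2, h3, Matrix.mul_zero, sub_neg_eq_add, zero_add] at h1
    have h4 := congrArg (· * matUinv p.2) h1
    simpa only [Matrix.mul_assoc, mul_matUinv hp', Matrix.mul_one] using h4

end Coframe

/-! ### Dual frames -/

section Uniqueness

variable {E : Type*} [NormedAddCommGroup E] [NormedSpace ℝ E]

/-- `(e, f)` is the frame dual to the coframe `(θ, Ω)` on `O`. -/
structure IsDualFrame (O : Set E) (θ Ω : Fin 5 → OneForm E) (e f : Fin 5 → E → E) : Prop where
  smooth_e : ∀ k, ContDiffOn ℝ ∞ (e k) O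
  smooth_f : ∀ k, ContDiffOn ℝ ∞ (f k) O
  θe : ∀ x ∈ O, ∀ i k, θ i x (e k x) = if i = k then 1 else 0
  θf : ∀ x ∈ O, ∀ i k, θ i x (f k x) = 0
  Ωe : ∀ x ∈ O, ∀ i k, Ω i x (e k x) = 0
  Ωf : ∀ x ∈ O, ∀ i k, Ω i x (f k x) = if i = k then 1 else 0
  ext : ∀ x ∈ O, ∀ α : E →L[ℝ] ℝ, (∀ k, α (e k x) = 0) → (∀ k, α (f k x) = 0) → α = 0

/-- The coframe is a smooth family of isomorphisms onto a coordinate space. Inversion of linear maps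
is smooth, so the preimages of the standard basis vectors form a smooth frame. -/
theorem exists_isDualFrame [FiniteDimensional ℝ E] (hE : Module.finrank ℝ E = 10) {O : Set E}
    (hO : IsOpen O) {θ Ω : Fin 5 → OneForm E} (hθ : ∀ i, ContDiffOn ℝ ∞ (θ i) O)
    (hΩ : ∀ i, ContDiffOn ℝ ∞ (Ω i) O)
    (hc : ∀ x ∈ O, LinearIndependent ℝ (Sum.elim (fun i => θ i x) (fun i => Ω i x))) :
    ∃ e f : Fin 5 → E → E, IsDualFrame O θ Ω e f := by
  have : CompleteSpace E := FiniteDimensional.complete ℝ E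
  let C : Fin 5 ⊕ Fin 5 → OneForm E := Sum.elim θ Ω
  have hC : ∀ k, ContDiffOn ℝ ∞ (C k) O := fun k => by
    rcases k with i | i
    exacts [hθ i, hΩ i]
  let L : E → (E →L[ℝ] (Fin 5 ⊕ Fin 5 → ℝ)) := fun x => ContinuousLinearMap.pi fun k => C k x
  have hL : ContDiffOn ℝ ∞ L O := by
    refine contDiffOn_clm_apply.2 fun v => contDiffOn_pi.2 fun k => ?_
    exact (hC k).clm_apply contDiffOn_const
  have hinj : ∀ x ∈ O, ∀ v, L x v = 0 → v = 0 := fun x hx v hv => by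
    refine injective_of_linearIndependent (by simp [hE]) (hc x hx) fun k => ?_
    have := congrFun hv k
    rcases k with i | i
    exacts [this, this]
  have heq : ∀ x ∈ O, ∃ A : E ≃L[ℝ] (Fin 5 ⊕ Fin 5 → ℝ), (A : E →L[ℝ] _) = L x := by
    intro x hx
    have h1 : Function.Injective (L x).toLinearMap := by
      rw [← LinearMap.ker_eq_bot, LinearMap.ker_eq_bot']
      exact hinj x hx
    refine ⟨(LinearEquiv.ofInjectiveOfFinrankEq _ h1 (by simp [hE])).toContinuousLinearEquiv, ?_⟩
    ext v
    rfl
  have hI : ContDiffOn ℝ ∞ (fun x => ContinuousLinearMap.inverse (L x)) O := by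
    intro x hx
    obtain ⟨A, hA⟩ := heq x hx
    have h1 : ContDiffAt ℝ ∞ ContinuousLinearMap.inverse (L x) := hA ▸ contDiffAt_map_inverse A
    exact (h1.comp x (hL.contDiffAt (hO.mem_nhds hx))).contDiffWithinAt
  let F : Fin 5 ⊕ Fin 5 → E → E := fun k x => ContinuousLinearMap.inverse (L x) (Pi.single k 1)
  have hF : ∀ k, ContDiffOn ℝ ∞ (F k) O := fun k => hI.clm_apply contDiffOn_const
  have hCF : ∀ x ∈ O, ∀ k l, C k x (F l x) = if k = l then 1 else 0 := by
    intro x hx k l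
    obtain ⟨A, hA⟩ := heq x hx
    have h1 : L x (F l x) = Pi.single l 1 := by
      simp only [F, ← hA, ContinuousLinearMap.inverse_equiv]
      exact A.apply_symm_apply _
    have := congrFun h1 k
    rwa [Pi.single_apply] at this
  refine ⟨fun k => F (Sum.inl k), fun k => F (Sum.inr k), fun k => hF _, fun k => hF _,
    fun x hx i k => ?_, fun x hx i k => ?_, fun x hx i k => ?_, fun x hx i k => ?_, ?_⟩
  · simpa [C] using hCF x hx (Sum.inl i) (Sum.inl k)
  · simpa [C] using hCF x hx (Sum.inl i) (Sum.inr k)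
  · simpa [C] using hCF x hx (Sum.inr i) (Sum.inl k)
  · simpa [C] using hCF x hx (Sum.inr i) (Sum.inr k)
  · intro x hx α he hf
    refine ContinuousLinearMap.ext fun v => ?_
    have hv : v - ∑ k, C k x v • F k x = 0 := by
      refine hinj x hx _ (funext fun l => ?_)
      change C l x _ = 0
      rcases l with l | l <;> simp [map_sub, map_sum, hCF x hx]
    rw [sub_eq_zero.1 hv, map_sum, Fintype.sum_sum_type]
    simp [he, hf]

/-- The zero pattern is the intersection of two block triangular patterns, with weights (2,1,1,0,0)
and (2,0,0,1,1). Each of them is stable under inversion. -/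
theorem paraCR_inv {S : Matrix (Fin 5) (Fin 5) ℝ} (hS : S ∈ paraCRMatrices) :
    S⁻¹ ∈ paraCRMatrices := by
  obtain ⟨hd, h0, h1, h2⟩ := hS
  have hu : IsUnit S.det := isUnit_iff_ne_zero.2 hd
  let _ := S.invertibleOfIsUnitDet hu
  have b1 : S.BlockTriangular (![2, 1, 1, 0, 0] : Fin 5 → ℕ) := by
    intro i j hij
    fin_cases i <;> fin_cases j <;> simp at hij <;> first | exact h0 _ (by decide) | exact h1 _ (by simp) _ (by simp)
  have b2 : S.BlockTriangular (![2, 0, 0, 1, 1] : Fin 5 → ℕ) := by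
    intro i j hij
    fin_cases i <;> fin_cases j <;> simp at hij <;> first | exact h0 _ (by decide) | exact h2 _ (by simp) _ (by simp)
  have c1 := Matrix.blockTriangular_inv_of_blockTriangular b1
  have c2 := Matrix.blockTriangular_inv_of_blockTriangular b2
  refine ⟨?_, ?_, ?_, ?_⟩
  · exact (isUnit_iff_ne_zero.1 (S.isUnit_nonsing_inv_det hu))
  · intro j hj
    refine c1 ?_
    fin_cases j <;> simp_all
  · rintro i (rfl | rfl) j (rfl | rfl) <;> exact c1 (by simp)
  · rintro i (rfl | rfl) j (rfl | rfl) <;> exact c2 (by simp)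

/-! ### The normal form of an adapted coframe -/

section Adapted

variable {O : Set E} {π : E → JetSpace} {θ Ω : Fin 5 → OneForm E} {e f : Fin 5 → E → E}

/-- The coefficients of the pullbacks of the flat forms with respect to a frame. -/
def pullCoef (π : E → JetSpace) (e : Fin 5 → E → E) (x : E) : Matrix (Fin 5) (Fin 5) ℝ :=
  Matrix.of fun j k => pullback π (flatForms j) x (e k x)

theorem pullCoef_apply (π : E → JetSpace) (e : Fin 5 → E → E) (x : E) (j k : Fin 5) :
    pullCoef π e x j k = pullback π (flatForms j) x (e k x) := rfl

theorem IsAdaptedCoframe.exists_inverse (h : IsAdaptedCoframe O π θ Ω)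
    (hf : IsDualFrame O θ Ω e f) {x : E} (hx : x ∈ O) :
    ∃ S ∈ paraCRMatrices, S * pullCoef π e x = 1 ∧
      ∀ i, θ i x = ∑ j, S i j • pullback π (flatForms j) x := by
  obtain ⟨S, hS, hθ⟩ := h.adapted x hx
  refine ⟨S, hS, ?_, hθ⟩
  ext i k
  have := congrArg (fun L => L (e k x)) (hθ i)
  rw [Matrix.mul_apply, Matrix.one_apply, ← hf.θe x hx i k]
  simpa [pullCoef_apply] using this.symm

theorem IsAdaptedCoframe.pullCoef_mem (h : IsAdaptedCoframe O π θ Ω)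
    (hf : IsDualFrame O θ Ω e f) {x : E} (hx : x ∈ O) : pullCoef π e x ∈ paraCRMatrices := by
  obtain ⟨S, hS, hST, -⟩ := h.exists_inverse hf hx
  rw [← Matrix.inv_eq_right_inv hST]
  exact paraCR_inv hS

theorem IsAdaptedCoframe.pullback_eq (h : IsAdaptedCoframe O π θ Ω)
    (hf : IsDualFrame O θ Ω e f) {x : E} (hx : x ∈ O) (j : Fin 5) :
    pullback π (flatForms j) x = ∑ k, pullCoef π e x j k • θ k x := by
  obtain ⟨S, hS, hST, hθ⟩ := h.exists_inverse hf hx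
  have hTS : pullCoef π e x * S = 1 := mul_eq_one_comm.1 hST
  simp only [hθ, Finset.smul_sum, smul_smul]
  rw [Finset.sum_comm]
  simp only [← Finset.sum_smul, ← Matrix.mul_apply, hTS, Matrix.one_apply, ite_smul, one_smul,
    zero_smul, Finset.sum_ite_eq, Finset.mem_univ, if_true]

theorem IsAdaptedCoframe.contDiffOn_pullback (h : IsAdaptedCoframe O π θ Ω) (hO : IsOpen O)
    (j : Fin 5) : ContDiffOn ℝ ∞ (pullback π (flatForms j)) O :=
  _root_.contDiffOn_pullback hO h.smooth_proj (contDiff_flatForms j).contDiffOn (Set.mapsTo_univ _ _)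

theorem IsAdaptedCoframe.contDiffOn_pullCoef (h : IsAdaptedCoframe O π θ Ω) (hO : IsOpen O)
    (hf : IsDualFrame O θ Ω e f) (j k : Fin 5) :
    ContDiffOn ℝ ∞ (fun x => pullCoef π e x j k) O :=
  (h.contDiffOn_pullback hO j).clm_apply (hf.smooth_e k)

/-- The structure equations of the flat forms in terms of the coefficients. -/
theorem IsAdaptedCoframe.coef_equations (h : IsAdaptedCoframe O π θ Ω) (hO : IsOpen O)
    (hf : IsDualFrame O θ Ω e f) {x : E} (hx : x ∈ O) (a b : Fin 5) :
    (∑ k, ((fderiv ℝ (fun y => pullCoef π e y 0 k) x ⋏ θ k x) (e a x) (e b x) +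
        pullCoef π e x 0 k * extD (θ k) x (e a x) (e b x)) =
      pullCoef π e x 1 a * pullCoef π e x 3 b - pullCoef π e x 1 b * pullCoef π e x 3 a) ∧
    (∑ k, ((fderiv ℝ (fun y => pullCoef π e y 1 k) x ⋏ θ k x) (e a x) (e b x) +
        pullCoef π e x 1 k * extD (θ k) x (e a x) (e b x)) =
      pullCoef π e x 2 a * pullCoef π e x 3 b - pullCoef π e x 2 b * pullCoef π e x 3 a +
      π x 4 * (pullCoef π e x 1 a * pullCoef π e x 4 b -
        pullCoef π e x 1 b * pullCoef π e x 4 a)) ∧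
    (∑ k, ((fderiv ℝ (fun y => pullCoef π e y 3 k) x ⋏ θ k x) (e a x) (e b x) +
        pullCoef π e x 3 k * extD (θ k) x (e a x) (e b x)) =
      -(pullCoef π e x 1 a * pullCoef π e x 4 b - pullCoef π e x 1 b * pullCoef π e x 4 a) -
      π x 4 * (pullCoef π e x 3 a * pullCoef π e x 4 b -
        pullCoef π e x 3 b * pullCoef π e x 4 a)) := by
  have hnhds := hO.mem_nhds hx
  -- The derivative of π^*ωʲ is computed twice, from the expansion ∑ Tⱼₖθᵏ and as the pullback of
  -- dωʲ.
  have hd : ∀ j v w, extD (pullback π (flatForms j)) x v w =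
      ∑ k, ((fderiv ℝ (fun y => pullCoef π e y j k) x ⋏ θ k x) v w +
        pullCoef π e x j k * extD (θ k) x v w) := by
    intro j v w
    have e1 : pullback π (flatForms j) =ᶠ[nhds x] fun y => ∑ k, pullCoef π e y j k • θ k y :=
      Filter.eventually_of_mem hnhds fun y hy => h.pullback_eq hf hy j
    have hc : ∀ k, DifferentiableAt ℝ (fun y => pullCoef π e y j k) x := fun k =>
      ((h.contDiffOn_pullCoef hO hf j k).contDiffAt hnhds).differentiableAt (by simp)
    have hθ : ∀ k, DifferentiableAt ℝ (θ k) x := fun k =>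
      ((h.smooth_θ k).contDiffAt hnhds).differentiableAt (by simp)
    rw [extD_congr e1, extD_sum _ fun k _ => (hc k).fun_smul (hθ k)]
    exact Finset.sum_congr rfl fun k _ => extD_smul (hc k) (hθ k) v w
  have hπ : ContDiffAt ℝ ∞ π x := h.smooth_proj.contDiffAt hnhds
  have hp : ∀ j v w, extD (pullback π (flatForms j)) x v w =
      extD (flatForms j) (π x) (fderiv ℝ π x v) (fderiv ℝ π x w) := fun j v w =>
    extD_pullback hπ ((contDiff_flatForms j).differentiable (by simp) _) v w
  rw [← hd, ← hd, ← hd]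
  exact ⟨(hp 0 _ _).trans (extD_flatForms _ _ _).1, (hp 1 _ _).trans (extD_flatForms _ _ _).2.1,
    (hp 3 _ _).trans (extD_flatForms _ _ _).2.2.2.1⟩

theorem fderiv_eq_zero_of_eqOn {g : E → ℝ} {c : ℝ} (hO : IsOpen O) (hg : ∀ y ∈ O, g y = c) {x : E}
    (hx : x ∈ O) : fderiv ℝ g x = 0 := by
  have h1 : g =ᶠ[nhds x] fun _ => c := Filter.eventually_of_mem (hO.mem_nhds hx) hg
  rw [h1.fderiv_eq]
  simp

/-- Row 0 of T has only the entry T₀₀. In d(T₀₀θ¹) = π^*(ω²∧ω⁴) the coefficient of θ²∧θ⁴ gives T₀₀ =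
T₁₁T₃₃, which is nonzero; those of θ³∧θ⁴ and θ²∧θ⁵ give T₁₂T₃₃ = 0 and T₁₁T₃₄ = 0. -/
theorem IsAdaptedCoframe.coef_relations (h : IsAdaptedCoframe O π θ Ω) (hO : IsOpen O)
    (hf : IsDualFrame O θ Ω e f) {x : E} (hx : x ∈ O) :
    pullCoef π e x 1 2 = 0 ∧ pullCoef π e x 3 4 = 0 ∧ pullCoef π e x 1 1 ≠ 0 ∧
    pullCoef π e x 3 3 ≠ 0 ∧
    pullCoef π e x 0 0 = pullCoef π e x 1 1 * pullCoef π e x 3 3 := by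
  obtain ⟨hdet, z0, z1, z2⟩ := h.pullCoef_mem hf hx
  have hs := h.structureEquations x hx
  have hθe := hf.θe x hx
  have hΩe := hf.Ωe x hx
  have z01 := z0 1 (by decide)
  have z02 := z0 2 (by decide)
  have z03 := z0 3 (by decide)
  have z04 := z0 4 (by decide)
  have z13 := z1 1 (by simp) 3 (by simp)
  have z14 := z1 1 (by simp) 4 (by simp)
  have z31 := z2 3 (by simp) 1 (by simp)
  have z32 := z2 3 (by simp) 2 (by simp)
  have dz : ∀ k, k ≠ 0 → fderiv ℝ (fun y => pullCoef π e y 0 k) x = 0 := fun k hk =>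
    fderiv_eq_zero_of_eqOn hO (fun y hy => (h.pullCoef_mem hf hy).2.1 k hk) hx
  have d01 := dz 1 (by decide)
  have d02 := dz 2 (by decide)
  have d03 := dz 3 (by decide)
  have d04 := dz 4 (by decide)
  have d0 := fun a b => (h.coef_equations hO hf hx a b).1
  simp only [wedge_apply, Fin.sum_univ_five, hs.dθ₁, Pi.sub_apply, hθe, hΩe, z01, z02, z03, z04,
    d01, d02, d03, d04, zero_apply] at d0
  have a13 := d0 1 3
  have a23 := d0 2 3
  have a14 := d0 1 4
  simp [z13, z14, z31, z32] at a13 a23 a14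
  have n00 : pullCoef π e x 0 0 ≠ 0 := by
    intro h00
    refine hdet ?_
    rw [Matrix.det_succ_row_zero, Fin.sum_univ_five, h00, z01, z02, z03, z04]
    ring
  have n : pullCoef π e x 1 1 * pullCoef π e x 3 3 ≠ 0 := a13 ▸ n00
  have n1 := left_ne_zero_of_mul n
  have n3 := right_ne_zero_of_mul n
  exact ⟨a23.resolve_right n3, a14.resolve_left n1, n1, n3, a13⟩

/-- These are the coefficients of θ³∧θ⁴ in dω² and of θ²∧θ⁵ in dω⁴. The entries of T whose
derivatives could appear vanish on all of O, so only algebraic terms remain. -/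
theorem IsAdaptedCoframe.coef_relations' (h : IsAdaptedCoframe O π θ Ω) (hO : IsOpen O)
    (hf : IsDualFrame O θ Ω e f) {x : E} (hx : x ∈ O) :
    pullCoef π e x 1 1 = pullCoef π e x 2 2 * pullCoef π e x 3 3 ∧
    pullCoef π e x 3 3 = pullCoef π e x 1 1 * pullCoef π e x 4 4 := by
  obtain ⟨hdet, z0, z1, z2⟩ := h.pullCoef_mem hf hx
  have hs := h.structureEquations x hx
  have hθe := hf.θe x hx
  have hΩe := hf.Ωe x hx
  obtain ⟨z12, z34, -⟩ := h.coef_relations hO hf hx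
  have z13 := z1 1 (by simp) 3 (by simp)
  have z14 := z1 1 (by simp) 4 (by simp)
  have z23 := z1 2 (by simp) 3 (by simp)
  have z31 := z2 3 (by simp) 1 (by simp)
  have z32 := z2 3 (by simp) 2 (by simp)
  have z41 := z2 4 (by simp) 1 (by simp)
  have d12 : fderiv ℝ (fun y => pullCoef π e y 1 2) x = 0 :=
    fderiv_eq_zero_of_eqOn hO (fun y hy => (h.coef_relations hO hf hy).1) hx
  have d34 : fderiv ℝ (fun y => pullCoef π e y 3 4) x = 0 :=
    fderiv_eq_zero_of_eqOn hO (fun y hy => (h.coef_relations hO hf hy).2.1) hx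
  have d13 : fderiv ℝ (fun y => pullCoef π e y 1 3) x = 0 :=
    fderiv_eq_zero_of_eqOn hO (fun y hy => (h.pullCoef_mem hf hy).2.2.1 1 (by simp) 3 (by simp)) hx
  have d31 : fderiv ℝ (fun y => pullCoef π e y 3 1) x = 0 :=
    fderiv_eq_zero_of_eqOn hO (fun y hy => (h.pullCoef_mem hf hy).2.2.2 3 (by simp) 1 (by simp)) hx
  have b23 := (h.coef_equations hO hf hx 2 3).2.1
  have b14 := (h.coef_equations hO hf hx 1 4).2.2
  simp only [wedge_apply, Fin.sum_univ_five, hs.dθ₁, hs.dθ₂, hs.dθ₃, hs.dθ₄, hs.dθ₅, Pi.add_apply,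
    Pi.sub_apply, Pi.neg_apply, Pi.smul_apply, smul_eq_mul, add_apply, sub_apply, smul_apply, hθe,
    hΩe, z12, z34, z13, z14, z23, z31, z32, z41, d12, d34, d13, d31, zero_apply] at b23 b14
  simp at b23 b14
  exact ⟨b23, b14⟩

end Adapted

end Uniqueness

section Rigidity

variable {E : Type*} [NormedAddCommGroup E] [NormedSpace ℝ E]

/-! ### Rigidity of the structure equations -/

/-- The structure equations of two systems of forms that agree up to terms of lower order force two
of the coefficients to vanish. -/
theorem rigidity_first {θ Ω η Λ : Fin 5 → OneForm E} {x : E} {e : Fin 5 → E}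
    (he : ∀ i k, θ i x (e k) = if i = k then 1 else 0)
    (hθ : StructureEquations θ Ω x) (hη : StructureEquations η Λ x)
    {A B C D : ℝ} {A' B' C' D' : E →L[ℝ] ℝ}
    (h0 : η 0 x = θ 0 x) (h1 : η 1 x = θ 1 x) (h3 : η 3 x = θ 3 x)
    (h2 : η 2 x = θ 2 x + A • θ 0 x + B • θ 1 x) (h4 : η 4 x = θ 4 x + C • θ 0 x + D • θ 3 x)
    (d0 : ∀ v w, extD (η 0) x v w = extD (θ 0) x v w)
    (d1 : ∀ v w, extD (η 1) x v w = extD (θ 1) x v w)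
    (d3 : ∀ v w, extD (η 3) x v w = extD (θ 3) x v w)
    (d2 : ∀ v w, extD (η 2) x v w = extD (θ 2) x v w + ((A' ⋏ θ 0 x) v w + A * extD (θ 0) x v w)
      + ((B' ⋏ θ 1 x) v w + B * extD (θ 1) x v w))
    (d4 : ∀ v w, extD (η 4) x v w = extD (θ 4) x v w + ((C' ⋏ θ 0 x) v w + C * extD (θ 0) x v w)
      + ((D' ⋏ θ 3 x) v w + D * extD (θ 3) x v w)) : B = 0 ∧ D = 0 := by
  rw [hη.dθ₁, hθ.dθ₁] at d0
  rw [hη.dθ₂, hθ.dθ₂] at d1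
  rw [hη.dθ₄, hθ.dθ₄] at d3
  rw [hη.dθ₃, hθ.dθ₁, hθ.dθ₂, hθ.dθ₃] at d2
  rw [hη.dθ₅, hθ.dθ₁, hθ.dθ₄, hθ.dθ₅] at d4
  simp only [Pi.add_apply, Pi.sub_apply, Pi.neg_apply, Pi.smul_apply, wedge_apply, smul_eq_mul,
    add_apply, sub_apply, smul_apply, h0, h1, h2, h3, h4] at d0 d1 d2 d3 d4
  -- The equation of dθ¹ shows that Λ 0 and Ω 0 agree on e 1 and e 3. With Δ = Λ 1 - Ω 1, those of
  -- dθ² and dθ³ give B = -Δ(e 3) and B = 2Δ(e 3), and those of dθ⁴ and dθ⁵ give D = Δ(e 1) and D =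
  -- -2Δ(e 1).
  have a01 := d0 (e 0) (e 1)
  have a03 := d0 (e 0) (e 3)
  have b13 := d1 (e 1) (e 3)
  have b23 := d2 (e 2) (e 3)
  have c13 := d3 (e 1) (e 3)
  have c14 := d4 (e 1) (e 4)
  simp [he] at a01 a03 b13 b23 c13 c14
  constructor <;> linarith

/-- Each coefficient is obtained twice with opposite signs: A is the value of Λ 2 - Ω 2 on e 3 by
dθ² and its negative by dθ³, and C is the value of Λ 3 - Ω 3 on e 1 by dθ⁴ and its negative by dθ⁵.
-/
theorem rigidity_second {θ Ω η Λ : Fin 5 → OneForm E} {x : E} {e : Fin 5 → E}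
    (he : ∀ i k, θ i x (e k) = if i = k then 1 else 0)
    (hθ : StructureEquations θ Ω x) (hη : StructureEquations η Λ x)
    {A C : ℝ} {A' C' : E →L[ℝ] ℝ}
    (h0 : η 0 x = θ 0 x) (h1 : η 1 x = θ 1 x) (h3 : η 3 x = θ 3 x)
    (h2 : η 2 x = θ 2 x + A • θ 0 x) (h4 : η 4 x = θ 4 x + C • θ 0 x)
    (d1 : ∀ v w, extD (η 1) x v w = extD (θ 1) x v w)
    (d3 : ∀ v w, extD (η 3) x v w = extD (θ 3) x v w)
    (d2 : ∀ v w, extD (η 2) x v w = extD (θ 2) x v w + ((A' ⋏ θ 0 x) v w + A * extD (θ 0) x v w))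
    (d4 : ∀ v w, extD (η 4) x v w = extD (θ 4) x v w + ((C' ⋏ θ 0 x) v w + C * extD (θ 0) x v w)) :
    A = 0 ∧ C = 0 := by
  rw [hη.dθ₂, hθ.dθ₂] at d1
  rw [hη.dθ₄, hθ.dθ₄] at d3
  rw [hη.dθ₃, hθ.dθ₁, hθ.dθ₃] at d2
  rw [hη.dθ₅, hθ.dθ₁, hθ.dθ₅] at d4
  simp only [Pi.add_apply, Pi.sub_apply, Pi.neg_apply, Pi.smul_apply, wedge_apply, smul_eq_mul,
    add_apply, sub_apply, smul_apply, h0, h1, h2, h3, h4] at d1 d2 d3 d4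
  have b03 := d1 (e 0) (e 3)
  have b13 := d2 (e 1) (e 3)
  have c01 := d3 (e 0) (e 1)
  have c13 := d4 (e 1) (e 3)
  simp [he] at b03 b13 c01 c13
  constructor <;> linarith

/-- Two systems of connection forms for the same forms `θ` differ by one function. -/
theorem rigidity_connection {θ Ω η Λ : Fin 5 → OneForm E} {x : E} {e : Fin 5 → E}
    (he : ∀ i k, θ i x (e k) = if i = k then 1 else 0)
    (hθ : StructureEquations θ Ω x) (hη : StructureEquations η Λ x) (h : ∀ i, η i x = θ i x)
    (d : ∀ i v w, extD (η i) x v w = extD (θ i) x v w) :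
    (∀ w, Λ 0 x w - Ω 0 x w = (Λ 0 x (e 0) - Ω 0 x (e 0)) * θ 0 x w) ∧
    (∀ w, Λ 1 x w = Ω 1 x w) ∧
    (∀ w, Λ 2 x w - Ω 2 x w = (Λ 0 x (e 0) - Ω 0 x (e 0)) / 2 * θ 1 x w) ∧
    (∀ w, Λ 3 x w - Ω 3 x w = (Λ 0 x (e 0) - Ω 0 x (e 0)) / 2 * θ 3 x w) := by
  have d0 := d 0
  have d1 := d 1
  have d2 := d 2
  have d3 := d 3
  have d4 := d 4
  rw [hη.dθ₁, hθ.dθ₁] at d0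
  rw [hη.dθ₂, hθ.dθ₂] at d1
  rw [hη.dθ₃, hθ.dθ₃] at d2
  rw [hη.dθ₄, hθ.dθ₄] at d3
  rw [hη.dθ₅, hθ.dθ₅] at d4
  simp only [Pi.add_apply, Pi.sub_apply, Pi.neg_apply, Pi.smul_apply, wedge_apply, smul_eq_mul,
    add_apply, sub_apply, smul_apply, h] at d0 d1 d2 d3 d4
  have a0 : ∀ w, Λ 0 x w - Ω 0 x w = (Λ 0 x (e 0) - Ω 0 x (e 0)) * θ 0 x w := by
    intro w
    have := d0 (e 0) w
    simp [he] at this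
    linarith
  have a0e : ∀ k, Λ 0 x (e k) - Ω 0 x (e k) = (Λ 0 x (e 0) - Ω 0 x (e 0)) * θ 0 x (e k) :=
    fun k => a0 (e k)
  -- The equation of dθ² makes the difference a combination of θ¹ and θ². It vanishes on e 1 by the
  -- equation of dθ⁴ and on e 0 by that of dθ³.
  have a1 : ∀ w, Λ 1 x w = Ω 1 x w := by
    intro w
    have q1 := d1 (e 1) w
    have q3 := d3 (e 3) w
    have q31 := d3 (e 3) (e 1)
    have q20 := d2 (e 2) (e 0)
    have q10 := d1 (e 1) (e 0)
    have z1 := a0e 1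
    have z3 := a0e 3
    have zw := a0 w
    simp [he] at q1 q3 q31 q20 q10 z1 z3
    have k1 : Λ 1 x (e 1) = Ω 1 x (e 1) := by linarith
    have k0 : Λ 1 x (e 0) = Ω 1 x (e 0) := by linarith
    linear_combination q1 + (1 / 2) * zw + θ 1 x w * k1 - (1 / 2) * θ 1 x w * z1 -
      θ 0 x w * q10 + θ 0 x w * k0
  have a2 : ∀ w, Λ 2 x w - Ω 2 x w = (Λ 2 x (e 1) - Ω 2 x (e 1)) * θ 1 x w := by
    intro w
    have q := d2 (e 1) w
    simp [he, a1] at q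
    linarith
  have a3 : ∀ w, Λ 3 x w - Ω 3 x w = (Λ 3 x (e 3) - Ω 3 x (e 3)) * θ 3 x w := by
    intro w
    have q := d4 (e 3) w
    simp [he, a1] at q
    linarith
  refine ⟨a0, a1, fun w => ?_, fun w => ?_⟩
  · have q := d1 (e 0) (e 1)
    simp [he, a1] at q
    rw [a2 w]
    linear_combination (-θ 1 x w) * q
  · have q := d3 (e 0) (e 3)
    simp [he, a1] at q
    rw [a3 w]
    linear_combination (-θ 3 x w) * q

/-- The term -θ¹∧Ω₅ of dΩ₁ determines Ω₅ up to a multiple of θ¹, and the term -½θ²∧Ω₅ of dΩ₃ fixes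
this multiple. -/
theorem rigidity_last {θ Ω η Λ : Fin 5 → OneForm E} {x : E} {e : Fin 5 → E}
    (he : ∀ i k, θ i x (e k) = if i = k then 1 else 0)
    (hθ : StructureEquations θ Ω x) (hη : StructureEquations η Λ x) (h : ∀ i, η i x = θ i x)
    (hΛ : ∀ i, i ≠ 4 → Λ i x = Ω i x)
    (d : ∀ i, i ≠ 4 → ∀ v w, extD (Λ i) x v w = extD (Ω i) x v w) : Λ 4 x = Ω 4 x := by
  have d0 := d 0 (by decide)
  have d2 := d 2 (by decide)
  rw [hη.dΩ₁, hθ.dΩ₁] at d0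
  rw [hη.dΩ₃, hθ.dΩ₃] at d2
  have l0 := hΛ 0 (by decide)
  have l1 := hΛ 1 (by decide)
  have l2 := hΛ 2 (by decide)
  have l3 := hΛ 3 (by decide)
  simp only [Pi.add_apply, Pi.sub_apply, Pi.neg_apply, Pi.smul_apply, wedge_apply, smul_eq_mul,
    add_apply, sub_apply, smul_apply, h, l0, l1, l2, l3] at d0 d2
  have k0 : Λ 4 x (e 0) = Ω 4 x (e 0) := by
    have := d2 (e 1) (e 0)
    simp [he] at this
    linarith
  refine ContinuousLinearMap.ext fun w => ?_
  have := d0 (e 0) w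
  simp [he, k0] at this
  linarith

end Rigidity

section Lift

variable {E : Type*} [NormedAddCommGroup E] [NormedSpace ℝ E]

/-! ### Maps to the bundle -/

theorem fderiv_fst_comp {Φ : E → BundleSpace} {π : E → JetSpace} {x : E}
    (hΦ : DifferentiableAt ℝ Φ x) (hπ : (fun y => (Φ y).1) =ᶠ[nhds x] π) (v : E) :
    (fderiv ℝ Φ x v).1 = fderiv ℝ π x v := by
  rw [← hπ.fderiv_eq]
  have := (hΦ.hasFDerivAt.fst).fderiv
  rw [this]; rfl

theorem fderiv_snd_comp {Φ : E → BundleSpace} {x : E} (hΦ : DifferentiableAt ℝ Φ x) (l : Fin 5)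
    (v : E) : (fderiv ℝ Φ x v).2 l = fderiv ℝ (fun y => (Φ y).2 l) x v := by
  have h1 := hΦ.hasFDerivAt.snd
  have h2 := ((ContinuousLinearMap.proj (R := ℝ) (φ := fun _ : Fin 5 => ℝ) l).hasFDerivAt
    (x := (Φ x).2)).comp x h1
  have h3 : fderiv ℝ (fun y => (Φ y).2 l) x = _ := h2.fderiv
  rw [h3]; rfl

theorem pullback_canonθ {Φ : E → BundleSpace} {π : E → JetSpace} {x : E}
    (hΦ : DifferentiableAt ℝ Φ x) (hπ : (fun y => (Φ y).1) =ᶠ[nhds x] π) (i : Fin 5) :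
    pullback Φ (canonθ i) x = ∑ j, coefθ (Φ x).2 i j • pullback π (flatForms j) x := by
  refine ContinuousLinearMap.ext fun v => ?_
  rw [pullback_apply, canonθ_apply_eq_sum, fderiv_fst_comp hΦ hπ, show (Φ x).1 = π x from hπ.self_of_nhds]
  simp [pullback_apply, sum_apply]

/-- Ω₁ is the one connection form whose pullback is needed explicitly, because the parameter u is
fixed through its ω¹-coefficient. -/
theorem pullback_canonΩ_zero {Φ : E → BundleSpace} {π : E → JetSpace} {x : E}
    (hΦ : DifferentiableAt ℝ Φ x) (hπ : (fun y => (Φ y).1) =ᶠ[nhds x] π) (v : E) :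
    pullback Φ (canonΩ 0) x v = -((Φ x).2 0 ^ 2 * (Φ x).2 4) * pullback π (flatForms 0) x v +
      -((Φ x).2 3 * Real.exp ((Φ x).2 1) / (Φ x).2 0) * pullback π (flatForms 1) x v +
      (Φ x).2 2 * Real.exp (-(Φ x).2 1) / (Φ x).2 0 * pullback π (flatForms 3) x v +
      2 / (Φ x).2 0 * fderiv ℝ (fun y => (Φ y).2 0) x v := by
  rw [pullback_apply, (canonΩ_apply _ _).1, fderiv_fst_comp hΦ hπ, fderiv_snd_comp hΦ,
    show (Φ x).1 = π x from hπ.self_of_nhds]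
  rfl

theorem structureEquations_pullback_canon {Φ : E → BundleSpace} {x : E} (hΦ : ContDiffAt ℝ ∞ Φ x)
    (hx : Φ x ∈ bundle) :
    StructureEquations (fun i => pullback Φ (canonθ i)) (fun i => pullback Φ (canonΩ i)) x :=
  (structureEquations_canon hx).pullback hΦ (differentiableAt_canonθ hx) (differentiableAt_canonΩ hx)

section Normal

variable {O : Set E} {π : E → JetSpace} {θ Ω : Fin 5 → OneForm E} {e f : Fin 5 → E → E}

/-- The parameters determined by an adapted coframe, up to the last one. -/
def liftParam (π : E → JetSpace) (e : Fin 5 → E → E) (u : E → ℝ) (x : E) : Params :=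
  -- The parameters solve re^φT₁₁ = re^{-φ}T₃₃ = 1, sT₀₀ + re^φT₁₀ = 0 and s̄T₀₀ + re^{-φ}T₃₀ = 0,
  -- which normalises rows 1 and 3 of `coefθ b * T`.
  let T := pullCoef π e x
  let φ := Real.log (T 3 3 / T 1 1) / 2
  ![Real.exp φ / T 3 3, φ, -(T 1 0 / (T 1 1 * T 0 0)), -(T 3 0 / (T 3 3 * T 0 0)), u x]

/-- The map to the bundle determined by an adapted coframe and a function `u`. -/
def liftMap (π : E → JetSpace) (e : Fin 5 → E → E) (u : E → ℝ) (x : E) : BundleSpace :=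
  (π x, liftParam π e u x)

theorem contDiffOn_coefθ {b : E → Params} (hb : ContDiffOn ℝ ∞ b O) (h0 : ∀ x ∈ O, b x ∈ paramSet)
    (i j : Fin 5) : ContDiffOn ℝ ∞ (fun x => coefθ (b x) i j) O := by
  have hr : ∀ b ∈ paramSet, b 0 ≠ 0 := fun b hb => hb
  have hr2 : ∀ b ∈ paramSet, 2 * b 0 ^ 2 ≠ 0 := fun b hb =>
    mul_ne_zero two_ne_zero (pow_ne_zero _ (hr b hb))
  have h : ContDiffOn ℝ ∞ (fun b => coefθ b i j) paramSet := by
    fin_cases i <;> fin_cases j <;>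
      simp only [coefθ, Matrix.of_apply, Matrix.cons_val, Fin.zero_eta, Fin.mk_one,
        Fin.reduceFinMk] <;>
      fun_prop (disch := assumption)
  exact h.comp hb h0

theorem IsAdaptedCoframe.liftMap_smooth (h : IsAdaptedCoframe O π θ Ω) (hO : IsOpen O)
    (hf : IsDualFrame O θ Ω e f) (hpos : ∀ x ∈ O, 0 < pullCoef π e x 1 1 * pullCoef π e x 3 3)
    {u : E → ℝ} (hu : ContDiffOn ℝ ∞ u O) : ContDiffOn ℝ ∞ (liftMap π e u) O := by
  have hT := h.contDiffOn_pullCoef hO hf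
  have n1 : ∀ x ∈ O, pullCoef π e x 1 1 ≠ 0 := fun x hx => left_ne_zero_of_mul (hpos x hx).ne'
  have n3 : ∀ x ∈ O, pullCoef π e x 3 3 ≠ 0 := fun x hx => right_ne_zero_of_mul (hpos x hx).ne'
  have n0 : ∀ x ∈ O, pullCoef π e x 0 0 ≠ 0 := fun x hx =>
    (h.coef_relations hO hf hx).2.2.2.2 ▸ (hpos x hx).ne'
  have hφ : ContDiffOn ℝ ∞ (fun x => Real.log (pullCoef π e x 3 3 / pullCoef π e x 1 1) / 2) O :=
    (((hT 3 3).div (hT 1 1) n1).log fun x hx => div_ne_zero (n3 x hx) (n1 x hx)).div_const 2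
  refine h.smooth_proj.prodMk (contDiffOn_pi.2 fun i => ?_)
  fin_cases i
  · exact hφ.exp.div (hT 3 3) n3
  · exact hφ
  · exact ((hT 1 0).div ((hT 1 1).mul (hT 0 0)) fun x hx => mul_ne_zero (n1 x hx) (n0 x hx)).neg
  · exact ((hT 3 0).div ((hT 3 3).mul (hT 0 0)) fun x hx => mul_ne_zero (n3 x hx) (n0 x hx)).neg
  · exact hu

theorem liftMap_mem (u : E → ℝ) {x : E} (hx : pullCoef π e x 3 3 ≠ 0) :
    liftMap π e u x ∈ bundle :=
  div_ne_zero (Real.exp_pos _).ne' hx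

/-- The coefficients of the pulled back forms with respect to the adapted coframe. -/
theorem IsAdaptedCoframe.liftMap_coef (h : IsAdaptedCoframe O π θ Ω) (hO : IsOpen O)
    (hf : IsDualFrame O θ Ω e f) (hpos : ∀ x ∈ O, 0 < pullCoef π e x 1 1 * pullCoef π e x 3 3)
    (u : E → ℝ) {x : E} (hx : x ∈ O) {M : Matrix (Fin 5) (Fin 5) ℝ}
    (hM : M = coefθ (liftParam π e u x) * pullCoef π e x) :
    M = !![1, 0, 0, 0, 0;
           0, 1, 0, 0, 0;
           M 2 0, M 2 1, 1, 0, 0;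
           0, 0, 0, 1, 0;
           M 4 0, 0, 0, M 4 3, 1] := by
  obtain ⟨hdet, z0, z1, z2⟩ := h.pullCoef_mem hf hx
  obtain ⟨z12, z34, n1, n3, h00⟩ := h.coef_relations hO hf hx
  obtain ⟨h11, h33⟩ := h.coef_relations' hO hf hx
  have hp := hpos x hx
  have z01 := z0 1 (by decide)
  have z02 := z0 2 (by decide)
  have z03 := z0 3 (by decide)
  have z04 := z0 4 (by decide)
  have z13 := z1 1 (by simp) 3 (by simp)
  have z14 := z1 1 (by simp) 4 (by simp)
  have z23 := z1 2 (by simp) 3 (by simp)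
  have z24 := z1 2 (by simp) 4 (by simp)
  have z31 := z2 3 (by simp) 1 (by simp)
  have z32 := z2 3 (by simp) 2 (by simp)
  have z41 := z2 4 (by simp) 1 (by simp)
  have z42 := z2 4 (by simp) 2 (by simp)
  have hE : Real.exp (liftParam π e u x 1) ^ 2 = pullCoef π e x 3 3 / pullCoef π e x 1 1 := by
    have hp' : 0 < pullCoef π e x 3 3 / pullCoef π e x 1 1 := by
      rcases pos_and_pos_or_neg_and_neg_of_mul_pos hp with h | h
      · exact div_pos h.2 h.1
      · exact div_pos_of_neg_of_neg h.2 h.1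
    rw [sq, ← Real.exp_add]
    change Real.exp (Real.log _ / 2 + Real.log _ / 2) = _
    rw [add_halves, Real.exp_log hp']
  have b0 : liftParam π e u x 0 = Real.exp (liftParam π e u x 1) / pullCoef π e x 3 3 := rfl
  have b2 : liftParam π e u x 2 = -(pullCoef π e x 1 0 / (pullCoef π e x 1 1 * pullCoef π e x 0 0)) :=
    rfl
  have b3 : liftParam π e u x 3 = -(pullCoef π e x 3 0 / (pullCoef π e x 3 3 * pullCoef π e x 0 0)) :=
    rfl
  have hEne := (Real.exp_pos (liftParam π e u x 1)).ne'
  have he' : Real.exp (-liftParam π e u x 1) = (Real.exp (liftParam π e u x 1))⁻¹ := Real.exp_neg _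
  have hN : ∀ i j, M i j = coefθ (liftParam π e u x) i 0 * pullCoef π e x 0 j +
      coefθ (liftParam π e u x) i 1 * pullCoef π e x 1 j +
      coefθ (liftParam π e u x) i 2 * pullCoef π e x 2 j +
      coefθ (liftParam π e u x) i 3 * pullCoef π e x 3 j +
      coefθ (liftParam π e u x) i 4 * pullCoef π e x 4 j := fun i j => by
    rw [hM, Matrix.mul_apply, Fin.sum_univ_five]
  generalize hT : pullCoef π e x = T at *
  generalize hb : liftParam π e u x = b at *
  generalize hXe : Real.exp (b 1) = X at *
  have hX : X ^ 2 * T 1 1 = T 3 3 := by rw [hE]; field_simp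
  have n0 : T 0 0 ≠ 0 := h00 ▸ hp.ne'
  have h0 : b 0 * X * T 1 1 = 1 := by
    rw [b0]; field_simp; linarith
  have h3 : b 0 * X⁻¹ * T 3 3 = 1 := by
    rw [b0]; field_simp
  -- The remaining diagonal entries are 1 because T₀₀ = T₁₁T₃₃, T₂₂ = T₁₁/T₃₃ and T₄₄ = T₃₃/T₁₁.
  have m00 : b 0 ^ 2 * T 0 0 = 1 := by
    have : b 0 ^ 2 * T 0 0 = (b 0 * X * T 1 1) * (b 0 * X⁻¹ * T 3 3) := by
      rw [h00]; field_simp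
    rw [this, h0, h3, one_mul]
  have m22 : X ^ 2 * T 2 2 = 1 := by
    rw [hE]; field_simp; linarith
  have m44 : (X ^ 2)⁻¹ * T 4 4 = 1 := by
    rw [hE]; field_simp; linarith
  have m10 : b 2 * T 0 0 + b 0 * X * T 1 0 = 0 := by
    have : b 0 * X = 1 / T 1 1 := by field_simp; linarith
    rw [this, b2]; field_simp; ring
  have m30 : b 3 * T 0 0 + b 0 * X⁻¹ * T 3 0 = 0 := by
    have : b 0 * X⁻¹ = 1 / T 3 3 := by field_simp at h3 ⊢; linarith
    rw [this, b3]; field_simp; ring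
  ext i j
  fin_cases i <;> fin_cases j <;> first
    | rfl
    | (simp only [Fin.zero_eta, Fin.mk_one, Fin.reduceFinMk, Matrix.of_apply, Matrix.cons_val]
       rw [hN]
       simp [coefθ, z01, z02, z03, z04, z12, z13, z14, z23, z24, z31, z32, z34, z41, z42, hXe, he', m00,
        h0, h3, m22, m44, m10, m30])

end Normal

end Lift

/-! ### The coframe map of an adapted coframe -/

section CoframeMap

variable {E : Type*} [NormedAddCommGroup E] [NormedSpace ℝ E]
variable {O : Set E} {π : E → JetSpace} {θ Ω : Fin 5 → OneForm E} {e f : Fin 5 → E → E}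

theorem extD_eq_of_eqOn {α β : OneForm E} (hO : IsOpen O) (h : ∀ y ∈ O, α y = β y) {x : E}
    (hx : x ∈ O) (v w : E) : extD α x v w = extD β x v w := by
  rw [extD_congr (Filter.eventually_of_mem (hO.mem_nhds hx) h)]

theorem extD_add_smul_add_smul {α β γ : OneForm E} {A B : E → ℝ} {x : E}
    (hα : DifferentiableAt ℝ α x) (hβ : DifferentiableAt ℝ β x) (hγ : DifferentiableAt ℝ γ x)
    (hA : DifferentiableAt ℝ A x) (hB : DifferentiableAt ℝ B x) (v w : E) :
    extD (fun y => α y + A y • β y + B y • γ y) x v w = extD α x v w +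
      ((fderiv ℝ A x ⋏ β x) v w + A x * extD β x v w) +
      ((fderiv ℝ B x ⋏ γ x) v w + B x * extD γ x v w) := by
  have h1 := extD_add (hα.add (hA.fun_smul hβ)) (hB.fun_smul hγ) v w
  rw [extD_add hα (hA.fun_smul hβ), extD_smul hA hβ, extD_smul hB hγ] at h1
  exact h1

theorem extD_add_smul {α β : OneForm E} {A : E → ℝ} {x : E}
    (hα : DifferentiableAt ℝ α x) (hβ : DifferentiableAt ℝ β x)
    (hA : DifferentiableAt ℝ A x) (v w : E) :
    extD (fun y => α y + A y • β y) x v w = extD α x v w +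
      ((fderiv ℝ A x ⋏ β x) v w + A x * extD β x v w) := by
  have h1 := extD_add hα (hA.fun_smul hβ) v w
  rw [extD_smul hA hβ] at h1
  exact h1

/-- The pullback of the forms `θ` by the map determined by an adapted coframe. -/
theorem IsAdaptedCoframe.pullback_liftMap (h : IsAdaptedCoframe O π θ Ω) (hO : IsOpen O)
    (hf : IsDualFrame O θ Ω e f) (hpos : ∀ x ∈ O, 0 < pullCoef π e x 1 1 * pullCoef π e x 3 3)
    {u : E → ℝ} (hu : ContDiffOn ℝ ∞ u O) {x : E} (hx : x ∈ O) (i : Fin 5) :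
    pullback (liftMap π e u) (canonθ i) x = θ i x := by
  have hΦ := h.liftMap_smooth hO hf hpos hu
  have hmem : ∀ y ∈ O, liftMap π e u y ∈ bundle := fun y hy =>
    liftMap_mem u (right_ne_zero_of_mul (hpos y hy).ne')
  have hΦd : ∀ y ∈ O, DifferentiableAt ℝ (liftMap π e u) y := fun y hy =>
    (hΦ.contDiffAt (hO.mem_nhds hy)).differentiableAt (by simp)
  have hb : ContDiffOn ℝ ∞ (liftParam π e u) O := contDiff_snd.comp_contDiffOn hΦ
  -- The pulled back forms are Mθ, where only M₂₀, M₂₁, M₄₀, M₄₃ can differ from the identity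
  -- matrix. The entries M₂₁ and M₄₃ are removed first and on all of O, since the argument for the
  -- other two differentiates the simplified expressions.
  let M : E → Matrix (Fin 5) (Fin 5) ℝ := fun y => coefθ (liftParam π e u y) * pullCoef π e y
  have hMd : ∀ i j, ∀ y ∈ O, DifferentiableAt ℝ (fun y => M y i j) y := by
    intro i j y hy
    have : ContDiffOn ℝ ∞ (fun y => M y i j) O := by
      simp only [M, Matrix.mul_apply]
      exact ContDiffOn.sum fun k _ => (contDiffOn_coefθ hb hmem i k).mul
        (h.contDiffOn_pullCoef hO hf k j)
    exact (this.contDiffAt (hO.mem_nhds hy)).differentiableAt (by simp)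
  have hη : ∀ y ∈ O, ∀ i, pullback (liftMap π e u) (canonθ i) y = ∑ k, M y i k • θ k y := by
    intro y hy i
    rw [pullback_canonθ (hΦd y hy) Filter.EventuallyEq.rfl i]
    have h2 : ∀ j, pullback (fun y => (liftMap π e u y).1) (flatForms j) y = _ := fun j =>
      h.pullback_eq hf hy j
    simp only [h2, Finset.smul_sum, smul_smul]
    rw [Finset.sum_comm]
    simp only [← Finset.sum_smul, M, Matrix.mul_apply]
    rfl
  have hshape : ∀ y ∈ O, M y = _ := fun y hy => h.liftMap_coef hO hf hpos u hy rfl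
  have hM : ∀ i j, ∀ y ∈ O, M y i j = _ := fun i j y hy => congrFun (congrFun (hshape y hy) i) j
  have η0 : ∀ y ∈ O, pullback (liftMap π e u) (canonθ 0) y = θ 0 y := by
    intro y hy
    rw [hη y hy, Fin.sum_univ_five, hM 0 0 y hy, hM 0 1 y hy, hM 0 2 y hy, hM 0 3 y hy, hM 0 4 y hy]
    simp
  have η1 : ∀ y ∈ O, pullback (liftMap π e u) (canonθ 1) y = θ 1 y := by
    intro y hy
    rw [hη y hy, Fin.sum_univ_five, hM 1 0 y hy, hM 1 1 y hy, hM 1 2 y hy, hM 1 3 y hy, hM 1 4 y hy]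
    simp
  have η3 : ∀ y ∈ O, pullback (liftMap π e u) (canonθ 3) y = θ 3 y := by
    intro y hy
    rw [hη y hy, Fin.sum_univ_five, hM 3 0 y hy, hM 3 1 y hy, hM 3 2 y hy, hM 3 3 y hy, hM 3 4 y hy]
    simp
  have η2 : ∀ y ∈ O, pullback (liftMap π e u) (canonθ 2) y =
      θ 2 y + M y 2 0 • θ 0 y + M y 2 1 • θ 1 y := by
    intro y hy
    rw [hη y hy, Fin.sum_univ_five, hM 2 2 y hy, hM 2 3 y hy, hM 2 4 y hy]
    simp only [Matrix.of_apply, Matrix.cons_val, one_smul, zero_smul, add_zero]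
    abel
  have η4 : ∀ y ∈ O, pullback (liftMap π e u) (canonθ 4) y =
      θ 4 y + M y 4 0 • θ 0 y + M y 4 3 • θ 3 y := by
    intro y hy
    rw [hη y hy, Fin.sum_univ_five, hM 4 1 y hy, hM 4 2 y hy, hM 4 4 y hy]
    simp only [Matrix.of_apply, Matrix.cons_val, one_smul, zero_smul, add_zero]
    abel
  have hθd : ∀ k, ∀ y ∈ O, DifferentiableAt ℝ (θ k) y := fun k y hy =>
    ((h.smooth_θ k).contDiffAt (hO.mem_nhds hy)).differentiableAt (by simp)
  have hs : ∀ y ∈ O, StructureEquations (fun i => pullback (liftMap π e u) (canonθ i))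
      (fun i => pullback (liftMap π e u) (canonΩ i)) y := fun y hy =>
    structureEquations_pullback_canon (hΦ.contDiffAt (hO.mem_nhds hy)) (hmem y hy)
  have first : ∀ y ∈ O, M y 2 1 = 0 ∧ M y 4 3 = 0 := fun y hy =>
    rigidity_first (hf.θe y hy) (h.structureEquations y hy) (hs y hy) (η0 y hy) (η1 y hy) (η3 y hy)
      (η2 y hy) (η4 y hy) (extD_eq_of_eqOn hO η0 hy) (extD_eq_of_eqOn hO η1 hy)
      (extD_eq_of_eqOn hO η3 hy)
      (fun v w => (extD_eq_of_eqOn hO η2 hy v w).trans (extD_add_smul_add_smul (hθd 2 y hy)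
        (hθd 0 y hy) (hθd 1 y hy) (hMd 2 0 y hy) (hMd 2 1 y hy) v w))
      (fun v w => (extD_eq_of_eqOn hO η4 hy v w).trans (extD_add_smul_add_smul (hθd 4 y hy)
        (hθd 0 y hy) (hθd 3 y hy) (hMd 4 0 y hy) (hMd 4 3 y hy) v w))
  have η2' : ∀ y ∈ O, pullback (liftMap π e u) (canonθ 2) y = θ 2 y + M y 2 0 • θ 0 y := by
    intro y hy
    rw [η2 y hy, (first y hy).1, zero_smul, add_zero]
  have η4' : ∀ y ∈ O, pullback (liftMap π e u) (canonθ 4) y = θ 4 y + M y 4 0 • θ 0 y := by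
    intro y hy
    rw [η4 y hy, (first y hy).2, zero_smul, add_zero]
  have second := rigidity_second (hf.θe x hx) (h.structureEquations x hx) (hs x hx) (η0 x hx)
    (η1 x hx) (η3 x hx) (η2' x hx) (η4' x hx) (extD_eq_of_eqOn hO η1 hx) (extD_eq_of_eqOn hO η3 hx)
    (fun v w => (extD_eq_of_eqOn hO η2' hx v w).trans (extD_add_smul (hθd 2 x hx)
        (hθd 0 x hx) (hMd 2 0 x hx) v w))
    (fun v w => (extD_eq_of_eqOn hO η4' hx v w).trans (extD_add_smul (hθd 4 x hx)
        (hθd 0 x hx) (hMd 4 0 x hx) v w))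
  fin_cases i
  · exact η0 x hx
  · exact η1 x hx
  · change pullback (liftMap π e u) (canonθ 2) x = θ 2 x
    rw [η2' x hx, second.1, zero_smul, add_zero]
  · exact η3 x hx
  · change pullback (liftMap π e u) (canonθ 4) x = θ 4 x
    rw [η4' x hx, second.2, zero_smul, add_zero]

/-- By rigidity, what is left is the function f for which the pulled back Ω₁ differs from Ω₁ by fθ¹.
The parameter u does not occur in the θ; it enters Ω₁ through -r²uω¹, and r²ω¹ takes the value 1 on
e 0. Choosing u as the value of f for u = 0 therefore makes f vanish. Then Ω₁, …, Ω₄ agree, and Ω₅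
follows from `rigidity_last`. -/
theorem exists_isCoframeMap_of_pos (h : IsAdaptedCoframe O π θ Ω) (hO : IsOpen O)
    (hf : IsDualFrame O θ Ω e f)
    (hpos : ∀ x ∈ O, 0 < pullCoef π e x 1 1 * pullCoef π e x 3 3) :
    ∃ Φ : E → BundleSpace, ContDiffOn ℝ ∞ Φ O ∧ Set.MapsTo Φ O bundle ∧
      (∀ x ∈ O, (Φ x).1 = π x) ∧ (∀ x ∈ O, ∀ i, pullback Φ (canonθ i) x = θ i x) ∧
      ∀ x ∈ O, ∀ i, pullback Φ (canonΩ i) x = Ω i x := by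
  have hmem : ∀ u, ∀ y ∈ O, liftMap π e u y ∈ bundle := fun u y hy =>
    liftMap_mem u (right_ne_zero_of_mul (hpos y hy).ne')
  have hs : ∀ u, ContDiffOn ℝ ∞ u O → ∀ y ∈ O,
      StructureEquations (fun i => pullback (liftMap π e u) (canonθ i))
        (fun i => pullback (liftMap π e u) (canonΩ i)) y := fun u hu y hy =>
    structureEquations_pullback_canon
      ((h.liftMap_smooth hO hf hpos hu).contDiffAt (hO.mem_nhds hy)) (hmem u y hy)
  have hd : ∀ u, ContDiffOn ℝ ∞ u O → ∀ y ∈ O, DifferentiableAt ℝ (liftMap π e u) y :=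
    fun u hu y hy =>
      ((h.liftMap_smooth hO hf hpos hu).contDiffAt (hO.mem_nhds hy)).differentiableAt (by simp)
  have hrig : ∀ u, ContDiffOn ℝ ∞ u O → ∀ y ∈ O, _ := fun u hu y hy =>
    rigidity_connection (hf.θe y hy) (h.structureEquations y hy) (hs u hu y hy)
      (fun i => h.pullback_liftMap hO hf hpos hu hy i)
      (fun i v w => extD_eq_of_eqOn hO (fun z hz => h.pullback_liftMap hO hf hpos hu hz i) hy v w)
  have h0 : ContDiffOn ℝ ∞ (0 : E → ℝ) O := contDiffOn_const
  let u : E → ℝ := fun x => pullback (liftMap π e 0) (canonΩ 0) x (e 0 x) - Ω 0 x (e 0 x)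
  have hu : ContDiffOn ℝ ∞ u O :=
    ((contDiffOn_pullback hO (h.liftMap_smooth hO hf hpos h0) (contDiffOn_canonΩ 0)
      (hmem 0)).clm_apply (hf.smooth_e 0)).sub ((h.smooth_Ω 0).clm_apply (hf.smooth_e 0))
  have hzero : ∀ y ∈ O, pullback (liftMap π e u) (canonΩ 0) y (e 0 y) - Ω 0 y (e 0 y) = 0 := by
    intro y hy
    have k1 := pullback_canonΩ_zero (hd u hu y hy) Filter.EventuallyEq.rfl (e 0 y)
    have k2 := pullback_canonΩ_zero (hd 0 h0 y hy) Filter.EventuallyEq.rfl (e 0 y)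
    have k3 : pullback (liftMap π e u) (canonΩ 0) y (e 0 y) =
        pullback (liftMap π e 0) (canonΩ 0) y (e 0 y) -
          u y * ((liftParam π e u y 0) ^ 2 * pullback π (flatForms 0) y (e 0 y)) := by
      rw [k1, k2]
      have c0 : ∀ z, (liftMap π e 0 z).2 0 = (liftMap π e u z).2 0 := fun z => rfl
      have c1 : (liftMap π e 0 y).2 1 = (liftMap π e u y).2 1 := rfl
      have c2 : (liftMap π e 0 y).2 2 = (liftMap π e u y).2 2 := rfl
      have c3 : (liftMap π e 0 y).2 3 = (liftMap π e u y).2 3 := rfl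
      have c4 : (liftMap π e 0 y).2 4 = 0 := rfl
      have c5 : (liftMap π e u y).2 4 = u y := rfl
      have c6 : liftParam π e u y 0 = (liftMap π e u y).2 0 := rfl
      have c7 : ∀ v : E → ℝ, (fun z => (liftMap π e v z).1) = π := fun v => rfl
      simp only [c0, c1, c2, c3, c4, c5, c6, c7]
      ring
    have k4 := congrArg (fun L => L (e 0 y)) (h.pullback_liftMap hO hf hpos hu hy 0)
    simp only [pullback_canonθ (hd u hu y hy) Filter.EventuallyEq.rfl, hf.θe y hy, if_true] at k4
    rw [Fin.sum_univ_five] at k4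
    simp [coefθ] at k4
    have k5 : (liftParam π e u y 0) ^ 2 * pullback π (flatForms 0) y (e 0 y) = 1 := k4
    rw [k3, k5]
    simp only [u]
    ring
  have hΩ : ∀ y ∈ O, ∀ i, i ≠ 4 → pullback (liftMap π e u) (canonΩ i) y = Ω i y := by
    intro y hy i hi
    obtain ⟨r0, r1, r2, r3⟩ := hrig u hu y hy
    simp only [hzero y hy, zero_mul, zero_div] at r0 r2 r3
    refine ContinuousLinearMap.ext fun w => ?_
    fin_cases i
    · exact sub_eq_zero.1 (r0 w)
    · exact r1 w
    · exact sub_eq_zero.1 (r2 w)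
    · exact sub_eq_zero.1 (r3 w)
    · exact absurd rfl hi
  refine ⟨liftMap π e u, h.liftMap_smooth hO hf hpos hu, hmem u, fun x hx => rfl,
    fun x hx i => h.pullback_liftMap hO hf hpos hu hx i, fun x hx i => ?_⟩
  by_cases hi : i = 4
  · subst hi
    exact rigidity_last (hf.θe x hx) (h.structureEquations x hx) (hs u hu x hx)
      (fun i => h.pullback_liftMap hO hf hpos hu hx i) (hΩ x hx)
      (fun i hi v w => extD_eq_of_eqOn hO (fun y hy => hΩ y hy i hi) hx v w)
  · exact hΩ x hx i hi

/-! ### The involution -/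

theorem signθ_sq {ε : ℝ} (hε : ε = 1 ∨ ε = -1) (i : Fin 5) : signθ ε i * signθ ε i = 1 := by
  rcases hε with rfl | rfl <;> fin_cases i <;> simp [signθ]

theorem signΩ_sq {ε : ℝ} (hε : ε = 1 ∨ ε = -1) (i : Fin 5) : signΩ ε i * signΩ ε i = 1 := by
  rcases hε with rfl | rfl <;> fin_cases i <;> simp [signΩ]

/-- The factors match in each equation because ε² = 1. Conceptually the involution is conjugation of
the connection matrix by diag(ε, 1, 1, 1, ε). -/
theorem StructureEquations.sign {ε : ℝ} (hε : ε = 1 ∨ ε = -1) {x : E}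
    (hθ : ∀ i, DifferentiableAt ℝ (θ i) x) (hΩ : ∀ i, DifferentiableAt ℝ (Ω i) x)
    (h : StructureEquations θ Ω x) :
    StructureEquations (fun i => signθ ε i • θ i) (fun i => signΩ ε i • Ω i) x := by
  have hε2 : ε * ε = 1 := by rcases hε with rfl | rfl <;> norm_num
  obtain ⟨h1, h2, h3, h4, h5, g1, g2, g3, g4, g5⟩ := h
  constructor <;> funext v w
  · rw [extD_const_smul _ (hθ _), h1]
    simp only [Pi.add_apply, Pi.sub_apply, Pi.neg_apply, Pi.smul_apply, wedge_apply, smul_eq_mul,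
      add_apply, sub_apply, smul_apply, signθ, signΩ, Matrix.cons_val]
    ring
  · rw [extD_const_smul _ (hθ _), h2]
    simp only [Pi.add_apply, Pi.sub_apply, Pi.neg_apply, Pi.smul_apply, wedge_apply, smul_eq_mul,
      add_apply, sub_apply, smul_apply, signθ, signΩ, Matrix.cons_val]
    ring
  · rw [extD_const_smul _ (hθ _), h3]
    simp only [Pi.add_apply, Pi.sub_apply, Pi.neg_apply, Pi.smul_apply, wedge_apply, smul_eq_mul,
      add_apply, sub_apply, smul_apply, signθ, signΩ, Matrix.cons_val]
    ring
  · rw [extD_const_smul _ (hθ _), h4]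
    simp only [Pi.add_apply, Pi.sub_apply, Pi.neg_apply, Pi.smul_apply, wedge_apply, smul_eq_mul,
      add_apply, sub_apply, smul_apply, signθ, signΩ, Matrix.cons_val]
    linear_combination (θ 1 x v * θ 4 x w - θ 1 x w * θ 4 x v + θ 0 x v * Ω 3 x w -
      θ 0 x w * Ω 3 x v) * hε2
  · rw [extD_const_smul _ (hθ _), h5]
    simp only [Pi.add_apply, Pi.sub_apply, Pi.neg_apply, Pi.smul_apply, wedge_apply, smul_eq_mul,
      add_apply, sub_apply, smul_apply, signθ, signΩ, Matrix.cons_val]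
    ring
  · rw [extD_const_smul _ (hΩ _), g1]
    simp only [Pi.add_apply, Pi.sub_apply, Pi.neg_apply, Pi.smul_apply, wedge_apply, smul_eq_mul,
      add_apply, sub_apply, smul_apply, signθ, signΩ, Matrix.cons_val]
    linear_combination (-(θ 1 x v * Ω 3 x w - θ 1 x w * Ω 3 x v) + (θ 0 x v * Ω 4 x w -
      θ 0 x w * Ω 4 x v)) * hε2
  · rw [extD_const_smul _ (hΩ _), g2]
    simp only [Pi.add_apply, Pi.sub_apply, Pi.neg_apply, Pi.smul_apply, wedge_apply, smul_eq_mul,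
      add_apply, sub_apply, smul_apply, signθ, signΩ, Matrix.cons_val]
    linear_combination ((θ 2 x v * θ 4 x w - θ 2 x w * θ 4 x v) + 1 / 2 * (θ 1 x v * Ω 3 x w -
      θ 1 x w * Ω 3 x v)) * hε2
  · rw [extD_const_smul _ (hΩ _), g3]
    simp only [Pi.add_apply, Pi.sub_apply, Pi.neg_apply, Pi.smul_apply, wedge_apply, smul_eq_mul,
      add_apply, sub_apply, smul_apply, signθ, signΩ, Matrix.cons_val]
    linear_combination (-(θ 2 x v * Ω 3 x w - θ 2 x w * Ω 3 x v) + 1 / 2 * (θ 1 x v * Ω 4 x w -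
      θ 1 x w * Ω 4 x v)) * hε2
  · rw [extD_const_smul _ (hΩ _), g4]
    simp only [Pi.add_apply, Pi.sub_apply, Pi.neg_apply, Pi.smul_apply, wedge_apply, smul_eq_mul,
      add_apply, sub_apply, smul_apply, signθ, signΩ, Matrix.cons_val]
    ring
  · rw [extD_const_smul _ (hΩ _), g5]
    simp only [Pi.add_apply, Pi.sub_apply, Pi.neg_apply, Pi.smul_apply, wedge_apply, smul_eq_mul,
      add_apply, sub_apply, smul_apply, signθ, signΩ, Matrix.cons_val]
    ring

theorem paraCR_diagonal_mul {d : Fin 5 → ℝ} (hd : ∀ i, d i ≠ 0) {S : Matrix (Fin 5) (Fin 5) ℝ}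
    (hS : S ∈ paraCRMatrices) : Matrix.diagonal d * S ∈ paraCRMatrices := by
  obtain ⟨h, h0, h1, h2⟩ := hS
  refine ⟨?_, fun j hj => ?_, fun i hi j hj => ?_, fun i hi j hj => ?_⟩
  · rw [Matrix.det_mul, Matrix.det_diagonal]
    exact mul_ne_zero (Finset.prod_ne_zero_iff.2 fun i _ => hd i) h
  · rw [Matrix.diagonal_mul, h0 j hj, mul_zero]
  · rw [Matrix.diagonal_mul, h1 i hi j hj, mul_zero]
  · rw [Matrix.diagonal_mul, h2 i hi j hj, mul_zero]

theorem IsAdaptedCoframe.sign [FiniteDimensional ℝ E] (hE : Module.finrank ℝ E = 10)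
    (hO : IsOpen O) (h : IsAdaptedCoframe O π θ Ω) {ε : ℝ} (hε : ε = 1 ∨ ε = -1) :
    IsAdaptedCoframe O π (fun i => signθ ε i • θ i) (fun i => signΩ ε i • Ω i) where
  smooth_proj := h.smooth_proj
  smooth_θ := fun i => contDiffOn_const.smul (h.smooth_θ i)
  smooth_Ω := fun i => contDiffOn_const.smul (h.smooth_Ω i)
  coframe := fun x hx => by
    refine linearIndependent_of_injective (by simp [hE]) fun v hv => ?_
    refine injective_of_linearIndependent (by simp [hE]) (h.coframe x hx) fun k => ?_
    rcases k with i | i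
    · have := hv (Sum.inl i)
      simp only [Sum.elim_inl, Pi.smul_apply, smul_apply, smul_eq_mul] at this
      exact (mul_eq_zero.1 this).resolve_left (left_ne_zero_of_mul_eq_one (signθ_sq hε i))
    · have := hv (Sum.inr i)
      simp only [Sum.elim_inr, Pi.smul_apply, smul_apply, smul_eq_mul] at this
      exact (mul_eq_zero.1 this).resolve_left (left_ne_zero_of_mul_eq_one (signΩ_sq hε i))
  adapted := fun x hx => by
    obtain ⟨S, hS, hθ⟩ := h.adapted x hx
    refine ⟨Matrix.diagonal (signθ ε) * S, paraCR_diagonal_mul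
      (fun i => left_ne_zero_of_mul_eq_one (signθ_sq hε i)) hS, fun i => ?_⟩
    simp only [Pi.smul_apply, hθ i, Finset.smul_sum, smul_smul, Matrix.diagonal_mul]
  structureEquations := fun x hx => (h.structureEquations x hx).sign hε
    (fun i => ((h.smooth_θ i).contDiffAt (hO.mem_nhds hx)).differentiableAt (by simp))
    (fun i => ((h.smooth_Ω i).contDiffAt (hO.mem_nhds hx)).differentiableAt (by simp))

theorem IsDualFrame.sign (hf : IsDualFrame O θ Ω e f) {ε : ℝ} (hε : ε = 1 ∨ ε = -1) :
    IsDualFrame O (fun i => signθ ε i • θ i) (fun i => signΩ ε i • Ω i)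
      (fun k x => signθ ε k • e k x) (fun k x => signΩ ε k • f k x) where
  smooth_e := fun k => (hf.smooth_e k).const_smul _
  smooth_f := fun k => (hf.smooth_f k).const_smul _
  θe := fun x hx i k => by
    simp only [Pi.smul_apply, smul_apply, map_smul, hf.θe x hx, smul_eq_mul]
    split_ifs with hik
    · rw [hik, mul_one, signθ_sq hε]
    · simp
  θf := fun x hx i k => by simp [hf.θf x hx]
  Ωe := fun x hx i k => by simp [hf.Ωe x hx]
  Ωf := fun x hx i k => by
    simp only [Pi.smul_apply, smul_apply, map_smul, hf.Ωf x hx, smul_eq_mul]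
    split_ifs with hik
    · rw [hik, mul_one, signΩ_sq hε]
    · simp
  ext := fun x hx α he hf' => hf.ext x hx α
    (fun k => by
      have := he k
      rw [map_smul, smul_eq_mul] at this
      exact (mul_eq_zero.1 this).resolve_left (left_ne_zero_of_mul_eq_one (signθ_sq hε k)))
    (fun k => by
      have := hf' k
      rw [map_smul, smul_eq_mul] at this
      exact (mul_eq_zero.1 this).resolve_left (left_ne_zero_of_mul_eq_one (signΩ_sq hε k)))

/-! ### Existence and uniqueness of the coframe map -/

theorem exists_sign_of_isPreconnected {X : Type*} [TopologicalSpace X] {O : Set X} {g : X → ℝ}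
    (hO : IsPreconnected O) (hg : ContinuousOn g O)
    (h0 : ∀ x ∈ O, g x ≠ 0) : ∃ ε : ℝ, (ε = 1 ∨ ε = -1) ∧ ∀ x ∈ O, 0 < ε * g x := by
  by_cases hp : ∃ x ∈ O, 0 < g x
  · obtain ⟨a, ha, hga⟩ := hp
    refine ⟨1, Or.inl rfl, fun x hx => ?_⟩
    rw [one_mul]
    by_contra hneg
    obtain ⟨y, hy, hy0⟩ := hO.intermediate_value hx ha hg ⟨not_lt.1 hneg, hga.le⟩
    exact h0 y hy hy0
  · refine ⟨-1, Or.inr rfl, fun x hx => ?_⟩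
    have : ¬ 0 < g x := fun h => hp ⟨x, hx, h⟩
    have := lt_of_le_of_ne (not_lt.1 this) (h0 x hx)
    linarith

/-- T₁₁T₃₃ has no zero, hence a constant sign ε on O. The involution multiplies it by ε and makes it
positive, as the logarithm in `liftParam` requires. -/
theorem exists_isCoframeMap [FiniteDimensional ℝ E] (hE : Module.finrank ℝ E = 10)
    (hO : IsOpen O) (hc : IsPreconnected O) (h : IsAdaptedCoframe O π θ Ω) :
    ∃ ε : ℝ, (ε = 1 ∨ ε = -1) ∧ ∃ Φ : E → BundleSpace,
      IsCoframeMap O π θ Ω canonθ canonΩ ε Φ := by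
  obtain ⟨e, f, hf⟩ := exists_isDualFrame hE hO h.smooth_θ h.smooth_Ω h.coframe
  obtain ⟨ε, hε, hpos⟩ := exists_sign_of_isPreconnected (g := fun x =>
    pullCoef π e x 1 1 * pullCoef π e x 3 3) hc
    ((h.contDiffOn_pullCoef hO hf 1 1).continuousOn.mul (h.contDiffOn_pullCoef hO hf 3 3).continuousOn)
    (fun x hx => mul_ne_zero (h.coef_relations hO hf hx).2.2.1 (h.coef_relations hO hf hx).2.2.2.1)
  obtain ⟨Φ, h1, h2, h3, h4, h5⟩ := exists_isCoframeMap_of_pos (h.sign hE hO hε) hO (hf.sign hε)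
    (fun x hx => by
      have := hpos x hx
      simp only [pullCoef_apply, map_smul, smul_eq_mul, signθ, Matrix.cons_val] at this ⊢
      linarith)
  exact ⟨ε, hε, Φ, h1, h2, h3, h4, h5⟩

theorem params_eq_of_coefθ_eq {b c : Params} (hb : b ∈ paramSet)
    (h : coefθ b = coefθ c) : b 0 = c 0 ∧ b 1 = c 1 ∧ b 2 = c 2 ∧ b 3 = c 3 := by
  have hb0 : b 0 ≠ 0 := hb
  have k : ∀ i j, coefθ b i j = coefθ c i j := fun i j => by rw [h]
  have k2 := k 1 0
  have k3 := k 3 0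
  have k11 := k 1 1
  have k33 := k 3 3
  have k22 := k 2 2
  simp only [coefθ, Matrix.of_apply, Matrix.cons_val] at k2 k3 k11 k33 k22
  have hexp : Real.exp (b 1) = Real.exp (c 1) :=
    (sq_eq_sq₀ (Real.exp_pos _).le (Real.exp_pos _).le).1 k22
  have h1 : b 1 = c 1 := Real.exp_injective hexp
  refine ⟨?_, h1, k2, k3⟩
  rw [hexp] at k11
  exact mul_right_cancel₀ (Real.exp_pos _).ne' k11

/-- A coframe map satisfies `coefθ` * T = diag(`signθ ε`). The entry 00 reads r²T₀₀ = ε, so ε is the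
sign of T₀₀. Next `coefθ` is determined, hence r, φ, s, s̄, and finally u by the value of Ω₁ on e 0.
-/
theorem IsCoframeMap.unique [FiniteDimensional ℝ E] (hE : Module.finrank ℝ E = 10)
    (hO : IsOpen O) (hne : O.Nonempty) (h : IsAdaptedCoframe O π θ Ω) {ε ε' : ℝ}
    (hε : ε = 1 ∨ ε = -1) (hε' : ε' = 1 ∨ ε' = -1) {Φ Φ' : E → BundleSpace}
    (hΦ : IsCoframeMap O π θ Ω canonθ canonΩ ε Φ)
    (hΦ' : IsCoframeMap O π θ Ω canonθ canonΩ ε' Φ') : ε' = ε ∧ Set.EqOn Φ' Φ O := by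
  obtain ⟨e, f, hf⟩ := exists_isDualFrame hE hO h.smooth_θ h.smooth_Ω h.coframe
  have hd : ∀ {ε Φ}, IsCoframeMap O π θ Ω canonθ canonΩ ε Φ → ∀ x ∈ O,
      DifferentiableAt ℝ Φ x := fun {ε Φ} hΦ x hx =>
    (hΦ.smooth.contDiffAt (hO.mem_nhds hx)).differentiableAt (by simp)
  have hπ : ∀ {ε Φ}, IsCoframeMap O π θ Ω canonθ canonΩ ε Φ → ∀ x ∈ O,
      (fun y => (Φ y).1) =ᶠ[nhds x] π := fun {ε Φ} hΦ x hx =>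
    Filter.eventually_of_mem (hO.mem_nhds hx) hΦ.proj
  have key : ∀ {ε Φ}, IsCoframeMap O π θ Ω canonθ canonΩ ε Φ → ∀ x ∈ O,
      coefθ (Φ x).2 * pullCoef π e x = Matrix.diagonal (signθ ε) := by
    intro ε Φ hΦ x hx
    ext i k
    have h1 := congrArg (fun L => L (e k x)) (hΦ.pullback_θ x hx i)
    simp only [pullback_canonθ (hd hΦ x hx) (hπ hΦ x hx), sum_apply, smul_apply, smul_eq_mul,
      hf.θe x hx] at h1
    rw [Matrix.mul_apply]
    refine h1.trans ?_
    rw [Matrix.diagonal_apply]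
    split_ifs <;> simp
  have key' : ∀ {ε Φ}, IsCoframeMap O π θ Ω canonθ canonΩ ε Φ → ∀ x ∈ O, ∀ S,
      S * pullCoef π e x = 1 → coefθ (Φ x).2 = Matrix.diagonal (signθ ε) * S := by
    intro ε Φ hΦ x hx S hS
    rw [← key hΦ x hx, Matrix.mul_assoc, mul_eq_one_comm.1 hS, Matrix.mul_one]
  have hεε : ε' = ε := by
    obtain ⟨x, hx⟩ := hne
    obtain ⟨S, -, hS, -⟩ := h.exists_inverse hf hx
    have k1 := congrFun (congrFun (key' hΦ x hx S hS) 0) 0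
    have k2 := congrFun (congrFun (key' hΦ' x hx S hS) 0) 0
    rw [Matrix.diagonal_mul] at k1 k2
    have r1 : 0 < coefθ (Φ x).2 0 0 := sq_pos_of_ne_zero (hΦ.mapsTo hx)
    have r2 : 0 < coefθ (Φ' x).2 0 0 := sq_pos_of_ne_zero (hΦ'.mapsTo hx)
    rw [k1] at r1
    rw [k2] at r2
    rcases hε with rfl | rfl <;> rcases hε' with rfl | rfl <;> simp [signθ] at r1 r2 ⊢ <;> linarith
  subst hεε
  refine ⟨rfl, fun x hx => ?_⟩
  have hfour : ∀ y ∈ O, (Φ y).2 0 = (Φ' y).2 0 ∧ (Φ y).2 1 = (Φ' y).2 1 ∧ (Φ y).2 2 = (Φ' y).2 2 ∧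
      (Φ y).2 3 = (Φ' y).2 3 := by
    intro y hy
    obtain ⟨S, -, hS, -⟩ := h.exists_inverse hf hy
    exact params_eq_of_coefθ_eq (hΦ.mapsTo hy)
      ((key' hΦ y hy S hS).trans (key' hΦ' y hy S hS).symm)
  obtain ⟨p0, p1, p2, p3⟩ := hfour x hx
  have k1 := pullback_canonΩ_zero (hd hΦ x hx) (hπ hΦ x hx) (e 0 x)
  have k2 := pullback_canonΩ_zero (hd hΦ' x hx) (hπ hΦ' x hx) (e 0 x)
  have hfd : fderiv ℝ (fun y => (Φ y).2 0) x = fderiv ℝ (fun y => (Φ' y).2 0) x :=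
    Filter.EventuallyEq.fderiv_eq
      (Filter.eventually_of_mem (hO.mem_nhds hx) fun y hy => (hfour y hy).1)
  rw [hΦ.pullback_Ω x hx] at k1
  rw [hΦ'.pullback_Ω x hx, ← p0, ← p1, ← p2, ← p3, ← hfd, k1] at k2
  have hr : (Φ x).2 0 ≠ 0 := hΦ.mapsTo hx
  have hβ : pullback π (flatForms 0) x (e 0 x) ≠ 0 := by
    have := congrFun (congrFun (key hΦ x hx) 0) 0
    rw [Matrix.mul_apply, Fin.sum_univ_five] at this
    intro h0
    rw [pullCoef_apply, h0] at this
    rcases hε with rfl | rfl <;> simp [coefθ, signθ] at this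
  have p4 : (Φ x).2 4 = (Φ' x).2 4 := by
    have : (Φ x).2 0 ^ 2 * pullback π (flatForms 0) x (e 0 x) * ((Φ x).2 4 - (Φ' x).2 4) = 0 := by
      linarith
    have := (mul_eq_zero.1 this).resolve_left (mul_ne_zero (pow_ne_zero _ hr) hβ)
    linarith
  refine Prod.ext ((hΦ'.proj x hx).trans (hΦ.proj x hx).symm) (funext fun i => ?_)
  fin_cases i
  exacts [p0.symm, p1.symm, p2.symm, p3.symm, p4.symm]

end CoframeMap

/-! ### The chart of the homogeneous model -/

/-- The section `h` of the homogeneous model. -/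
def sectionH (m : JetSpace) : SO32 := mkSO (matH m) (matH_orthogonal m) (matH_det m)

theorem matSO_sectionH (m : JetSpace) : matSO (sectionH m) = matH m := rfl

/-- The matrices on which the inverse of the chart of the homogeneous model is defined. -/
def chartDomain : Set (Matrix (Fin 5) (Fin 5) ℝ) :=
  {A | A 3 3 ≠ 0 ∧ A 0 0 * A 3 3 - A 3 0 * A 0 3 ≠ 0}

/-- The inverse of the chart of the homogeneous model, as a function on matrices. -/
def chartInv (A : Matrix (Fin 5) (Fin 5) ℝ) : JetSpace :=
  -- Only the lines of columns 0 and 3 are meaningful modulo K. Dividing column 3 by A₃₃ gives x, y,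
  -- z. If column 0 is β times that of h, then d = βA₃₃, because the same minor of h is 1; this
  -- yields p and q.
  let d := A 0 0 * A 3 3 - A 3 0 * A 0 3
  ![A 2 3 / A 3 3, -2 * A 0 3 / A 3 3, -A 4 3 / A 3 3, (A 2 0 * A 3 3 - A 2 3 * A 3 0) / d,
    -(A 3 0 * A 3 3) / d]

theorem matH_mem_chartDomain (m : JetSpace) : matH m ∈ chartDomain := by
  constructor
  · simp [matH]
  · have : matH m 0 0 * matH m 3 3 - matH m 3 0 * matH m 0 3 = 1 := by
      simp [matH]; ring
    rw [this]; exact one_ne_zero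

theorem chartInv_matH (m : JetSpace) : chartInv (matH m) = m := by
  have : matH m 0 0 * matH m 3 3 - matH m 3 0 * matH m 0 3 = 1 := by
    simp [matH]; ring
  unfold chartInv
  simp only [this]
  ext i
  fin_cases i <;> simp [matH] <;> ring

theorem PreservesLines.mul_apply {N : Matrix (Fin 5) (Fin 5) ℝ} (hN : PreservesLines N)
    (A : Matrix (Fin 5) (Fin 5) ℝ) (i : Fin 5) :
    (A * N) i 0 = A i 0 * N 0 0 ∧ (A * N) i 3 = A i 3 * N 3 3 := by
  constructor
  · rw [Matrix.mul_apply, Finset.sum_eq_single 0]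
    · intro k _ hk; rw [hN.1 k hk, mul_zero]
    · simp
  · rw [Matrix.mul_apply, Finset.sum_eq_single 3]
    · intro k _ hk; rw [hN.2 k hk, mul_zero]
    · simp

/-- N rescales columns 0 and 3, and each component of `chartInv` is homogeneous of degree 0 in
either column. -/
theorem chartInv_mul {A N : Matrix (Fin 5) (Fin 5) ℝ} (hA : A ∈ chartDomain)
    (hN : PreservesLines N) (hN' : Nᵀ * formJ * N = formJ) :
    A * N ∈ chartDomain ∧ chartInv (A * N) = chartInv A := by
  obtain ⟨-, -, -, -, h0, h3⟩ := hN.shape hN'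
  have n0 : N 0 0 ≠ 0 := left_ne_zero_of_mul_eq_one h0
  have n3 : N 3 3 ≠ 0 := right_ne_zero_of_mul_eq_one h3
  obtain ⟨a3, ad⟩ := hA
  have e : (A * N) 0 0 * (A * N) 3 3 - (A * N) 3 0 * (A * N) 0 3 =
      (A 0 0 * A 3 3 - A 3 0 * A 0 3) * (N 0 0 * N 3 3) := by
    rw [(hN.mul_apply A 0).1, (hN.mul_apply A 3).1, (hN.mul_apply A 0).2, (hN.mul_apply A 3).2]
    ring
  have n03 := mul_ne_zero n0 n3
  refine ⟨⟨?_, ?_⟩, ?_⟩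
  · rw [(hN.mul_apply A 3).2]; exact mul_ne_zero a3 n3
  · rw [e]; exact mul_ne_zero ad n03
  · unfold chartInv
    simp only [e]
    simp only [(hN.mul_apply A _).1, (hN.mul_apply A _).2]
    generalize A 0 0 * A 3 3 - A 3 0 * A 0 3 = d at ad
    ext i
    fin_cases i <;> simp only [Matrix.cons_val, Fin.zero_eta, Fin.mk_one, Fin.reduceFinMk] <;>
      field_simp

/-- The chart accounts for all but three entries of the two columns. These are forced: A₁₃ by the
isotropy of column 3, A₁₀ by the orthogonality of the two columns, and A₄₀ by the isotropy of column
0. -/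
theorem columns_of_mem_chartDomain {A : Matrix (Fin 5) (Fin 5) ℝ} (hA : A ∈ chartDomain)
    (h : Aᵀ * formJ * A = formJ) : ∃ β : ℝ, ∀ i,
      A i 0 = matH (chartInv A) i 0 * β ∧ A i 3 = matH (chartInv A) i 3 * A 3 3 := by
  obtain ⟨a3, ad⟩ := hA
  have hβ0 : (A 0 0 * A 3 3 - A 3 0 * A 0 3) / A 3 3 ≠ 0 := div_ne_zero ad a3
  have e0 : A 2 3 = chartInv A 0 * A 3 3 := by
    simp only [chartInv, Matrix.cons_val]; field_simp
  have e1 : A 0 3 = -(chartInv A 1) / 2 * A 3 3 := by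
    simp only [chartInv, Matrix.cons_val]; field_simp
  have e2 : A 4 3 = -chartInv A 2 * A 3 3 := by
    simp only [chartInv, Matrix.cons_val]; field_simp
  have e4 : A 3 0 = -chartInv A 4 * ((A 0 0 * A 3 3 - A 3 0 * A 0 3) / A 3 3) := by
    simp only [chartInv, Matrix.cons_val]
    generalize A 0 0 * A 3 3 - A 3 0 * A 0 3 = d at ad
    field_simp
  have e3 : A 2 0 = (chartInv A 3 - chartInv A 4 * chartInv A 0) *
      ((A 0 0 * A 3 3 - A 3 0 * A 0 3) / A 3 3) := by
    simp only [chartInv, Matrix.cons_val]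
    generalize A 0 0 * A 3 3 - A 3 0 * A 0 3 = d at ad
    field_simp
    ring
  have e5 : A 0 0 = (A 0 0 * A 3 3 - A 3 0 * A 0 3) / A 3 3 - chartInv A 1 / 2 * A 3 0 := by
    simp only [chartInv, Matrix.cons_val]; field_simp; ring
  generalize (A 0 0 * A 3 3 - A 3 0 * A 0 3) / A 3 3 = β at hβ0 e3 e4 e5
  generalize chartInv A = m at *
  rw [isOrthogonal_iff] at h
  have h33 := h 3 3
  have h00 := h 0 0
  have h03 := h 0 3
  simp only [formJ, Matrix.of_apply, Matrix.cons_val] at h33 h00 h03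
  have f1 : A 1 3 = (m 0 ^ 2 + m 2 * m 1) / 2 * A 3 3 := by
    rw [e0, e1, e2] at h33
    apply mul_right_cancel₀ a3
    linear_combination -h33 / 2
  rw [e4] at e5
  have g1 : A 1 0 = -A 0 0 * m 2 + A 2 0 * m 0 - A 3 0 * (m 0 ^ 2 + m 2 * m 1) / 2
      - A 4 0 * m 1 / 2 := by
    rw [e0, e1, e2, f1] at h03
    apply mul_right_cancel₀ a3
    linear_combination -h03
  have g4 : A 4 0 = (-m 3 ^ 2 / 2 + m 4 * m 2) * β := by
    rw [g1, e3, e4, e5] at h00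
    apply mul_right_cancel₀ hβ0
    linear_combination h00 / 2
  refine ⟨β, fun i => ?_⟩
  fin_cases i <;>
    simp only [matH, Matrix.of_apply, Matrix.cons_val, Fin.zero_eta, Fin.mk_one, Fin.reduceFinMk]
  · exact ⟨by rw [e5]; ring, by rw [e1]; ring⟩
  · exact ⟨by rw [g1, g4, e3, e4, e5]; ring, by rw [f1]; ring⟩
  · exact ⟨by rw [e3], by rw [e0]⟩
  · exact ⟨by rw [e4], by ring⟩
  · exact ⟨by rw [g4]; ring, by rw [e2]⟩

theorem preservesLines_of_mem_chartDomain {A : Matrix (Fin 5) (Fin 5) ℝ} (hA : A ∈ chartDomain)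
    (h : Aᵀ * formJ * A = formJ) :
    PreservesLines (formJ * (matH (chartInv A))ᵀ * formJ * A) := by
  obtain ⟨β, hβ⟩ := columns_of_mem_chartDomain hA h
  have h1 := orthogonal_inv_left (matH_orthogonal (chartInv A))
  generalize formJ * (matH (chartInv A))ᵀ * formJ = P at h1
  have e0 : ∀ i, (P * A) i 0 = (P * matH (chartInv A)) i 0 * β := fun i => by
    simp only [Matrix.mul_apply, Finset.sum_mul, (hβ _).1, mul_assoc]
  have e3 : ∀ i, (P * A) i 3 = (P * matH (chartInv A)) i 3 * A 3 3 := fun i => by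
    rw [Matrix.mul_apply, Matrix.mul_apply, Finset.sum_mul]
    exact Finset.sum_congr rfl fun k _ => by rw [(hβ k).2, mul_assoc]
  constructor <;> intro i hi
  · rw [e0, h1, Matrix.one_apply_ne hi, zero_mul]
  · rw [e3, h1, Matrix.one_apply_ne hi, zero_mul]

theorem mk_eq_iff (A B : SO32) : (A : SO32 ⧸ lineStabilizer) = B ↔
    ∃ N : SO32, PreservesLines (matSO N) ∧ B = A * N := by
  rw [QuotientGroup.eq]
  constructor
  · exact fun h => ⟨_, h, by group⟩
  · rintro ⟨N, hN, rfl⟩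
    rw [inv_mul_cancel_left]; exact hN

theorem mk_eq_sectionH {B : SO32} (hB : matSO B ∈ chartDomain) :
    (B : SO32 ⧸ lineStabilizer) = sectionH (chartInv (matSO B)) := by
  refine (QuotientGroup.eq.2 ?_).symm
  rw [mem_lineStabilizer, matSO_mul, matSO_inv, matSO_sectionH]
  exact preservesLines_of_mem_chartDomain hB (matSO_orthogonal B)

theorem chartInv_of_mk_eq {A B : SO32} (hA : matSO A ∈ chartDomain)
    (h : (A : SO32 ⧸ lineStabilizer) = B) :
    matSO B ∈ chartDomain ∧ chartInv (matSO B) = chartInv (matSO A) := by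
  obtain ⟨N, hN, rfl⟩ := (mk_eq_iff A B).1 h
  rw [matSO_mul]
  exact chartInv_mul hA hN (matSO_orthogonal N)

theorem chartInv_of_sectionH_eq {m : JetSpace} {B : SO32}
    (h : (sectionH m : SO32 ⧸ lineStabilizer) = B) :
    matSO B ∈ chartDomain ∧ chartInv (matSO B) = m := by
  have := chartInv_of_mk_eq (A := sectionH m) (matH_mem_chartDomain m) h
  rwa [matSO_sectionH, chartInv_matH] at this

theorem continuous_entry (i j : Fin 5) : Continuous fun A : Matrix (Fin 5) (Fin 5) ℝ => A i j :=
  (continuous_apply j).comp (continuous_apply i)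

theorem isOpen_chartDomain : IsOpen chartDomain := by
  have c := continuous_entry
  exact (isOpen_ne_fun (c 3 3) continuous_const).inter
    (isOpen_ne_fun (((c 0 0).mul (c 3 3)).sub ((c 3 0).mul (c 0 3))) continuous_const)

theorem continuousOn_chartInv : ContinuousOn chartInv chartDomain := by
  have c : ∀ i j, ContinuousOn (fun A : Matrix (Fin 5) (Fin 5) ℝ => A i j) chartDomain :=
    fun i j => (continuous_entry i j).continuousOn
  have d := ((c 0 0).mul (c 3 3)).sub ((c 3 0).mul (c 0 3))
  refine continuousOn_pi.2 fun i => ?_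
  fin_cases i
  · exact (c 2 3).div (c 3 3) fun A hA => hA.1
  · exact (continuousOn_const.mul (c 0 3)).div (c 3 3) fun A hA => hA.1
  · exact (c 4 3).neg.div (c 3 3) fun A hA => hA.1
  · exact (((c 2 0).mul (c 3 3)).sub ((c 2 3).mul (c 3 0))).div d fun A hA => hA.2
  · exact ((c 3 0).mul (c 3 3)).neg.div d fun A hA => hA.2

theorem continuous_sectionH : Continuous sectionH :=
  continuous_of_matSO (continuous_matrix fun i j => (contDiff_matH i j).continuous)

/-- The image of an open V is the projection of the open set of those A in the chart domain for
which `chartInv A` lies in V, and the projection to the quotient is open. The same function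
`chartInv` gives injectivity. -/
theorem isOpenEmbedding_sectionH :
    Topology.IsOpenEmbedding fun m => (sectionH m : SO32 ⧸ lineStabilizer) := by
  refine .of_continuous_injective_isOpenMap (continuous_quotient_mk'.comp continuous_sectionH)
    (fun m m' h => ?_) fun V hV => ?_
  · have := (chartInv_of_sectionH_eq h).2
    rwa [matSO_sectionH, chartInv_matH, eq_comm] at this
  · have hop : IsOpen (matSO ⁻¹' (chartDomain ∩ chartInv ⁻¹' V)) :=
      (continuousOn_chartInv.isOpen_inter_preimage isOpen_chartDomain hV).preimage continuous_matSO
    convert QuotientGroup.isOpenMap_coe (N := lineStabilizer) _ hop using 1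
    ext x
    constructor
    · rintro ⟨m, hm, rfl⟩
      refine ⟨sectionH m, ⟨matH_mem_chartDomain m, ?_⟩, rfl⟩
      rw [Set.mem_preimage, matSO_sectionH, chartInv_matH]
      exact hm
    · rintro ⟨B, ⟨hB, hBV⟩, rfl⟩
      exact ⟨_, hBV, (mk_eq_sectionH hB).symm⟩

/-! ### Elements of the group act by symmetries -/

theorem contDiffOn_chartInv {E : Type*} [NormedAddCommGroup E] [NormedSpace ℝ E]
    {X : E → Matrix (Fin 5) (Fin 5) ℝ} {O : Set E}
    (hX : ∀ i j, ContDiffOn ℝ ∞ (fun x => X x i j) O) (hO : ∀ x ∈ O, X x ∈ chartDomain) :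
    ContDiffOn ℝ ∞ (fun x => chartInv (X x)) O := by
  have d := ((hX 0 0).mul (hX 3 3)).sub ((hX 3 0).mul (hX 0 3))
  refine contDiffOn_pi.2 fun i => ?_
  fin_cases i
  · exact (hX 2 3).div (hX 3 3) fun x hx => (hO x hx).1
  · exact (contDiffOn_const.mul (hX 0 3)).div (hX 3 3) fun x hx => (hO x hx).1
  · exact (hX 4 3).neg.div (hX 3 3) fun x hx => (hO x hx).1
  · exact (((hX 2 0).mul (hX 3 3)).sub ((hX 2 3).mul (hX 3 0))).div d fun x hx => (hO x hx).2
  · exact ((hX 3 0).mul (hX 3 3)).neg.div d fun x hx => (hO x hx).2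

/-- Off the diagonal, column 0 of the connection matrix contains just θ¹, θ², θ³ and column 3 just
θ⁵, θ⁴, θ¹. A gauge transformation that preserves both lines acts on each of these columns
separately. This is the block form of a change of para-CR coframe. -/
theorem paraCRRel_of_gauge {E : Type*} [NormedAddCommGroup E] [NormedSpace ℝ E]
    {θ θ' : Fin 5 → (E →L[ℝ] ℝ)} {N : Matrix (Fin 5) (Fin 5) ℝ} (hN : PreservesLines N)
    (hN' : Nᵀ * formJ * N = formJ)
    (h0 : ∀ v, ∀ i, i ≠ 0 → ![0, θ' 0 v, θ' 1 v, θ' 2 v, 0] i =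
      N 0 0 * ∑ k, (formJ * Nᵀ * formJ) i k * ![0, θ 0 v, θ 1 v, θ 2 v, 0] k)
    (h3 : ∀ v, ∀ i, i ≠ 3 → ![θ' 4 v, 0, θ' 3 v, 0, θ' 0 v] i =
      N 3 3 * ∑ k, (formJ * Nᵀ * formJ) i k * ![θ 4 v, 0, θ 3 v, 0, θ 0 v] k) :
    ParaCRRel θ θ' := by
  have hP := hN.inv hN'
  have hP' : (formJ * Nᵀ * formJ)ᵀ * formJ * (formJ * Nᵀ * formJ) = formJ := by
    have e := orthogonal_inv_right hN'
    generalize hP : formJ * Nᵀ * formJ = P at e ⊢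
    have := congrArg Matrix.transpose e
    rw [Matrix.transpose_mul, Matrix.transpose_one] at this
    calc Pᵀ * formJ * P = Pᵀ * (Nᵀ * formJ * N) * P := by rw [hN']
      _ = (Pᵀ * Nᵀ) * formJ * (N * P) := by simp only [Matrix.mul_assoc]
      _ = formJ := by rw [e, this, Matrix.one_mul, Matrix.mul_one]
  obtain ⟨-, -, -, -, n0, n3⟩ := hN.shape hN'
  have n00 : N 0 0 ≠ 0 := left_ne_zero_of_mul_eq_one n0
  have n33 : N 3 3 ≠ 0 := right_ne_zero_of_mul_eq_one n3
  generalize formJ * Nᵀ * formJ = P at *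
  obtain ⟨h12, h14, h41, h42, p0, p3⟩ := hP.shape hP'
  have h10 := hP.1 1 (by decide)
  have h20 := hP.1 2 (by decide)
  have h30 := hP.1 3 (by decide)
  have h40 := hP.1 4 (by decide)
  have h03 := hP.2 0 (by decide)
  have h13 := hP.2 1 (by decide)
  have h23 := hP.2 2 (by decide)
  have h43 := hP.2 4 (by decide)
  have h22 := (isOrthogonal_iff P).1 hP' 2 2
  simp only [formJ, Matrix.of_apply, Matrix.cons_val, h12, h42] at h22
  have p22 : P 2 2 ≠ 0 := fun h => by simp [h] at h22
  refine ⟨!![N 0 0 * P 1 1, 0, 0, 0, 0;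
             N 0 0 * P 2 1, N 0 0 * P 2 2, 0, 0, 0;
             N 0 0 * P 3 1, N 0 0 * P 3 2, N 0 0 * P 3 3, 0, 0;
             N 3 3 * P 2 4, 0, 0, N 3 3 * P 2 2, 0;
             N 3 3 * P 0 4, 0, 0, N 3 3 * P 0 2, N 3 3 * P 0 0], ⟨?_, ?_, ?_, ?_⟩, ?_⟩
  · rw [Matrix.det_of_isLowerTriangular _ (by
      intro i j hij
      fin_cases i <;> fin_cases j <;> first | rfl | exact absurd hij (by decide))]
    simp only [Fin.prod_univ_five, Matrix.of_apply, Matrix.cons_val]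
    have := left_ne_zero_of_mul_eq_one p0
    have := left_ne_zero_of_mul_eq_one p3
    have := right_ne_zero_of_mul_eq_one p3
    positivity
  · intro j hj; fin_cases j <;> first | rfl | exact absurd rfl hj
  · rintro i (rfl | rfl) j (rfl | rfl) <;> rfl
  · rintro i (rfl | rfl) j (rfl | rfl) <;> rfl
  · intro i
    refine ContinuousLinearMap.ext fun v => ?_
    have a1 := h0 v 1 (by decide)
    have a2 := h0 v 2 (by decide)
    have a3 := h0 v 3 (by decide)
    have b0 := h3 v 0 (by decide)
    have b2 := h3 v 2 (by decide)
    simp only [Fin.sum_univ_five, Matrix.cons_val, h10, h20, h30, h40, h03, h13, h23, h43, h12, h14,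
      h41, h42] at a1 a2 a3 b0 b2
    fin_cases i <;>
      simp only [Fin.sum_univ_five, Matrix.of_apply, Matrix.cons_val, Fin.zero_eta, Fin.mk_one,
        Fin.reduceFinMk, add_apply, smul_apply, smul_eq_mul]
    · rw [a1]; ring
    · rw [a2]; ring
    · rw [a3]; ring
    · rw [b2]; ring
    · rw [b0]; ring

/-- ψ is smooth because it equals `chartInv` of Ah. The matrix N = (Ah)⁻¹(h∘ψ) is K-valued, and
differentiating h∘ψ = AhN gives ψ^*W = N⁻¹WN + N⁻¹dN. As N preserves the lines on all of V, so does
dN, and the last term does not contribute off the diagonal in columns 0 and 3. -/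
theorem isLocalSymmetry_of_smul {A : SO32} {V : Set JetSpace} {ψ : JetSpace → JetSpace}
    (hV : IsOpen V) (h : ∀ m ∈ V, (sectionH (ψ m) : SO32 ⧸ lineStabilizer) =
      A • (sectionH m : SO32 ⧸ lineStabilizer)) : IsLocalSymmetry V ψ := by
  have hAH : ∀ i j, ContDiff ℝ ∞ fun m => (matSO A * matH m) i j := fun i j => by
    simp only [Matrix.mul_apply]
    exact ContDiff.sum fun k _ => contDiff_const.mul (contDiff_matH k j)
  have hc : ∀ m ∈ V, matSO A * matH m ∈ chartDomain ∧ chartInv (matSO A * matH m) = ψ m :=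
    fun m hm => chartInv_of_sectionH_eq (B := A * sectionH m) (h m hm)
  have hψ : ContDiffOn ℝ ∞ ψ V :=
    (contDiffOn_chartInv (fun i j => (hAH i j).contDiffOn) fun m hm => (hc m hm).1).congr
      fun m hm => (hc m hm).2.symm
  refine ⟨hψ, fun m hm => ?_⟩
  let N : JetSpace → Matrix (Fin 5) (Fin 5) ℝ := fun m =>
    formJ * (matSO A * matH m)ᵀ * formJ * matH (ψ m)
  have hN : ∀ m ∈ V, PreservesLines (N m) ∧ (N m)ᵀ * formJ * N m = formJ ∧
      matH (ψ m) = matSO A * matH m * N m := fun m hm => by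
    obtain ⟨N', h1, h2⟩ := (mk_eq_iff (A * sectionH m) (sectionH (ψ m))).1 (h m hm).symm
    have h3 : matH (ψ m) = matSO A * matH m * matSO N' := congrArg matSO h2
    have h4 : N m = matSO N' := by
      change formJ * (matSO A * matH m)ᵀ * formJ * matH (ψ m) = _
      have h5 := orthogonal_inv_left (matSO_orthogonal (A * sectionH m))
      rw [matSO_mul, matSO_sectionH] at h5
      rw [h3, ← Matrix.mul_assoc, h5, Matrix.one_mul]
    rw [h4]
    exact ⟨h1, matSO_orthogonal N', h3⟩
  have dψ : DifferentiableAt ℝ ψ m := (hψ.contDiffAt (hV.mem_nhds hm)).differentiableAt (by simp)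
  have dH : MatDiffAt (fun y => matH (ψ y)) m := (matDiffAt_matH (ψ m)).comp dψ
  have dB : MatDiffAt (fun y => matSO A * matH y) m :=
    (matDiffAt_const _ _).mul (matDiffAt_matH m)
  have dN : MatDiffAt N m := dB.conjJ.mul dH
  obtain ⟨n1, n2, n3⟩ := hN m hm
  have hdN : ∀ v, PreservesLines (matD N m v) := fun v => by
    have key : ∀ i j, (∀ y ∈ V, N y i j = 0) → matD N m v i j = 0 := fun i j hz => by
      rw [matD_apply, Filter.EventuallyEq.fderiv_eq (Filter.eventually_of_mem (hV.mem_nhds hm) hz)]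
      simp
    exact ⟨fun i hi => key i 0 fun y hy => (hN y hy).1.1 i hi,
      fun i hi => key i 3 fun y hy => (hN y hy).1.2 i hi⟩
  have hW : ∀ v, evalForm (connMatrix flatForms flatΩ) (ψ m) (fderiv ℝ ψ m v) =
      formJ * (N m)ᵀ * formJ * (evalForm (connMatrix flatForms flatΩ) m v * N m) +
      formJ * (N m)ᵀ * formJ * matD N m v := fun v => by
    have e1 := matD_comp (matDiffAt_matH (ψ m)) dψ v
    rw [matD_matH, matD_congr (Filter.eventually_of_mem (hV.mem_nhds hm) fun y hy =>
      (hN y hy).2.2) v, matD_mul dB dN, matD_const_mul _ (matDiffAt_matH m), matD_matH, n3] at e1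
    have e2 := congrArg (fun X => formJ * (N m)ᵀ * formJ *
      (formJ * (matSO A * matH m)ᵀ * formJ * X)) e1
    have e3 := orthogonal_inv_left (matSO_orthogonal (A * sectionH m))
    rw [matSO_mul, matSO_sectionH] at e3
    have e4 := orthogonal_inv_left n2
    generalize formJ * (N m)ᵀ * formJ = P at *
    generalize formJ * (matSO A * matH m)ᵀ * formJ = Q at *
    have e5 : ∀ X, Q * (matSO A * (matH m * X)) = X := fun X => by
      rw [← Matrix.mul_assoc (matSO A), ← Matrix.mul_assoc Q, e3, Matrix.one_mul]
    have e6 : ∀ X, P * (N m * X) = X := fun X => by rw [← Matrix.mul_assoc, e4, Matrix.one_mul]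
    simp only [Matrix.mul_assoc, Matrix.mul_add, e5, e6] at e2
    rw [← e2]
  have hcol : ∀ v i k, (∀ l, l ≠ k → N m l k = 0) →
      (formJ * (N m)ᵀ * formJ * matD N m v) i k = 0 →
      evalForm (connMatrix flatForms flatΩ) (ψ m) (fderiv ℝ ψ m v) i k =
      N m k k * ∑ l, (formJ * (N m)ᵀ * formJ) i l *
        evalForm (connMatrix flatForms flatΩ) m v l k := fun v i k hk h0 => by
    rw [hW, Matrix.add_apply, h0, add_zero, ← Matrix.mul_assoc, Matrix.mul_apply,
      Finset.sum_eq_single k (fun l _ hl => by rw [hk l hl, mul_zero]) (by simp), mul_comm,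
      Matrix.mul_apply]
  have hP := n1.inv n2
  refine paraCRRel_of_gauge n1 n2 (fun v i hi => ?_) fun v i hi => ?_
  · have e := hcol v i 0 n1.1 ((hP.mul (hdN v)).1 i hi)
    rw [Fin.sum_univ_five, hP.1 i hi, zero_mul] at e
    rw [Fin.sum_univ_five, hP.1 i hi, zero_mul]
    simp only [evalForm_connMatrix, Matrix.of_apply, Matrix.cons_val] at e
    simp only [Matrix.cons_val, pullback_apply]
    rw [← e]
    fin_cases i <;> first | exact absurd rfl hi | simp
  · have e := hcol v i 3 n1.2 ((hP.mul (hdN v)).2 i hi)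
    rw [Fin.sum_univ_five, hP.2 i hi, zero_mul] at e
    rw [Fin.sum_univ_five, hP.2 i hi, zero_mul]
    simp only [evalForm_connMatrix, Matrix.of_apply, Matrix.cons_val] at e
    simp only [Matrix.cons_val, pullback_apply]
    rw [← e]
    fin_cases i <;> first | exact absurd rfl hi | simp

/-! ### Uniqueness of the group element -/

/-- The second difference of the values at t₀ and t₀ ± δ/2 isolates c, then the first difference
isolates b. -/
theorem quadratic_eq_zero {a b c t₀ δ : ℝ} (hδ : 0 < δ)
    (h : ∀ t, |t - t₀| < δ → a + b * t + c * t ^ 2 = 0) : a = 0 ∧ b = 0 ∧ c = 0 := by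
  have h0 := h t₀ (by simpa using hδ)
  have h1 := h (t₀ + δ / 2) (by rw [add_sub_cancel_left, abs_of_pos] <;> linarith)
  have h2 := h (t₀ - δ / 2) (by rw [sub_sub_cancel_left, abs_neg, abs_of_pos] <;> linarith)
  have hc : c = 0 := by
    have : c * δ ^ 2 = 0 := by linear_combination 2 * h1 + 2 * h2 - 4 * h0
    exact (mul_eq_zero.1 this).resolve_right (pow_ne_zero 2 hδ.ne')
  subst hc
  have hb : b = 0 := by
    have : b * δ = 0 := by linear_combination h1 - h2
    exact (mul_eq_zero.1 this).resolve_right hδ.ne'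
  subst hb
  exact ⟨by linear_combination h0, rfl, rfl⟩

theorem linear_eq_zero {a b t₀ δ : ℝ} (hδ : 0 < δ)
    (h : ∀ t, |t - t₀| < δ → a + b * t = 0) : a = 0 ∧ b = 0 := by
  have := quadratic_eq_zero (a := a) (b := b) (c := 0) hδ fun t ht => by
    rw [zero_mul, add_zero]; exact h t ht
  exact ⟨this.1, this.2.1⟩

/-- The fourth columns of the matrices `matH m` span the whole space. -/
theorem eq_zero_of_column_mul {c : Fin 5 → ℝ} {x₀ y₀ z₀ δ : ℝ} (hδ : 0 < δ)
    (h : ∀ x y z : ℝ, |x - x₀| < δ → |y - y₀| < δ → |z - z₀| < δ →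
      c 0 * (-y / 2) + c 1 * ((x ^ 2 + z * y) / 2) + c 2 * x + c 3 - c 4 * z = 0) : c = 0 := by
  have hz : ∀ x y : ℝ, |x - x₀| < δ → |y - y₀| < δ →
      c 0 * (-y / 2) + c 1 * (x ^ 2 / 2) + c 2 * x + c 3 = 0 ∧ c 1 * y / 2 - c 4 = 0 :=
    fun x y hx hy => linear_eq_zero hδ fun z hz => by linear_combination h x y z hx hy hz
  have hx0 : |x₀ - x₀| < δ := by simpa using hδ
  obtain ⟨h4, h1⟩ := linear_eq_zero (a := -c 4) (b := c 1 / 2) hδ fun y hy => by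
    linear_combination (hz x₀ y hx0 hy).2
  have h1' : c 1 = 0 := by linarith
  have hy : ∀ x : ℝ, |x - x₀| < δ → c 2 * x + c 3 = 0 ∧ -c 0 / 2 = 0 := fun x hx =>
    linear_eq_zero hδ fun y hy => by
      linear_combination (hz x y hx hy).1 - x ^ 2 / 2 * h1'
  obtain ⟨h3, h2⟩ := linear_eq_zero (a := c 3) (b := c 2) hδ fun x hx => by
    linear_combination (hy x hx).1
  have h0 := (hy x₀ hx0).2
  ext i
  fin_cases i <;> simp only [Fin.zero_eta, Fin.mk_one, Fin.reduceFinMk, Pi.zero_apply] <;> linarith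

/-- Each v = (-y/2, (x² + zy)/2, x, 1, -z) in the box is an eigenvector, and its eigenvalue is entry
3 of Av since v₃ = 1. Comparing leading coefficients shows that this eigenvalue is the constant A₃₃.
These v span, so A = A₃₃·1, and A₃₃⁵ = det A = 1 gives A₃₃ = 1. -/
theorem eq_one_of_eigenvector {A : Matrix (Fin 5) (Fin 5) ℝ} (hd : A.det = 1) {x₀ y₀ z₀ δ : ℝ}
    (hδ : 0 < δ) (h : ∀ x y z : ℝ, |x - x₀| < δ → |y - y₀| < δ → |z - z₀| < δ → ∀ i,
      A i 0 * (-y / 2) + A i 1 * ((x ^ 2 + z * y) / 2) + A i 2 * x + A i 3 - A i 4 * z =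
      ![-y / 2, (x ^ 2 + z * y) / 2, x, 1, -z] i *
      (A 3 0 * (-y / 2) + A 3 1 * ((x ^ 2 + z * y) / 2) + A 3 2 * x + A 3 3 - A 3 4 * z)) :
    A = 1 := by
  have hx0 : |x₀ - x₀| < δ := by simpa using hδ
  have hy0 : |y₀ - y₀| < δ := by simpa using hδ
  have hz0 : |z₀ - z₀| < δ := by simpa using hδ
  -- The coefficients compared are, in order, those of z² in row 4, y² in row 0, yz in row 2 and x²
  -- in row 2.
  obtain ⟨h34, h31⟩ := linear_eq_zero (a := -A 3 4) (b := A 3 1 / 2) hδ fun y hy =>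
    (quadratic_eq_zero
      (a := A 4 0 * (-y / 2) + A 4 1 * (x₀ ^ 2 / 2) + A 4 2 * x₀ + A 4 3)
      (b := A 4 1 * y / 2 - A 4 4 + (A 3 0 * (-y / 2) + A 3 1 * (x₀ ^ 2 / 2) + A 3 2 * x₀ + A 3 3))
      hδ fun z hz => by
        have := h x₀ y z hx0 hy hz 4
        simp only [Matrix.cons_val] at this
        linear_combination this).2.2
  replace h34 : A 3 4 = 0 := by linarith
  replace h31 : A 3 1 = 0 := by linarith
  obtain ⟨-, -, h30⟩ := quadratic_eq_zero
    (a := A 0 1 * (x₀ ^ 2 / 2) + A 0 2 * x₀ + A 0 3 - A 0 4 * z₀)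
    (b := -A 0 0 / 2 + A 0 1 * z₀ / 2 + (A 3 2 * x₀ + A 3 3) / 2) (c := -A 3 0 / 4)
    hδ fun y hy => by
      have := h x₀ y z₀ hx0 hy hz0 0
      simp only [Matrix.cons_val, h34, h31] at this
      linear_combination this
  replace h30 : A 3 0 = 0 := by linarith
  obtain ⟨-, h21⟩ := linear_eq_zero (a := -A 2 4) (b := A 2 1 / 2) hδ fun y hy =>
    (linear_eq_zero (a := A 2 0 * (-y / 2) + A 2 1 * (x₀ ^ 2 / 2) + A 2 2 * x₀ + A 2 3 -
        x₀ * (A 3 2 * x₀ + A 3 3)) hδ fun z hz => by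
      have := h x₀ y z hx0 hy hz 2
      simp only [Matrix.cons_val, h34, h31, h30] at this
      linear_combination this).2
  replace h21 : A 2 1 = 0 := by linarith
  obtain ⟨-, -, h32⟩ := quadratic_eq_zero
    (a := A 2 0 * (-y₀ / 2) + A 2 3 - A 2 4 * z₀) (b := A 2 2 - A 3 3) (c := -A 3 2) hδ fun x hx => by
      have := h x y₀ z₀ hx hy0 hz0 2
      simp only [Matrix.cons_val, h34, h31, h30, h21] at this
      linear_combination this
  replace h32 : A 3 2 = 0 := by linarith
  have hA : A = A 3 3 • (1 : Matrix (Fin 5) (Fin 5) ℝ) := by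
    have key : ∀ i, (fun j => A i j - A 3 3 * (1 : Matrix (Fin 5) (Fin 5) ℝ) i j) = 0 := fun i =>
      eq_zero_of_column_mul hδ fun x y z hx hy hz => by
        have := h x y z hx hy hz i
        simp only [h34, h31, h30, h32] at this
        fin_cases i <;> simp [Matrix.one_apply] at this ⊢ <;> linear_combination this
    ext i j
    have := congrFun (key i) j
    simp only [Pi.zero_apply] at this
    rw [Matrix.smul_apply, smul_eq_mul]
    linarith
  rw [hA, Matrix.det_smul, Matrix.det_one, mul_one, Fintype.card_fin] at hd
  have h1 : A 3 3 = 1 := (Odd.strictMono_pow (by decide : Odd 5)).injective (by simpa using hd)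
  rw [hA, h1, one_smul]

theorem exists_box_subset {V : Set JetSpace} (hV : IsOpen V) {m : JetSpace} (hm : m ∈ V) :
    ∃ δ > 0, ∀ x y z : ℝ, |x - m 0| < δ → |y - m 1| < δ → |z - m 2| < δ →
      (![x, y, z, m 3, m 4] : JetSpace) ∈ V := by
  obtain ⟨δ, hδ, hb⟩ := Metric.isOpen_iff.1 hV m hm
  refine ⟨δ, hδ, fun x y z hx hy hz => hb ?_⟩
  rw [Metric.mem_ball, dist_pi_lt_iff hδ]
  intro i
  rw [Real.dist_eq]
  fin_cases i <;> simp_all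

/-- Only column 3 of Ah(m) = h(m)N is used, with p and q frozen and x, y, z varying in a box. -/
theorem eq_one_of_smul_sectionH_eq {A : SO32} {V : Set JetSpace} (hV : IsOpen V) (hne : V.Nonempty)
    (h : ∀ m ∈ V, A • (sectionH m : SO32 ⧸ lineStabilizer) = sectionH m) : A = 1 := by
  obtain ⟨m, hm⟩ := hne
  obtain ⟨δ, hδ, hb⟩ := exists_box_subset hV hm
  refine matSO_injective (eq_one_of_eigenvector (x₀ := m 0) (y₀ := m 1) (z₀ := m 2) (matSO_det A) hδ
    fun x y z hx hy hz i => ?_)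
  have hv := hb x y z hx hy hz
  obtain ⟨N, hN, e⟩ := (mk_eq_iff _ (A * sectionH _)).1 (h _ hv).symm
  have e' : ∀ i, (matSO A * matH ![x, y, z, m 3, m 4]) i 3 =
      matH ![x, y, z, m 3, m 4] i 3 * matSO N 3 3 := fun i => by
    rw [← (hN.mul_apply _ i).2]
    exact congrFun (congrFun (congrArg matSO e) i) 3
  have e3 := e' 3
  have ei := e' i
  simp only [Matrix.mul_apply, Fin.sum_univ_five, matH, Matrix.of_apply, Matrix.cons_val] at e3 ei
  have e4 : matSO A 3 0 * (-y / 2) + matSO A 3 1 * ((x ^ 2 + z * y) / 2) + matSO A 3 2 * x +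
      matSO A 3 3 - matSO A 3 4 * z = matSO N 3 3 := by linear_combination e3
  rw [e4]
  fin_cases i <;> simp only [Matrix.of_apply, Matrix.cons_val, Fin.zero_eta, Fin.mk_one, Fin.reduceFinMk] at ei ⊢ <;>
    linear_combination ei

theorem eq_of_smul_sectionH_eq {A B : SO32} {V : Set JetSpace} (hV : IsOpen V) (hne : V.Nonempty)
    (h : ∀ m ∈ V, A • (sectionH m : SO32 ⧸ lineStabilizer) = B • (sectionH m : SO32 ⧸ lineStabilizer)) :
    A = B := by
  have := eq_one_of_smul_sectionH_eq (A := B⁻¹ * A) hV hne fun m hm => by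
    rw [mul_smul, h m hm, inv_smul_smul]
  rwa [inv_mul_eq_one, eq_comm] at this

theorem faithfulSMul_quotient : FaithfulSMul SO32 (SO32 ⧸ lineStabilizer) :=
  ⟨fun h => eq_of_smul_sectionH_eq isOpen_univ Set.univ_nonempty fun _ _ => h _⟩

/-! ### Local symmetries come from the group -/

theorem paraCR_mul {S T : Matrix (Fin 5) (Fin 5) ℝ} (hS : S ∈ paraCRMatrices)
    (hT : T ∈ paraCRMatrices) : S * T ∈ paraCRMatrices := by
  obtain ⟨hd, h0, h1, h2⟩ := hS
  obtain ⟨kd, k0, k1, k2⟩ := hT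
  have a := h0 1 (by decide)
  have b := h0 2 (by decide)
  have c := h0 3 (by decide)
  have d := h0 4 (by decide)
  refine ⟨by rw [Matrix.det_mul]; exact mul_ne_zero hd kd, fun j hj => ?_, fun i hi j hj => ?_,
    fun i hi j hj => ?_⟩
  · rw [Matrix.mul_apply, Fin.sum_univ_five, a, b, c, d, k0 j hj]
    ring
  · rw [Matrix.mul_apply, Fin.sum_univ_five, h1 i hi 3 (by simp), h1 i hi 4 (by simp),
      k1 1 (by simp) j hj, k1 2 (by simp) j hj,
      k0 j (by rcases hj with rfl | rfl <;> decide)]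
    ring
  · rw [Matrix.mul_apply, Fin.sum_univ_five, h2 i hi 1 (by simp), h2 i hi 2 (by simp),
      k2 3 (by simp) j hj, k2 4 (by simp) j hj,
      k0 j (by rcases hj with rfl | rfl <;> decide)]
    ring

/-- The forms ψ^*ω and ω differ by a para-CR matrix, so the canonical coframe is adapted to ψ after
the projection as well. The restriction to r > 0 keeps the domain connected when V is. -/
theorem isAdaptedCoframe_canon_comp {V : Set JetSpace} {ψ : JetSpace → JetSpace} (hV : IsOpen V)
    (hψ : IsLocalSymmetry V ψ) :
    IsAdaptedCoframe (V ×ˢ {b : Params | 0 < b 0}) (fun p => ψ p.1) canonθ canonΩ := by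
  have hsub : V ×ˢ {b : Params | 0 < b 0} ⊆ bundle := fun p hp => ne_of_gt hp.2
  refine ⟨hψ.1.comp contDiff_fst.contDiffOn fun p hp => hp.1,
    fun i => (contDiffOn_canonθ i).mono hsub, fun i => (contDiffOn_canonΩ i).mono hsub,
    fun p hp => isAdaptedCoframe_canon.coframe p (hsub hp), fun p hp => ?_,
    fun p hp => isAdaptedCoframe_canon.structureEquations p (hsub hp)⟩
  obtain ⟨S, hS, hSψ⟩ := hψ.2 p.1 hp.1
  have hd : DifferentiableAt ℝ ψ p.1 :=
    (hψ.1.contDiffAt (hV.mem_nhds hp.1)).differentiableAt (by simp)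
  refine ⟨coefθ p.2 * S⁻¹, paraCR_mul (coefθ_mem (hsub hp)) (paraCR_inv hS), fun i =>
    ContinuousLinearMap.ext fun v => ?_⟩
  have hf : fderiv ℝ (fun p : BundleSpace => ψ p.1) p v = fderiv ℝ ψ p.1 v.1 := by
    rw [fderiv_fun_comp p hd differentiableAt_fst, fderiv_fst]
    rfl
  have h1 : ∀ j, flatForms j (ψ p.1) (fderiv ℝ ψ p.1 v.1) = (S *ᵥ fun k => flatForms k p.1 v.1) j :=
    fun j => by
      have := congrArg (fun L => L v.1) (hSψ j)
      simpa [pullback_apply, sum_apply, Matrix.mulVec, dotProduct] using this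
  have h2 : canonθ i p v = (coefθ p.2 *ᵥ fun k => flatForms k p.1 v.1) i := canonθ_apply_eq_sum p v i
  have h3 : (∑ j, (coefθ p.2 * S⁻¹) i j • pullback (fun p : BundleSpace => ψ p.1) (flatForms j) p) v =
      ((coefθ p.2 * S⁻¹) *ᵥ (S *ᵥ fun k => flatForms k p.1 v.1)) i := by
    simp only [sum_apply, smul_apply, smul_eq_mul, pullback_apply, hf, h1]
    rfl
  rw [h2, h3, Matrix.mulVec_mulVec, Matrix.mul_assoc,
    Matrix.nonsing_inv_mul _ (isUnit_iff_ne_zero.2 hS.1), Matrix.mul_one]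

/-- The group element by which a coframe map twists the connection. -/
def signMatrix (ε : ℝ) : Matrix (Fin 5) (Fin 5) ℝ := Matrix.diagonal ![ε, 1, 1, 1, ε]

theorem signMatrix_mul_self {ε : ℝ} (hε : ε = 1 ∨ ε = -1) : signMatrix ε * signMatrix ε = 1 := by
  ext i j
  fin_cases i <;> fin_cases j <;> rcases hε with rfl | rfl <;> simp [signMatrix]

theorem exists_matSO_eq_signMatrix {ε : ℝ} (hε : ε = 1 ∨ ε = -1) :
    ∃ D ∈ lineStabilizer, matSO D = signMatrix ε := by
  rcases hε with rfl | rfl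
  · refine ⟨1, lineStabilizer.one_mem, ?_⟩
    rw [matSO_one]
    ext i j
    fin_cases i <;> fin_cases j <;> simp [signMatrix]
  · exact ⟨elemE, preservesLines_reflE, rfl⟩

theorem IsCoframeMap.evalForm_connMatrix {E : Type*} [NormedAddCommGroup E] [NormedSpace ℝ E]
    {O : Set E} {π : E → JetSpace} {θ Ω : Fin 5 → OneForm E} {ε : ℝ} {Φ : E → BundleSpace}
    (hΦ : IsCoframeMap O π θ Ω canonθ canonΩ ε Φ) (hε : ε = 1 ∨ ε = -1) {x : E} (hx : x ∈ O) (v : E) :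
    evalForm (connMatrix canonθ canonΩ) (Φ x) (fderiv ℝ Φ x v) =
      signMatrix ε * evalForm (connMatrix θ Ω) x v * signMatrix ε := by
  have hθ : ∀ i, canonθ i (Φ x) (fderiv ℝ Φ x v) = signθ ε i * θ i x v := fun i =>
    congrArg (fun L => L v) (hΦ.pullback_θ x hx i)
  have hΩ : ∀ i, canonΩ i (Φ x) (fderiv ℝ Φ x v) = signΩ ε i * Ω i x v := fun i =>
    congrArg (fun L => L v) (hΦ.pullback_Ω x hx i)
  rw [_root_.evalForm_connMatrix, _root_.evalForm_connMatrix, signMatrix]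
  ext i j
  rw [Matrix.mul_diagonal, Matrix.diagonal_mul]
  simp only [hθ, hΩ, signθ, signΩ]
  have h2 : ε * ε = 1 := by rcases hε with rfl | rfl <;> norm_num
  fin_cases i <;> fin_cases j <;>
    simp only [Matrix.of_apply, Matrix.cons_val, Fin.zero_eta, Fin.mk_one, Fin.reduceFinMk] <;>
    try ring1
  · linear_combination -(Ω 0 x v / 2 - Ω 1 x v) * h2
  · linear_combination -(-(Ω 0 x v / 2) + Ω 1 x v) * h2

/-- This is d(H⁻¹) = -ωH⁻¹. With H⁻¹ = JHᵀJ it reduces to Jωᵀ = -ωJ, that is to ω being in so(3,2).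
-/
theorem matD_conjJ_bundleH {p : BundleSpace} (hp : p ∈ bundle) (v : BundleSpace) :
    matD (fun q => formJ * (bundleH q)ᵀ * formJ) p v =
      -(evalForm (connMatrix canonθ canonΩ) p v * (formJ * (bundleH p)ᵀ * formJ)) := by
  have hd := matDiffAt_bundleH hp
  have hW := (mem_so32_iff _).1 (evalForm_connMatrix_mem canonθ canonΩ p v)
  rw [matD_mul_const (X := fun q => formJ * (bundleH q)ᵀ) _ ((matDiffAt_const _ _).mul hd.transpose),
    matD_const_mul _ hd.transpose,
    matD_transpose, matD_bundleH hp, Matrix.transpose_mul]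
  generalize evalForm (connMatrix canonθ canonΩ) p v = W at *
  have h1 : formJ * Wᵀ = -(W * formJ) := by
    have h2 := congrArg (fun X => formJ * X * formJ) (eq_neg_of_add_eq_zero_left hW)
    simp only [Matrix.mul_assoc, formJ_mul_formJ, Matrix.mul_one, Matrix.mul_neg, Matrix.neg_mul]
      at h2
    rw [h2, ← Matrix.mul_assoc, formJ_mul_formJ, Matrix.one_mul]
  rw [← Matrix.mul_assoc formJ, h1]
  simp only [Matrix.mul_assoc, Matrix.neg_mul]

theorem eq_of_matD_eq_zero {E : Type*} [NormedAddCommGroup E] [NormedSpace ℝ E] {O : Set E}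
    {X : E → Matrix (Fin 5) (Fin 5) ℝ} (hO : IsOpen O) (hO' : IsPreconnected O)
    (hX : ∀ x ∈ O, MatDiffAt X x) (h : ∀ x ∈ O, ∀ v, matD X x v = 0) {x y : E} (hx : x ∈ O)
    (hy : y ∈ O) : X x = X y := by
  ext i j
  refine hO.is_const_of_fderiv_eq_zero hO' (f := fun x => X x i j)
    (fun z hz => (hX z hz i j).differentiableWithinAt) (fun z hz => ?_) hx hy
  exact ContinuousLinearMap.ext fun v => congrFun (congrFun (h z hz v) i) j

/-- Let Φ be the coframe map of the canonical coframe over ψ, so that Φ^*ω = DωD with D =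
`signMatrix ε`. Then X = (H∘Φ)DH⁻¹ has dX = (H∘Φ)(DωDD - Dω)H⁻¹ = 0. On the identity section the
constant X equals h(ψ m)k h(m)⁻¹ with k in K, so it carries the coset of h(m) to that of h(ψ m). -/
theorem exists_smul_of_isLocalSymmetry {V : Set JetSpace} {ψ : JetSpace → JetSpace} (hV : IsOpen V)
    (hc : IsConnected V) (hψ : IsLocalSymmetry V ψ) : ∃ A : SO32, ∀ m ∈ V,
      (sectionH (ψ m) : SO32 ⧸ lineStabilizer) = A • (sectionH m : SO32 ⧸ lineStabilizer) := by
  have hO : IsOpen (V ×ˢ {b : Params | 0 < b 0}) :=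
    hV.prod (isOpen_lt continuous_const (continuous_apply 0))
  have hOc : IsPreconnected (V ×ˢ {b : Params | 0 < b 0}) := by
    refine hc.isPreconnected.prod (Convex.isPreconnected ?_)
    intro a ha b hb s t hs ht hst
    have ha' : 0 < a 0 := ha
    have hb' : 0 < b 0 := hb
    change 0 < s * a 0 + t * b 0
    rcases hs.eq_or_lt with rfl | hs
    · rw [zero_add] at hst; subst hst; linarith
    · have := mul_nonneg ht hb'.le
      have := mul_pos hs ha'
      linarith
  have hsub : V ×ˢ {b : Params | 0 < b 0} ⊆ bundle := fun p hp => ne_of_gt hp.2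
  obtain ⟨ε, hε, Φ, hΦ⟩ := exists_isCoframeMap finrank_bundleSpace hO hOc
    (isAdaptedCoframe_canon_comp hV hψ)
  let X : BundleSpace → Matrix (Fin 5) (Fin 5) ℝ := fun p =>
    bundleH (Φ p) * signMatrix ε * (formJ * (bundleH p)ᵀ * formJ)
  have dΦ : ∀ p ∈ V ×ˢ {b : Params | 0 < b 0}, DifferentiableAt ℝ Φ p := fun p hp =>
    (hΦ.smooth.contDiffAt (hO.mem_nhds hp)).differentiableAt (by simp)
  have d1 : ∀ p ∈ V ×ˢ {b : Params | 0 < b 0}, MatDiffAt (fun q => bundleH (Φ q)) p :=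
    fun p hp => (matDiffAt_bundleH (hΦ.mapsTo hp)).comp (dΦ p hp)
  have d2 : ∀ p ∈ V ×ˢ {b : Params | 0 < b 0},
      MatDiffAt (fun q => bundleH (Φ q) * signMatrix ε) p :=
    fun p hp => (d1 p hp).mul (matDiffAt_const _ _)
  have d3 : ∀ p ∈ V ×ˢ {b : Params | 0 < b 0},
      MatDiffAt (fun q => formJ * (bundleH q)ᵀ * formJ) p :=
    fun p hp => (matDiffAt_bundleH (hsub hp)).conjJ
  have hX : ∀ p ∈ V ×ˢ {b : Params | 0 < b 0}, ∀ q ∈ V ×ˢ {b : Params | 0 < b 0}, X p = X q := by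
    intro p hp q hq
    refine eq_of_matD_eq_zero hO hOc (fun p hp => (d2 p hp).mul (d3 p hp)) (fun p hp v => ?_) hp hq
    rw [matD_mul (d2 p hp) (d3 p hp), matD_mul_const _ (d1 p hp),
      matD_comp (matDiffAt_bundleH (hΦ.mapsTo hp)) (dΦ p hp), matD_bundleH (hΦ.mapsTo hp),
      matD_conjJ_bundleH (hsub hp), hΦ.evalForm_connMatrix hε hp]
    have := signMatrix_mul_self hε
    simp only [Matrix.mul_assoc, this, Matrix.mul_one, Matrix.mul_neg, add_neg_cancel]
  obtain ⟨D, hD, hDε⟩ := exists_matSO_eq_signMatrix hε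
  have hmem : ∀ m ∈ V, ((m, idParam) : BundleSpace) ∈ V ×ˢ {b : Params | 0 < b 0} := fun m hm =>
    ⟨hm, by simp [idParam]⟩
  have key : ∀ m ∈ V, ∃ k ∈ lineStabilizer,
      matSO (sectionH (ψ m) * k * (sectionH m)⁻¹) = X (m, idParam) := fun m hm => by
    have hb : (Φ (m, idParam)).2 ∈ paramSet := hΦ.mapsTo (hmem m hm)
    refine ⟨(elemU (Φ (m, idParam)).2 hb)⁻¹ * D,
      lineStabilizer.mul_mem (lineStabilizer.inv_mem (preservesLines_matU _)) hD, ?_⟩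
    have hπ : (Φ (m, idParam)).1 = ψ m := hΦ.proj _ (hmem m hm)
    have h1 : matUinv idParam = 1 := by rw [← matU_inv_eq idParam_mem, matU_idParam, inv_one]
    change _ = bundleH (Φ (m, idParam)) * signMatrix ε * (formJ * (matH m * matUinv idParam)ᵀ * formJ)
    rw [matSO_mul, matSO_mul, matSO_mul, matSO_inv, matSO_inv, matSO_elemU, hDε, matSO_sectionH,
      matSO_sectionH, bundleH, hπ, h1, Matrix.mul_one, matUinv]
    simp only [Matrix.mul_assoc]
  obtain ⟨m₀, hm₀⟩ := hc.nonempty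
  obtain ⟨k₀, -, hk₀⟩ := key m₀ hm₀
  refine ⟨sectionH (ψ m₀) * k₀ * (sectionH m₀)⁻¹, fun m hm => ?_⟩
  obtain ⟨k, hk, hkm⟩ := key m hm
  have := matSO_injective (hk₀.trans ((hX _ (hmem m₀ hm₀) _ (hmem m hm)).trans hkm.symm))
  rw [this]
  refine QuotientGroup.eq.2 ?_
  simpa only [smul_eq_mul, mul_assoc, inv_mul_cancel, mul_one, inv_mul_cancel_left] using hk

/-! ### Connectedness of the homogeneous model -/

/-- The vectors v of column 3 span, so some v has g = (Av)₃ ≠ 0; let f = (Av)₀. Suppose that the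
minor vanishes for q = 0 and all p. Then w = g·row₀ - f·row₃, which kills v, also kills column 0 of
h for all p, and so w = t(Jv)ᵀ. Row 3 is orthogonal to rows 0 and 3, so pairing with it gives tg = 0
and w = 0. But w pairs with row 4 to g. -/
theorem exists_mul_matH_mem_chartDomain (A : SO32) : ∃ m, matSO A * matH m ∈ chartDomain := by
  have hA := orthogonal_inv_right (matSO_orthogonal A)
  rw [formJ_conj] at hA
  generalize matSO A = A at *
  have k : ∀ i j, _ := fun i j => congrFun (congrFun hA i) j
  have k01 := k 0 1
  have k31 := k 3 1
  have k00 := k 0 0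
  have k30 := k 3 0
  have k33 := k 3 3
  simp only [Matrix.mul_apply, Fin.sum_univ_five, Matrix.of_apply, Matrix.cons_val] at k01 k31 k00 k30 k33
  rw [Matrix.one_apply_ne (by decide)] at k01 k31 k30
  rw [Matrix.one_apply_eq] at k00 k33
  obtain ⟨x, y, z, hg⟩ : ∃ x y z : ℝ,
      A 3 0 * (-y / 2) + A 3 1 * ((x ^ 2 + z * y) / 2) + A 3 2 * x + A 3 3 - A 3 4 * z ≠ 0 := by
    by_contra hcon
    push Not at hcon
    have h0 := eq_zero_of_column_mul (c := A 3) (x₀ := 0) (y₀ := 0) (z₀ := 0) one_pos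
      fun x y z _ _ _ => hcon x y z
    simp [h0] at k33
  by_contra hcon
  push Not at hcon
  set g := A 3 0 * (-y / 2) + A 3 1 * ((x ^ 2 + z * y) / 2) + A 3 2 * x + A 3 3 - A 3 4 * z with hgd
  set f := A 0 0 * (-y / 2) + A 0 1 * ((x ^ 2 + z * y) / 2) + A 0 2 * x + A 0 3 - A 0 4 * z with hfd
  have hD : ∀ p : ℝ, (A 0 0 - z * A 0 1 + p * (x * A 0 1 + A 0 2) + p ^ 2 * (y / 4 * A 0 1 - A 0 4 / 2)) * g -
      (A 3 0 - z * A 3 1 + p * (x * A 3 1 + A 3 2) + p ^ 2 * (y / 4 * A 3 1 - A 3 4 / 2)) * f = 0 := by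
    intro p
    have hz : (A * matH ![x, y, z, p, 0]) 0 0 * (A * matH ![x, y, z, p, 0]) 3 3 -
        (A * matH ![x, y, z, p, 0]) 3 0 * (A * matH ![x, y, z, p, 0]) 0 3 = 0 := by
      by_contra h0
      refine hcon ![x, y, z, p, 0] ⟨?_, h0⟩
      convert hg using 1
      simp only [Matrix.mul_apply, Fin.sum_univ_five, matH, Matrix.of_apply, Matrix.cons_val]
      rw [hgd]; ring
    simp only [Matrix.mul_apply, Fin.sum_univ_five, matH, Matrix.of_apply, Matrix.cons_val] at hz
    rw [hgd, hfd]
    linear_combination hz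
  -- The minor is a quadratic polynomial in p; three values give its coefficients.
  have c0 := hD 0
  have c1 := hD 1
  have c2 := hD (-1)
  -- the combination of the two rows that annihilates the fourth column is a multiple of `J v`
  have e0 : g * A 0 0 - f * A 3 0 = z * (g * A 0 1 - f * A 3 1) := by linear_combination c0
  have e2 : g * A 0 2 - f * A 3 2 = -x * (g * A 0 1 - f * A 3 1) := by
    linear_combination (c1 - c2) / 2
  have e4 : g * A 0 4 - f * A 3 4 = y / 2 * (g * A 0 1 - f * A 3 1) := by
    linear_combination 2 * c0 - c1 - c2
  have e3 : g * A 0 3 - f * A 3 3 = (x ^ 2 + y * z) / 2 * (g * A 0 1 - f * A 3 1) := by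
    have : g * f - f * g = 0 := by ring
    nth_rewrite 1 [hfd] at this
    nth_rewrite 2 [hgd] at this
    linear_combination this + y / 2 * e0 - x * e2 + z * e4
  have ht : g * A 0 1 - f * A 3 1 = 0 := by
    have h1 : (g * A 0 1 - f * A 3 1) * g = 0 := by
      nth_rewrite 2 [hgd]
      linear_combination g * k01 - f * k31 + A 3 4 * e0 + A 3 2 * e2 - A 3 1 * e3 + A 3 0 * e4
    exact (mul_eq_zero.1 h1).resolve_right hg
  rw [ht] at e0 e2 e3 e4
  exact hg (by linear_combination -g * k00 + f * k30 + A 4 4 * e0 - A 4 3 * ht + A 4 2 * e2 - A 4 1 * e3 + A 4 0 * e4)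

theorem exists_eq_smul_sectionH (x : SO32 ⧸ lineStabilizer) (m : JetSpace) :
    ∃ A : SO32, x = A • (sectionH m : SO32 ⧸ lineStabilizer) := by
  induction x using QuotientGroup.induction_on with
  | H B => exact ⟨B * (sectionH m)⁻¹, congrArg _ (inv_mul_cancel_right B (sectionH m)).symm⟩

/-- Every point lies in a translate of the chart. Each translate is connected and meets the chart
itself by `exists_mul_matH_mem_chartDomain`. -/
theorem preconnectedSpace_quotient : PreconnectedSpace (SO32 ⧸ lineStabilizer) := by
  have hc := isOpenEmbedding_sectionH.continuous
  have hr := isPreconnected_range hc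
  refine ⟨isPreconnected_of_forall (sectionH 0 : SO32 ⧸ lineStabilizer) fun x _ => ?_⟩
  obtain ⟨A, rfl⟩ := exists_eq_smul_sectionH x 0
  obtain ⟨m, hm⟩ := exists_mul_matH_mem_chartDomain A
  have ht := isPreconnected_range (hc.const_smul A)
  have h1 : A • (sectionH m : SO32 ⧸ lineStabilizer) ∈
      Set.range fun m => (sectionH m : SO32 ⧸ lineStabilizer) :=
    ⟨_, (mk_eq_sectionH (B := A * sectionH m) hm).symm⟩
  exact ⟨_, Set.subset_univ _, Or.inl ⟨0, rfl⟩, Or.inr ⟨0, rfl⟩, IsPreconnected.union _ h1 (Set.mem_range_self m) hr ht⟩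

/-! ### Automorphisms of the homogeneous model -/

theorem eq_of_smul_eq_on_open {A B : SO32} {U : Set (SO32 ⧸ lineStabilizer)} (hU : IsOpen U)
    (hne : U.Nonempty) (h : ∀ x ∈ U, A • x = B • x) : A = B := by
  obtain ⟨x, hx⟩ := hne
  obtain ⟨C, rfl⟩ := exists_eq_smul_sectionH x 0
  have hV : IsOpen ((fun m => C • (sectionH m : SO32 ⧸ lineStabilizer)) ⁻¹' U) :=
    hU.preimage (isOpenEmbedding_sectionH.continuous.const_smul C)
  have := eq_of_smul_sectionH_eq (A := A * C) (B := B * C) hV ⟨0, hx⟩ fun m hm => by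
    rw [mul_smul, mul_smul]; exact h _ hm
  exact mul_right_cancel this

theorem isModelSymmetry_of_smul {Ψ : (SO32 ⧸ lineStabilizer) ≃ₜ (SO32 ⧸ lineStabilizer)} {A : SO32}
    (h : ∀ x, Ψ x = A • x) :
    IsModelSymmetry (fun m => (sectionH m : SO32 ⧸ lineStabilizer)) Ψ := by
  intro B B' V ψ hV hψ
  refine isLocalSymmetry_of_smul (A := B'⁻¹ * A * B) hV fun m hm => ?_
  rw [mul_smul, mul_smul, ← h, hψ m hm, inv_smul_smul]

/-- In charts centred at x and at Ψ x the map is a local symmetry on a small ball. Balls are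
connected, so a single group element gives it there. -/
theorem IsModelSymmetry.exists_local_smul
    {Ψ : (SO32 ⧸ lineStabilizer) ≃ₜ (SO32 ⧸ lineStabilizer)}
    (h : IsModelSymmetry (fun m => (sectionH m : SO32 ⧸ lineStabilizer)) Ψ)
    (x : SO32 ⧸ lineStabilizer) :
    ∃ A : SO32, ∃ U, IsOpen U ∧ x ∈ U ∧ ∀ y ∈ U, Ψ y = A • y := by
  obtain ⟨A, rfl⟩ := exists_eq_smul_sectionH x 0
  obtain ⟨A', hA'⟩ := exists_eq_smul_sectionH (Ψ (A • (sectionH 0 : SO32 ⧸ lineStabilizer))) 0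
  have hι := isOpenEmbedding_sectionH
  have hf : Continuous fun m => A'⁻¹ • Ψ (A • (sectionH m : SO32 ⧸ lineStabilizer)) :=
    (Ψ.continuous.comp (hι.continuous.const_smul A)).const_smul A'⁻¹
  have hV := hι.isOpen_range.preimage hf
  obtain ⟨δ, hδ, hb⟩ := Metric.isOpen_iff.1 hV 0
    ⟨0, (eq_inv_smul_iff.2 hA'.symm)⟩
  choose! ψ hψ using fun m (hm : m ∈ Metric.ball (0 : JetSpace) δ) => hb hm
  have hψ' : ∀ m ∈ Metric.ball (0 : JetSpace) δ, Ψ (A • (sectionH m : SO32 ⧸ lineStabilizer)) =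
      A' • (sectionH (ψ m) : SO32 ⧸ lineStabilizer) := fun m hm =>
    (eq_inv_smul_iff.1 (hψ m hm)).symm
  obtain ⟨B, hB⟩ := exists_smul_of_isLocalSymmetry Metric.isOpen_ball
    (Metric.isConnected_ball hδ) (h A A' _ ψ Metric.isOpen_ball hψ')
  refine ⟨A' * B * A⁻¹, (A • ·) '' ((fun m => (sectionH m : SO32 ⧸ lineStabilizer)) ''
    Metric.ball 0 δ), (isOpenMap_smul A) _ (hι.isOpenMap _ Metric.isOpen_ball),
    ⟨_, ⟨0, Metric.mem_ball_self hδ, rfl⟩, rfl⟩, ?_⟩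
  rintro _ ⟨_, ⟨m, hm, rfl⟩, rfl⟩
  change Ψ (A • (sectionH m : SO32 ⧸ lineStabilizer)) = _
  rw [hψ' m hm, hB m hm, mul_smul, mul_smul, inv_smul_smul]

/-- A group element is determined by its action on any nonempty open set, so the local elements
agree on overlaps. They form a locally constant function on a connected space. -/
theorem isModelSymmetry_iff (Ψ : (SO32 ⧸ lineStabilizer) ≃ₜ (SO32 ⧸ lineStabilizer)) :
    IsModelSymmetry (fun m => (sectionH m : SO32 ⧸ lineStabilizer)) Ψ ↔
      ∃ A : SO32, ∀ x, Ψ x = A • x := by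
  refine ⟨fun h => ?_, fun ⟨A, hA⟩ => isModelSymmetry_of_smul hA⟩
  choose a U hU hx ha using h.exists_local_smul
  have hloc : IsLocallyConstant a := (IsLocallyConstant.iff_exists_open a).2 fun x =>
    ⟨U x, hU x, hx x, fun y hy => eq_of_smul_eq_on_open ((hU y).inter (hU x)) ⟨y, hx y, hy⟩
      fun z hz => (ha y z hz.1).symm.trans (ha x z hz.2)⟩
  have := preconnectedSpace_quotient
  refine ⟨a (sectionH 0), fun x => ?_⟩
  rw [ha x x (hx x), hloc.apply_eq_of_preconnectedSpace x (sectionH 0)]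

/-! ### The embedding of the parameters -/

/-- `paramOf` is a left inverse that is continuous on the set A₁₁A₄₄ > 0, which contains the image.
-/
theorem isEmbedding_matU : Topology.IsEmbedding fun b : paramSet => matU b := by
  have hc : Continuous fun b : paramSet => matU b :=
    continuous_matrix fun i j => continuousOn_iff_continuous_domRestrict.1 (contDiffOn_matU i j).continuousOn
  have hp : ContinuousOn paramOf {A | 0 < A 1 1 * A 4 4} := by
    have c : ∀ i j, ContinuousOn (fun A : Matrix (Fin 5) (Fin 5) ℝ => A i j)
        {A | 0 < A 1 1 * A 4 4} := fun i j => (continuous_entry i j).continuousOn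
    have h4 : ∀ A ∈ {A : Matrix (Fin 5) (Fin 5) ℝ | 0 < A 1 1 * A 4 4}, A 4 4 ≠ 0 :=
      fun A hA => right_ne_zero_of_mul (ne_of_gt hA)
    have h1 : ∀ A ∈ {A : Matrix (Fin 5) (Fin 5) ℝ | 0 < A 1 1 * A 4 4}, A 1 1 ≠ 0 :=
      fun A hA => left_ne_zero_of_mul (ne_of_gt hA)
    have hφ : ContinuousOn (fun A : Matrix (Fin 5) (Fin 5) ℝ => Real.log (A 4 4 / A 1 1) / 2)
        {A | 0 < A 1 1 * A 4 4} :=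
      (((c 4 4).div (c 1 1) h1).log fun A hA => div_ne_zero (h4 A hA) (h1 A hA)).div_const 2
    have hr := (c 4 4).mul hφ.neg.rexp
    refine continuousOn_pi.2 fun i => ?_
    fin_cases i
    · exact hr
    · exact hφ
    · exact (hr.pow 2).mul (c 3 2)
    · exact ((hr.pow 2).mul (c 0 2)).neg
    · exact ((((c 3 4).mul hφ.neg.rexp).add ((c 0 1).mul hφ.rexp)).neg).div hr
        fun A hA => mul_ne_zero (h4 A hA) (Real.exp_pos _).ne'
  let f : paramSet → {A : Matrix (Fin 5) (Fin 5) ℝ | 0 < A 1 1 * A 4 4} :=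
    fun b => ⟨matU b, matU_diag_pos b.2⟩
  have hf : Continuous f := hc.subtype_mk _
  have hg : ∀ A : {A : Matrix (Fin 5) (Fin 5) ℝ | 0 < A 1 1 * A 4 4},
      paramOf A ∈ paramSet := fun A =>
    mul_ne_zero (right_ne_zero_of_mul (ne_of_gt A.2)) (Real.exp_pos _).ne'
  let g : {A : Matrix (Fin 5) (Fin 5) ℝ | 0 < A 1 1 * A 4 4} → paramSet :=
    fun A => ⟨paramOf A, hg A⟩
  have hgc : Continuous g := (continuousOn_iff_continuous_domRestrict.1 hp).subtype_mk _
  have hgf : Function.LeftInverse g f := fun b => Subtype.ext (paramOf_matU b.2)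
  exact Topology.IsEmbedding.subtypeVal.comp (hgf.isEmbedding hgc hf)

theorem fderiv_bundleH {p : BundleSpace} (hp : p ∈ bundle) (v : BundleSpace) (i j : Fin 5) :
    fderiv ℝ (fun p' : BundleSpace => (matSO (sectionH p'.1) * (matU p'.2)⁻¹) i j) p v =
      (matSO (sectionH p.1) * (matU p.2)⁻¹ * evalForm (connMatrix canonθ canonΩ) p v) i j := by
  have h : (fun p' : BundleSpace => matSO (sectionH p'.1) * (matU p'.2)⁻¹) =ᶠ[nhds p] bundleH :=
    Filter.eventually_of_mem (bundle_isOpen.mem_nhds hp) fun q hq => by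
      change matSO (sectionH q.1) * (matU q.2)⁻¹ = bundleH q
      rw [bundleH, matU_inv_eq (b := q.2) hq, matSO_sectionH]
  have h2 := matD_congr h v
  rw [matD_bundleH hp, ← h.self_of_nhds] at h2
  exact congrFun (congrFun h2 i) j

end

/-! ### The main theorem -/

theorem mainTheorem3 :
    -- the forms represent a para-CR structure, that of the PDE system
    IsParaCR flatForms ∧
    (∀ m, ParaCRRel (fun j => pdeForms j m) (fun i => flatForms i m)) ∧
    -- the matrices `U` form a 5-dimensional embedded Lie subgroup `G` of `SO(3, 2)`
    (∃ G : Subgroup SO32, ∀ A : SO32, A ∈ G ↔ ∃ b ∈ paramSet, matSO A = matU b) ∧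
    (∀ b ∈ paramSet, ∃ A : SO32, matSO A = matU b) ∧
    matU idParam = 1 ∧
    (∀ i j, ContDiffOn ℝ ∞ (fun b => matU b i j) paramSet) ∧
    Topology.IsEmbedding (fun b : paramSet => matU b) ∧
    (∀ b ∈ paramSet, ∀ β : Params,
      (∀ i j, fderiv ℝ (fun b' => matU b' i j) b β = 0) → β = 0) ∧
    -- for arbitrary forms, the structure equations are the Maurer-Cartan equations of `so(3, 2)`
    (∀ (θ Ω : Fin 5 → OneForm BundleSpace) (x : BundleSpace),
      (∀ i, DifferentiableAt ℝ (θ i) x) → (∀ i, DifferentiableAt ℝ (Ω i) x) →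
      (StructureEquations θ Ω x ↔ IsFlatAt (connMatrix θ Ω) x)) ∧
    -- the canonical coframe on the bundle
    ∃ θ Ω : Fin 5 → OneForm BundleSpace,
      IsAdaptedCoframe bundle Prod.fst θ Ω ∧
      (∀ m : JetSpace,
        (∀ i, pullback (fun m' : JetSpace => ((m', idParam) : BundleSpace)) (θ i) m = flatForms i m) ∧
        (∀ i, pullback (fun m' : JetSpace => ((m', idParam) : BundleSpace)) (Ω i) m =
          if i = 1 then m 4 • flatForms 4 m else 0)) ∧
      -- local uniqueness of the bundle with its coframe
      (∀ (O : Set (Fin 10 → ℝ)) (π : (Fin 10 → ℝ) → JetSpace)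
        (θ' Ω' : Fin 5 → OneForm (Fin 10 → ℝ)),
        IsOpen O → IsConnected O → IsAdaptedCoframe O π θ' Ω' →
        ∃ ε : ℝ, (ε = 1 ∨ ε = -1) ∧ ∃ Φ : (Fin 10 → ℝ) → BundleSpace,
          IsCoframeMap O π θ' Ω' θ Ω ε Φ ∧
          ∀ (ε' : ℝ) (Φ' : (Fin 10 → ℝ) → BundleSpace), (ε' = 1 ∨ ε' = -1) →
            IsCoframeMap O π θ' Ω' θ Ω ε' Φ' → ε' = ε ∧ Set.EqOn Φ' Φ O) ∧
      -- the flat Cartan connection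
      IsCartanConnection (connMatrix θ Ω) ∧
      (∀ p ∈ bundle, IsFlatAt (connMatrix θ Ω) p) ∧
      -- the homogeneous model and the symmetry group
      ∃ K : Subgroup SO32,
        (∀ A : SO32, A ∈ K ↔ ∃ b ∈ paramSet, matSO A = matU b ∨ matSO A = reflE * matU b) ∧
        ∃ h : JetSpace → SO32,
          (∀ i j, ContDiff ℝ ∞ (fun m => matSO (h m) i j)) ∧
          (∀ p ∈ bundle, ∀ v : BundleSpace, ∀ i j,
            fderiv ℝ (fun p' : BundleSpace => (matSO (h p'.1) * (matU p'.2)⁻¹) i j) p v =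
              (matSO (h p.1) * (matU p.2)⁻¹ * evalForm (connMatrix θ Ω) p v) i j) ∧
          Topology.IsOpenEmbedding (fun m => (h m : SO32 ⧸ K)) ∧
          (∀ (A : SO32) (V : Set JetSpace) (ψ : JetSpace → JetSpace), IsOpen V →
            (∀ m ∈ V, (h (ψ m) : SO32 ⧸ K) = A • (h m : SO32 ⧸ K)) → IsLocalSymmetry V ψ) ∧
          (∀ (V : Set JetSpace) (ψ : JetSpace → JetSpace), IsOpen V → IsConnected V →
            IsLocalSymmetry V ψ →
            ∃! A : SO32, ∀ m ∈ V, (h (ψ m) : SO32 ⧸ K) = A • (h m : SO32 ⧸ K)) ∧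
          (∀ Ψ : (SO32 ⧸ K) ≃ₜ (SO32 ⧸ K),
            IsModelSymmetry (fun m => (h m : SO32 ⧸ K)) Ψ ↔
              ∃ A : SO32, ∀ x, Ψ x = A • x) ∧
          FaithfulSMul SO32 (SO32 ⧸ K) := by
  refine ⟨isParaCR_flatForms, paraCRRel_pdeForms, ⟨structureGroup, mem_structureGroup_iff⟩,
    fun b hb => ⟨elemU b hb, matSO_elemU b hb⟩, matU_idParam, contDiffOn_matU, isEmbedding_matU,
    fun b hb β h => matD_matU_injective hb (Matrix.ext h), fun θ Ω x _ hΩ =>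
      structureEquations_iff_isFlatAt θ Ω x hΩ,
    canonθ, canonΩ, isAdaptedCoframe_canon, canon_identity_section, ?_, isCartanConnection_canon,
    fun p hp => isFlatAt_canon hp, lineStabilizer, mem_lineStabilizer_iff, sectionH, contDiff_matH,
    fun p hp v i j => fderiv_bundleH hp v i j, isOpenEmbedding_sectionH,
    fun A V ψ hV h => isLocalSymmetry_of_smul hV h, fun V ψ hV hc hψ => ?_, isModelSymmetry_iff,
    faithfulSMul_quotient⟩
  · intro O π θ' Ω' hO hc h
    have hE : Module.finrank ℝ (Fin 10 → ℝ) = 10 := by simp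
    obtain ⟨ε, hε, Φ, hΦ⟩ := exists_isCoframeMap hE hO hc.isPreconnected h
    exact ⟨ε, hε, Φ, hΦ, fun ε' Φ' hε' hΦ' => hΦ.unique hE hO hc.nonempty h hε hε' hΦ'⟩
  · obtain ⟨A, hA⟩ := exists_smul_of_isLocalSymmetry hV hc hψ
    exact ⟨A, hA, fun B hB => eq_of_smul_sectionH_eq hV hc.nonempty fun m hm =>
      (hB m hm).symm.trans (hA m hm)⟩
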